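/- Let $\mathbf{emTT}$ be the extensional level of the Minimalist Foundation: the extensional dependent type theory with four kinds of types $prop_s \hookrightarrow prop \hookrightarrow col$, $prop_s \hookrightarrow set \hookrightarrow col$ (small propositions, propositions, sets, collections), fully annotated terms and a canonical proof-term $\mathsf{true}$ for propositions; its propositions are closed under intuitionistic logic with equality and are proof-irrelevant, propositional equality reflects judgemental equality, its sets are closed under $\mathsf{N}_0$, $\mathsf{N}_1$, $\Sigma$, $\Pi$, $+$, $\mathsf{List}$ and effective quotients by small equivalence relations, and its collections are closed under $\Sigma$ and contain the power collection $\mathcal{P}(1)$ of small propositions up to equiprovability and the collections $A \to \mathcal{P}(1)$ for every set $A$. Write $\varphi\ \mathsf{true}\ [\Gamma]$ for $\mathsf{true} \in \varphi\ [\Gamma]$, $\neg\varphi$ for $\varphi \Rightarrow \bot$, and $\varphi \Leftrightarrow \psi$ for $(\varphi \Rightarrow \psi) \wedge (\psi \Rightarrow \varphi)$. Let $\mathbf{emTT}_{\mathsf{imp}}$ be the extension of $\mathbf{emTT}$ by the resizing rules $$\frac{A\ col}{A\ set} \qquad \frac{\varphi\ prop}{\varphi\ prop_s},$$ and let $\mathbf{emTT}^c_{\mathsf{imp}}$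 be the extension of $\mathbf{emTT}_{\mathsf{imp}}$ by the Law of Excluded Middle: from $\varphi\ prop$ infer $\varphi \vee \neg\varphi\ \mathsf{true}$. For either theory $T$, let $T + \mathsf{propext}$ be the extension of $T$ by the rules of propositional extensionality $$\frac{\varphi\ prop \quad \psi\ prop \quad \varphi \Leftrightarrow \psi\ \mathsf{true}}{\varphi = \psi\ prop} \qquad \frac{\varphi\ prop_s \quad \psi\ prop_s \quad \varphi \Leftrightarrow \psi\ \mathsf{true}}{\varphi = \psi\ prop_s}.$$ **Proposition.** $\mathbf{emTT}_{\mathsf{imp}} + \mathsf{propext}$ is conservative over $\mathbf{emTT}_{\mathsf{imp}}$, and $\mathbf{emTT}^c_{\mathsf{imp}} + \mathsf{propext}$ is conservative over $\mathbf{emTT}^c_{\mathsf{imp}}$. That is, for $T$ either of $\mathbf{emTT}_{\mathsf{imp}}$ and $\mathbf{emTT}^c_{\mathsf{imp}}$, for every context $\Gamma$ and every $\varphi$: if $T \vdash \varphi\ prop\ [\Gamma]$ and $T + \mathsf{propext} \vdash \varphi\ \mathsf{true}\ [\Gamma]$, then $T \vdash \varphi\ \mathsf{true}\ [\Gamma]$.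 -/

import Mathlib

namespace EmTT

/-! ### Kinds of types

The four kinds `prop_s`, `prop`, `set`, `col`: propositions and collections, each of them either
small or of arbitrary size. -/

/-- Small or large. -/
inductive Size where
  | small
  | large

/-- The four kinds of types. -/
inductive Kind where
  | proposition (s : Size)
  | collection (s : Size)

namespace Kind

/-- Small propositions. -/
abbrev props : Kind := .proposition .small

/-- Propositions. -/
abbrev prop : Kind := .proposition .large

/-- Sets. -/
abbrev set : Kind := .collection .small

/-- Collections. -/
abbrev col : Kind := .collection .large

end Kind

/-! ### Pre-syntax

Well-scoped de Bruijn syntax: `PreExp n` is the set of pre-types, pre-propositions and pre-terms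
with free variables among `0, …, n - 1`, where `0` is the most recently declared one. An argument
in `PreExp (n + k)` binds `k` variables. Terms are fully annotated: every term constructor carries
what is needed to read off the type of the term. -/

/-- Pre-types, pre-propositions and pre-terms in `n` variables. -/
inductive PreExp : ℕ → Type where
  /-- variables -/
  | var {n : ℕ} (i : Fin n) : PreExp n
  /-- the empty set `N₀` -/
  | empty {n : ℕ} : PreExp n
  /-- the singleton set `N₁` -/
  | unit {n : ℕ} : PreExp n
  /-- `(Σ x ∈ A) B` -/
  | sigma {n : ℕ} (A : PreExp n) (B : PreExp (n + 1)) : PreExp n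
  /-- `(Π x ∈ A) B` -/
  | pi {n : ℕ} (A : PreExp n) (B : PreExp (n + 1)) : PreExp n
  /-- the disjoint sum `A + B` -/
  | sum {n : ℕ} (A B : PreExp n) : PreExp n
  /-- `List(A)` -/
  | list {n : ℕ} (A : PreExp n) : PreExp n
  /-- the quotient `A / (x, y). R` -/
  | quot {n : ℕ} (A : PreExp n) (R : PreExp (n + 2)) : PreExp n
  /-- the power collection `P(1)` of the singleton -/
  | pow {n : ℕ} : PreExp n
  /-- falsum -/
  | bot {n : ℕ} : PreExp n
  /-- conjunction -/
  | and {n : ℕ} (φ ψ : PreExp n) : PreExp n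
  /-- disjunction -/
  | or {n : ℕ} (φ ψ : PreExp n) : PreExp n
  /-- implication -/
  | imp {n : ℕ} (φ ψ : PreExp n) : PreExp n
  /-- `(∃ x ∈ A) φ` -/
  | ex {n : ℕ} (A : PreExp n) (φ : PreExp (n + 1)) : PreExp n
  /-- `(∀ x ∈ A) φ` -/
  | all {n : ℕ} (A : PreExp n) (φ : PreExp (n + 1)) : PreExp n
  /-- the propositional equality `Eq(A, a, b)` -/
  | eq {n : ℕ} (A a b : PreExp n) : PreExp n
  /-- the canonical proof-term `true` of the proposition `φ` -/
  | tt {n : ℕ} (φ : PreExp n) : PreExp n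
  /-- elimination of `N₀` towards the collection `(z). M` -/
  | elEmpty {n : ℕ} (M : PreExp (n + 1)) (c : PreExp n) : PreExp n
  /-- the element of `N₁` -/
  | star {n : ℕ} : PreExp n
  /-- elimination of `N₁` -/
  | elUnit {n : ℕ} (M : PreExp (n + 1)) (t c : PreExp n) : PreExp n
  /-- the pair `⟨a, b⟩` in `(Σ x ∈ A) B` -/
  | pair {n : ℕ} (A : PreExp n) (B : PreExp (n + 1)) (a b : PreExp n) : PreExp n
  /-- elimination `El(d, (x, y). m)` of `(Σ x ∈ A) B` -/
  | elSigma {n : ℕ} (A : PreExp n) (B M : PreExp (n + 1)) (d : PreExp n)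
      (m : PreExp (n + 2)) : PreExp n
  /-- `(λ x ∈ A) b` in `(Π x ∈ A) B` -/
  | lam {n : ℕ} (A : PreExp n) (B b : PreExp (n + 1)) : PreExp n
  /-- `Ap(f, a)` for `f` in `(Π x ∈ A) B` -/
  | app {n : ℕ} (A : PreExp n) (B : PreExp (n + 1)) (f a : PreExp n) : PreExp n
  /-- left injection in `A + B` -/
  | inl {n : ℕ} (A B a : PreExp n) : PreExp n
  /-- right injection in `A + B` -/
  | inr {n : ℕ} (A B b : PreExp n) : PreExp n
  /-- elimination `El(d, (x). l, (y). r)` of `A + B` -/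
  | elSum {n : ℕ} (A B : PreExp n) (M : PreExp (n + 1)) (d : PreExp n)
      (l r : PreExp (n + 1)) : PreExp n
  /-- the empty list of `List(A)` -/
  | nil {n : ℕ} (A : PreExp n) : PreExp n
  /-- `cons(s, a)`: the list `s` of `List(A)` extended by `a` -/
  | cons {n : ℕ} (A s a : PreExp n) : PreExp n
  /-- elimination `El(s, a, (x, y, z). l)` of `List(A)`; `x` is a list, `y` an element of `A`, and
  `z` the value at `x` -/
  | elList {n : ℕ} (A : PreExp n) (M : PreExp (n + 1)) (s a : PreExp n)
      (l : PreExp (n + 3)) : PreExp n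
  /-- the class `[a]` in `A / R` -/
  | cls {n : ℕ} (A : PreExp n) (R : PreExp (n + 2)) (a : PreExp n) : PreExp n
  /-- elimination `El(p, (x). l)` of `A / R` -/
  | elQuot {n : ℕ} (A : PreExp n) (R : PreExp (n + 2)) (M : PreExp (n + 1)) (p : PreExp n)
      (l : PreExp (n + 1)) : PreExp n
  /-- the class `[φ]` of the small proposition `φ` in `P(1)` -/
  | code {n : ℕ} (φ : PreExp n) : PreExp n

namespace PreExp

/-- Lifting a renaming under a binder. -/
def liftRen {n m : ℕ} (ρ : Fin n → Fin m) : Fin (n + 1) → Fin (m + 1) :=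
  Fin.cons 0 fun i => (ρ i).succ

/-- Renaming of variables. -/
def rename : {n m : ℕ} → (Fin n → Fin m) → PreExp n → PreExp m
  | _, _, ρ, var i => var (ρ i)
  | _, _, _, empty => empty
  | _, _, _, unit => unit
  | _, _, ρ, sigma A B => sigma (A.rename ρ) (B.rename (liftRen ρ))
  | _, _, ρ, pi A B => pi (A.rename ρ) (B.rename (liftRen ρ))
  | _, _, ρ, sum A B => sum (A.rename ρ) (B.rename ρ)
  | _, _, ρ, list A => list (A.rename ρ)
  | _, _, ρ, quot A R => quot (A.rename ρ) (R.rename (liftRen (liftRen ρ)))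
  | _, _, _, pow => pow
  | _, _, _, bot => bot
  | _, _, ρ, and φ ψ => and (φ.rename ρ) (ψ.rename ρ)
  | _, _, ρ, or φ ψ => or (φ.rename ρ) (ψ.rename ρ)
  | _, _, ρ, imp φ ψ => imp (φ.rename ρ) (ψ.rename ρ)
  | _, _, ρ, ex A φ => ex (A.rename ρ) (φ.rename (liftRen ρ))
  | _, _, ρ, all A φ => all (A.rename ρ) (φ.rename (liftRen ρ))
  | _, _, ρ, eq A a b => eq (A.rename ρ) (a.rename ρ) (b.rename ρ)
  | _, _, ρ, tt φ => tt (φ.rename ρ)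
  | _, _, ρ, elEmpty M c => elEmpty (M.rename (liftRen ρ)) (c.rename ρ)
  | _, _, _, star => star
  | _, _, ρ, elUnit M t c => elUnit (M.rename (liftRen ρ)) (t.rename ρ) (c.rename ρ)
  | _, _, ρ, pair A B a b =>
      pair (A.rename ρ) (B.rename (liftRen ρ)) (a.rename ρ) (b.rename ρ)
  | _, _, ρ, elSigma A B M d m =>
      elSigma (A.rename ρ) (B.rename (liftRen ρ)) (M.rename (liftRen ρ)) (d.rename ρ)
        (m.rename (liftRen (liftRen ρ)))
  | _, _, ρ, lam A B b => lam (A.rename ρ) (B.rename (liftRen ρ)) (b.rename (liftRen ρ))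
  | _, _, ρ, app A B f a => app (A.rename ρ) (B.rename (liftRen ρ)) (f.rename ρ) (a.rename ρ)
  | _, _, ρ, inl A B a => inl (A.rename ρ) (B.rename ρ) (a.rename ρ)
  | _, _, ρ, inr A B b => inr (A.rename ρ) (B.rename ρ) (b.rename ρ)
  | _, _, ρ, elSum A B M d l r =>
      elSum (A.rename ρ) (B.rename ρ) (M.rename (liftRen ρ)) (d.rename ρ)
        (l.rename (liftRen ρ)) (r.rename (liftRen ρ))
  | _, _, ρ, nil A => nil (A.rename ρ)
  | _, _, ρ, cons A s a => cons (A.rename ρ) (s.rename ρ) (a.rename ρ)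
  | _, _, ρ, elList A M s a l =>
      elList (A.rename ρ) (M.rename (liftRen ρ)) (s.rename ρ) (a.rename ρ)
        (l.rename (liftRen (liftRen (liftRen ρ))))
  | _, _, ρ, cls A R a => cls (A.rename ρ) (R.rename (liftRen (liftRen ρ))) (a.rename ρ)
  | _, _, ρ, elQuot A R M p l =>
      elQuot (A.rename ρ) (R.rename (liftRen (liftRen ρ))) (M.rename (liftRen ρ)) (p.rename ρ)
        (l.rename (liftRen ρ))
  | _, _, ρ, code φ => code (φ.rename ρ)

/-- Weakening by one variable. -/
def wk {n : ℕ} (e : PreExp n) : PreExp (n + 1) := e.rename Fin.succ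

/-- Lifting a substitution under a binder. -/
def lift {n m : ℕ} (σ : Fin n → PreExp m) : Fin (n + 1) → PreExp (m + 1) :=
  Fin.cons (var 0) fun i => (σ i).wk

/-- Simultaneous capture-avoiding substitution. -/
def subst : {n m : ℕ} → (Fin n → PreExp m) → PreExp n → PreExp m
  | _, _, σ, var i => σ i
  | _, _, _, empty => empty
  | _, _, _, unit => unit
  | _, _, σ, sigma A B => sigma (A.subst σ) (B.subst (lift σ))
  | _, _, σ, pi A B => pi (A.subst σ) (B.subst (lift σ))
  | _, _, σ, sum A B => sum (A.subst σ) (B.subst σ)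
  | _, _, σ, list A => list (A.subst σ)
  | _, _, σ, quot A R => quot (A.subst σ) (R.subst (lift (lift σ)))
  | _, _, _, pow => pow
  | _, _, _, bot => bot
  | _, _, σ, and φ ψ => and (φ.subst σ) (ψ.subst σ)
  | _, _, σ, or φ ψ => or (φ.subst σ) (ψ.subst σ)
  | _, _, σ, imp φ ψ => imp (φ.subst σ) (ψ.subst σ)
  | _, _, σ, ex A φ => ex (A.subst σ) (φ.subst (lift σ))
  | _, _, σ, all A φ => all (A.subst σ) (φ.subst (lift σ))
  | _, _, σ, eq A a b => eq (A.subst σ) (a.subst σ) (b.subst σ)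
  | _, _, σ, tt φ => tt (φ.subst σ)
  | _, _, σ, elEmpty M c => elEmpty (M.subst (lift σ)) (c.subst σ)
  | _, _, _, star => star
  | _, _, σ, elUnit M t c => elUnit (M.subst (lift σ)) (t.subst σ) (c.subst σ)
  | _, _, σ, pair A B a b => pair (A.subst σ) (B.subst (lift σ)) (a.subst σ) (b.subst σ)
  | _, _, σ, elSigma A B M d m =>
      elSigma (A.subst σ) (B.subst (lift σ)) (M.subst (lift σ)) (d.subst σ)
        (m.subst (lift (lift σ)))
  | _, _, σ, lam A B b => lam (A.subst σ) (B.subst (lift σ)) (b.subst (lift σ))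
  | _, _, σ, app A B f a => app (A.subst σ) (B.subst (lift σ)) (f.subst σ) (a.subst σ)
  | _, _, σ, inl A B a => inl (A.subst σ) (B.subst σ) (a.subst σ)
  | _, _, σ, inr A B b => inr (A.subst σ) (B.subst σ) (b.subst σ)
  | _, _, σ, elSum A B M d l r =>
      elSum (A.subst σ) (B.subst σ) (M.subst (lift σ)) (d.subst σ)
        (l.subst (lift σ)) (r.subst (lift σ))
  | _, _, σ, nil A => nil (A.subst σ)
  | _, _, σ, cons A s a => cons (A.subst σ) (s.subst σ) (a.subst σ)
  | _, _, σ, elList A M s a l =>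
      elList (A.subst σ) (M.subst (lift σ)) (s.subst σ) (a.subst σ)
        (l.subst (lift (lift (lift σ))))
  | _, _, σ, cls A R a => cls (A.subst σ) (R.subst (lift (lift σ))) (a.subst σ)
  | _, _, σ, elQuot A R M p l =>
      elQuot (A.subst σ) (R.subst (lift (lift σ))) (M.subst (lift σ)) (p.subst σ)
        (l.subst (lift σ))
  | _, _, σ, code φ => code (φ.subst σ)

/-- The substitution that weakens by `k` variables. -/
def shift {n : ℕ} (k : ℕ) (i : Fin n) : PreExp (n + k) := var (i.addNat k)

/-- Extending a substitution by a value for the variable `0`. -/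
def scons {n m : ℕ} (a : PreExp m) (σ : Fin n → PreExp m) : Fin (n + 1) → PreExp m :=
  Fin.cons a σ

/-- `B(a)`, for `B` depending on one variable. -/
def inst {n : ℕ} (B : PreExp (n + 1)) (a : PreExp n) : PreExp n :=
  B.subst (scons a var)

/-- `e(a, b)`, for `e` depending on two variables. -/
def inst₂ {n : ℕ} (e : PreExp (n + 2)) (a b : PreExp n) : PreExp n :=
  e.subst (scons b (scons a var))

/-- `e(a, b, c)`, for `e` depending on three variables. -/
def inst₃ {n : ℕ} (e : PreExp (n + 3)) (a b c : PreExp n) : PreExp n :=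
  e.subst (scons c (scons b (scons a var)))

/-- `M(t)`, for `M` depending on one variable and `t` living in a context with `k` additional
variables. -/
def instAt {n : ℕ} (k : ℕ) (M : PreExp (n + 1)) (t : PreExp (n + k)) : PreExp (n + k) :=
  M.subst (scons t (shift k))

/-- `R(a, b)`, for `R` depending on two variables and `a`, `b` living in a context with `k`
additional variables. -/
def instAt₂ {n : ℕ} (k : ℕ) (R : PreExp (n + 2)) (a b : PreExp (n + k)) : PreExp (n + k) :=
  R.subst (scons b (scons a (shift k)))

/-- Negation `¬ φ :≡ φ ⇒ ⊥`. -/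
abbrev neg {n : ℕ} (φ : PreExp n) : PreExp n := imp φ bot

/-- The true constant `⊤ :≡ ¬ ⊥`. -/
abbrev top {n : ℕ} : PreExp n := neg bot

/-- Logical equivalence `φ ⇔ ψ :≡ (φ ⇒ ψ) ∧ (ψ ⇒ φ)`. -/
abbrev iff {n : ℕ} (φ ψ : PreExp n) : PreExp n := and (imp φ ψ) (imp ψ φ)

/-- Decoding `Dc(U) :≡ Eq(P(1), U, [⊤])`. -/
abbrev dc {n : ℕ} (U : PreExp n) : PreExp n := eq pow U (code top)

end PreExp

/-! ### Pre-contexts and pre-judgements -/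

/-- Pre-contexts declaring `n` variables. -/
inductive Ctx : ℕ → Type where
  | nil : Ctx 0
  | snoc {n : ℕ} (Γ : Ctx n) (A : PreExp n) : Ctx (n + 1)

infixl:65 " ▹ " => Ctx.snoc

/-- The pre-type declared for a variable, weakened to the whole context. -/
def Ctx.get : {n : ℕ} → Ctx n → Fin n → PreExp n
  | _, .nil => Fin.elim0
  | _, .snoc Γ A => Fin.cons A.wk fun i => (Γ.get i).wk

/-- Pre-judgements in `n` variables: `Γ ctx`, `A type [Γ]`, `A = B type [Γ]`, `a ∈ A [Γ]` and
`a = b ∈ A [Γ]`, with `type` one of the four kinds. -/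
inductive Judgement (n : ℕ) where
  | ctx (Γ : Ctx n)
  | type (k : Kind) (Γ : Ctx n) (A : PreExp n)
  | typeEq (k : Kind) (Γ : Ctx n) (A B : PreExp n)
  | term (Γ : Ctx n) (a A : PreExp n)
  | termEq (Γ : Ctx n) (a b A : PreExp n)

/-- `φ true [Γ]`, that is, `true ∈ φ [Γ]`. -/
abbrev Judgement.holds {n : ℕ} (Γ : Ctx n) (φ : PreExp n) : Judgement n := .term Γ (.tt φ) φ

/-! ### Theories -/

/-- The optional rules on top of `emTT`. -/
inductive ExtraRule where
  /-- the resizing rules `col-into-set` and `prop-into-prop_s` -/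
  | resizing
  /-- the Law of Excluded Middle -/
  | lem
  /-- propositional extensionality, for propositions and for small propositions -/
  | propext

/-- An extension of `emTT` by some of the optional rules. -/
abbrev Theory : Type := Set ExtraRule

/-- `emTT_imp`. -/
def emTTimp : Theory := {.resizing}

/-- `emTT^c_imp`. -/
def emTTcimp : Theory := {.resizing, .lem}

/-- `T + propext`. -/
def Theory.addPropext (T : Theory) : Theory := insert .propext T

/-- The inclusions between kinds that hold in the theory `T`. -/
inductive Kind.Into (T : Theory) : Kind → Kind → Prop where
  | props_into_prop : Into T .props .prop
  | props_into_set : Into T .props .set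
  | prop_into_col : Into T .prop .col
  | set_into_col : Into T .set .col
  | col_into_set : ExtraRule.resizing ∈ T → Into T .col .set
  | prop_into_props : ExtraRule.resizing ∈ T → Into T .prop .props

open PreExp Judgement in
/-- Derivability in the theory `T`.

A premise is written in the context it lives in; for instance, for `M` depending on
`z ∈ (Σ x ∈ A) B`, the type `M(⟨x, y⟩) [x ∈ A, y ∈ B]` is
`M.instAt 2 (pair A.wk.wk _ (var 1) (var 0))`. -/
inductive Derivable (T : Theory) : {n : ℕ} → Judgement n → Prop where
  -- Contexts and variables
  | ctx_nil : Derivable T (ctx .nil)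
  | ctx_snoc {n : ℕ} {Γ : Ctx n} {A : PreExp n} :
      Derivable T (type .col Γ A) → Derivable T (ctx (Γ ▹ A))
  | var {n : ℕ} {Γ : Ctx n} (i : Fin n) :
      Derivable T (ctx Γ) → Derivable T (term Γ (var i) (Γ.get i))
  -- Inclusions between kinds
  | type_into {n : ℕ} {Γ : Ctx n} {A : PreExp n} {k k' : Kind} : Kind.Into T k k' →
      Derivable T (type k Γ A) → Derivable T (type k' Γ A)
  | typeEq_into {n : ℕ} {Γ : Ctx n} {A B : PreExp n} {k k' : Kind} : Kind.Into T k k' →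
      Derivable T (typeEq k Γ A B) → Derivable T (typeEq k' Γ A B)
  -- Equality is an equivalence relation, and equal types have the same terms
  | typeEq_refl {n : ℕ} {Γ : Ctx n} {A : PreExp n} {k : Kind} :
      Derivable T (type k Γ A) → Derivable T (typeEq k Γ A A)
  | typeEq_symm {n : ℕ} {Γ : Ctx n} {A B : PreExp n} {k : Kind} :
      Derivable T (typeEq k Γ A B) → Derivable T (typeEq k Γ B A)
  | typeEq_trans {n : ℕ} {Γ : Ctx n} {A B C : PreExp n} {k : Kind} :
      Derivable T (typeEq k Γ A B) → Derivable T (typeEq k Γ B C) → Derivable T (typeEq k Γ A C)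
  | termEq_refl {n : ℕ} {Γ : Ctx n} {a A : PreExp n} :
      Derivable T (term Γ a A) → Derivable T (termEq Γ a a A)
  | termEq_symm {n : ℕ} {Γ : Ctx n} {a b A : PreExp n} :
      Derivable T (termEq Γ a b A) → Derivable T (termEq Γ b a A)
  | termEq_trans {n : ℕ} {Γ : Ctx n} {a b c A : PreExp n} :
      Derivable T (termEq Γ a b A) → Derivable T (termEq Γ b c A) → Derivable T (termEq Γ a c A)
  | conv {n : ℕ} {Γ : Ctx n} {a A B : PreExp n} :
      Derivable T (term Γ a A) → Derivable T (typeEq .col Γ A B) → Derivable T (term Γ a B)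
  | convEq {n : ℕ} {Γ : Ctx n} {a b A B : PreExp n} :
      Derivable T (termEq Γ a b A) → Derivable T (typeEq .col Γ A B) → Derivable T (termEq Γ a b B)
  -- Weakening and substitution, along a telescopic substitution `σ ∈ Γ [Δ]`
  | type_subst {n m : ℕ} {Γ : Ctx n} {Δ : Ctx m} {σ : Fin n → PreExp m} {A : PreExp n}
      {k : Kind} : Derivable T (ctx Δ) →
      (∀ i, Derivable T (term Δ (σ i) ((Γ.get i).subst σ))) →
      Derivable T (type k Γ A) → Derivable T (type k Δ (A.subst σ))
  | typeEq_subst {n m : ℕ} {Γ : Ctx n} {Δ : Ctx m} {σ : Fin n → PreExp m} {A B : PreExp n}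
      {k : Kind} : Derivable T (ctx Δ) →
      (∀ i, Derivable T (term Δ (σ i) ((Γ.get i).subst σ))) →
      Derivable T (typeEq k Γ A B) → Derivable T (typeEq k Δ (A.subst σ) (B.subst σ))
  | term_subst {n m : ℕ} {Γ : Ctx n} {Δ : Ctx m} {σ : Fin n → PreExp m} {a A : PreExp n} :
      Derivable T (ctx Δ) →
      (∀ i, Derivable T (term Δ (σ i) ((Γ.get i).subst σ))) →
      Derivable T (term Γ a A) → Derivable T (term Δ (a.subst σ) (A.subst σ))
  | termEq_subst {n m : ℕ} {Γ : Ctx n} {Δ : Ctx m} {σ : Fin n → PreExp m} {a b A : PreExp n} :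
      Derivable T (ctx Δ) →
      (∀ i, Derivable T (term Δ (σ i) ((Γ.get i).subst σ))) →
      Derivable T (termEq Γ a b A) →
      Derivable T (termEq Δ (a.subst σ) (b.subst σ) (A.subst σ))
  -- Substitution of equals for equals
  | type_subst_eq {n m : ℕ} {Γ : Ctx n} {Δ : Ctx m} {σ τ : Fin n → PreExp m} {A : PreExp n}
      {k : Kind} : Derivable T (ctx Δ) →
      (∀ i, Derivable T (term Δ (σ i) ((Γ.get i).subst σ))) →
      (∀ i, Derivable T (term Δ (τ i) ((Γ.get i).subst τ))) →
      (∀ i, Derivable T (termEq Δ (σ i) (τ i) ((Γ.get i).subst σ))) →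
      Derivable T (type k Γ A) → Derivable T (typeEq k Δ (A.subst σ) (A.subst τ))
  | term_subst_eq {n m : ℕ} {Γ : Ctx n} {Δ : Ctx m} {σ τ : Fin n → PreExp m} {a A : PreExp n} :
      Derivable T (ctx Δ) →
      (∀ i, Derivable T (term Δ (σ i) ((Γ.get i).subst σ))) →
      (∀ i, Derivable T (term Δ (τ i) ((Γ.get i).subst τ))) →
      (∀ i, Derivable T (termEq Δ (σ i) (τ i) ((Γ.get i).subst σ))) →
      Derivable T (term Γ a A) → Derivable T (termEq Δ (a.subst σ) (a.subst τ) (A.subst σ))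
  -- Proof-irrelevance of propositions
  | prop_mono {n : ℕ} {Γ : Ctx n} {φ p q : PreExp n} : Derivable T (type .prop Γ φ) →
      Derivable T (term Γ p φ) → Derivable T (term Γ q φ) → Derivable T (termEq Γ p q φ)
  | prop_true {n : ℕ} {Γ : Ctx n} {φ p : PreExp n} : Derivable T (type .prop Γ φ) →
      Derivable T (term Γ p φ) → Derivable T (holds Γ φ)
  -- The empty set
  | empty_form {n : ℕ} {Γ : Ctx n} : Derivable T (ctx Γ) → Derivable T (type .set Γ empty)
  | empty_elim {n : ℕ} {Γ : Ctx n} {M : PreExp (n + 1)} {c : PreExp n} :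
      Derivable T (type .col (Γ ▹ empty) M) → Derivable T (term Γ c empty) →
      Derivable T (term Γ (elEmpty M c) (M.inst c))
  | empty_elim_eq {n : ℕ} {Γ : Ctx n} {M M' : PreExp (n + 1)} {c c' : PreExp n} :
      Derivable T (typeEq .col (Γ ▹ empty) M M') → Derivable T (termEq Γ c c' empty) →
      Derivable T (termEq Γ (elEmpty M c) (elEmpty M' c') (M.inst c))
  -- The singleton set
  | unit_form {n : ℕ} {Γ : Ctx n} : Derivable T (ctx Γ) → Derivable T (type .set Γ unit)
  | unit_intro {n : ℕ} {Γ : Ctx n} : Derivable T (ctx Γ) → Derivable T (term Γ star unit)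
  | unit_elim {n : ℕ} {Γ : Ctx n} {M : PreExp (n + 1)} {t c : PreExp n} :
      Derivable T (type .col (Γ ▹ unit) M) → Derivable T (term Γ t unit) →
      Derivable T (term Γ c (M.inst star)) →
      Derivable T (term Γ (elUnit M t c) (M.inst t))
  | unit_elim_eq {n : ℕ} {Γ : Ctx n} {M M' : PreExp (n + 1)} {t t' c c' : PreExp n} :
      Derivable T (typeEq .col (Γ ▹ unit) M M') → Derivable T (termEq Γ t t' unit) →
      Derivable T (termEq Γ c c' (M.inst star)) →
      Derivable T (termEq Γ (elUnit M t c) (elUnit M' t' c') (M.inst t))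
  | unit_beta {n : ℕ} {Γ : Ctx n} {M : PreExp (n + 1)} {c : PreExp n} :
      Derivable T (type .col (Γ ▹ unit) M) → Derivable T (term Γ c (M.inst star)) →
      Derivable T (termEq Γ (elUnit M star c) c (M.inst star))
  -- Dependent sums, of sets and of collections
  | sigma_form {n : ℕ} {Γ : Ctx n} {A : PreExp n} {B : PreExp (n + 1)} {s : Size} :
      Derivable T (type (.collection s) Γ A) → Derivable T (type (.collection s) (Γ ▹ A) B) →
      Derivable T (type (.collection s) Γ (sigma A B))
  | sigma_form_eq {n : ℕ} {Γ : Ctx n} {A A' : PreExp n} {B B' : PreExp (n + 1)} {s : Size} :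
      Derivable T (typeEq (.collection s) Γ A A') →
      Derivable T (typeEq (.collection s) (Γ ▹ A) B B') →
      Derivable T (typeEq (.collection s) Γ (sigma A B) (sigma A' B'))
  | sigma_intro {n : ℕ} {Γ : Ctx n} {A a b : PreExp n} {B : PreExp (n + 1)} :
      Derivable T (type .col Γ A) → Derivable T (type .col (Γ ▹ A) B) →
      Derivable T (term Γ a A) → Derivable T (term Γ b (B.inst a)) →
      Derivable T (term Γ (pair A B a b) (sigma A B))
  | sigma_intro_eq {n : ℕ} {Γ : Ctx n} {A A' a a' b b' : PreExp n} {B B' : PreExp (n + 1)} :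
      Derivable T (typeEq .col Γ A A') → Derivable T (typeEq .col (Γ ▹ A) B B') →
      Derivable T (termEq Γ a a' A) → Derivable T (termEq Γ b b' (B.inst a)) →
      Derivable T (termEq Γ (pair A B a b) (pair A' B' a' b') (sigma A B))
  | sigma_elim {n : ℕ} {Γ : Ctx n} {A d : PreExp n} {B M : PreExp (n + 1)}
      {m : PreExp (n + 2)} :
      Derivable T (type .col (Γ ▹ sigma A B) M) → Derivable T (term Γ d (sigma A B)) →
      Derivable T (term (Γ ▹ A ▹ B) m
        (M.instAt 2 (pair A.wk.wk (B.subst (lift (shift 2))) (var 1) (var 0)))) →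
      Derivable T (term Γ (elSigma A B M d m) (M.inst d))
  | sigma_elim_eq {n : ℕ} {Γ : Ctx n} {A A' d d' : PreExp n} {B B' M M' : PreExp (n + 1)}
      {m m' : PreExp (n + 2)} :
      Derivable T (typeEq .col Γ A A') → Derivable T (typeEq .col (Γ ▹ A) B B') →
      Derivable T (typeEq .col (Γ ▹ sigma A B) M M') → Derivable T (termEq Γ d d' (sigma A B)) →
      Derivable T (termEq (Γ ▹ A ▹ B) m m'
        (M.instAt 2 (pair A.wk.wk (B.subst (lift (shift 2))) (var 1) (var 0)))) →
      Derivable T (termEq Γ (elSigma A B M d m) (elSigma A' B' M' d' m') (M.inst d))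
  | sigma_beta {n : ℕ} {Γ : Ctx n} {A a b : PreExp n} {B M : PreExp (n + 1)}
      {m : PreExp (n + 2)} :
      Derivable T (type .col (Γ ▹ sigma A B) M) →
      Derivable T (term Γ a A) → Derivable T (term Γ b (B.inst a)) →
      Derivable T (term (Γ ▹ A ▹ B) m
        (M.instAt 2 (pair A.wk.wk (B.subst (lift (shift 2))) (var 1) (var 0)))) →
      Derivable T (termEq Γ (elSigma A B M (pair A B a b) m) (m.inst₂ a b)
        (M.inst (pair A B a b)))
  -- Dependent products of sets, and the collection of functions from a set to `P(1)`
  | pi_form {n : ℕ} {Γ : Ctx n} {A : PreExp n} {B : PreExp (n + 1)} :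
      Derivable T (type .set Γ A) → Derivable T (type .set (Γ ▹ A) B) →
      Derivable T (type .set Γ (pi A B))
  | pi_form_eq {n : ℕ} {Γ : Ctx n} {A A' : PreExp n} {B B' : PreExp (n + 1)} :
      Derivable T (typeEq .set Γ A A') → Derivable T (typeEq .set (Γ ▹ A) B B') →
      Derivable T (typeEq .set Γ (pi A B) (pi A' B'))
  | pi_pow_form {n : ℕ} {Γ : Ctx n} {A : PreExp n} :
      Derivable T (type .set Γ A) → Derivable T (type .col Γ (pi A pow))
  | pi_pow_form_eq {n : ℕ} {Γ : Ctx n} {A A' : PreExp n} :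
      Derivable T (typeEq .set Γ A A') → Derivable T (typeEq .col Γ (pi A pow) (pi A' pow))
  | pi_intro {n : ℕ} {Γ : Ctx n} {A : PreExp n} {B b : PreExp (n + 1)} :
      Derivable T (type .col Γ (pi A B)) → Derivable T (term (Γ ▹ A) b B) →
      Derivable T (term Γ (lam A B b) (pi A B))
  | pi_intro_eq {n : ℕ} {Γ : Ctx n} {A A' : PreExp n} {B B' b b' : PreExp (n + 1)} :
      Derivable T (typeEq .col Γ A A') → Derivable T (typeEq .col (Γ ▹ A) B B') →
      Derivable T (typeEq .col Γ (pi A B) (pi A' B')) → Derivable T (termEq (Γ ▹ A) b b' B) →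
      Derivable T (termEq Γ (lam A B b) (lam A' B' b') (pi A B))
  | pi_elim {n : ℕ} {Γ : Ctx n} {A f a : PreExp n} {B : PreExp (n + 1)} :
      Derivable T (type .col (Γ ▹ A) B) →
      Derivable T (term Γ f (pi A B)) → Derivable T (term Γ a A) →
      Derivable T (term Γ (app A B f a) (B.inst a))
  | pi_elim_eq {n : ℕ} {Γ : Ctx n} {A A' f f' a a' : PreExp n} {B B' : PreExp (n + 1)} :
      Derivable T (typeEq .col Γ A A') → Derivable T (typeEq .col (Γ ▹ A) B B') →
      Derivable T (typeEq .col Γ (pi A B) (pi A' B')) →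
      Derivable T (termEq Γ f f' (pi A B)) → Derivable T (termEq Γ a a' A) →
      Derivable T (termEq Γ (app A B f a) (app A' B' f' a') (B.inst a))
  | pi_beta {n : ℕ} {Γ : Ctx n} {A a : PreExp n} {B b : PreExp (n + 1)} :
      Derivable T (type .col Γ (pi A B)) → Derivable T (term (Γ ▹ A) b B) →
      Derivable T (term Γ a A) →
      Derivable T (termEq Γ (app A B (lam A B b) a) (b.inst a) (B.inst a))
  | pi_eta {n : ℕ} {Γ : Ctx n} {A f : PreExp n} {B : PreExp (n + 1)} :
      Derivable T (term Γ f (pi A B)) →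
      Derivable T (termEq Γ
        (lam A B (app A.wk (B.subst (lift (shift 1))) f.wk (var 0))) f (pi A B))
  -- Disjoint sums
  | sum_form {n : ℕ} {Γ : Ctx n} {A B : PreExp n} :
      Derivable T (type .set Γ A) → Derivable T (type .set Γ B) →
      Derivable T (type .set Γ (sum A B))
  | sum_form_eq {n : ℕ} {Γ : Ctx n} {A A' B B' : PreExp n} :
      Derivable T (typeEq .set Γ A A') → Derivable T (typeEq .set Γ B B') →
      Derivable T (typeEq .set Γ (sum A B) (sum A' B'))
  | sum_inl {n : ℕ} {Γ : Ctx n} {A B a : PreExp n} :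
      Derivable T (type .set Γ A) → Derivable T (type .set Γ B) → Derivable T (term Γ a A) →
      Derivable T (term Γ (inl A B a) (sum A B))
  | sum_inl_eq {n : ℕ} {Γ : Ctx n} {A A' B B' a a' : PreExp n} :
      Derivable T (typeEq .set Γ A A') → Derivable T (typeEq .set Γ B B') →
      Derivable T (termEq Γ a a' A) →
      Derivable T (termEq Γ (inl A B a) (inl A' B' a') (sum A B))
  | sum_inr {n : ℕ} {Γ : Ctx n} {A B b : PreExp n} :
      Derivable T (type .set Γ A) → Derivable T (type .set Γ B) → Derivable T (term Γ b B) →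
      Derivable T (term Γ (inr A B b) (sum A B))
  | sum_inr_eq {n : ℕ} {Γ : Ctx n} {A A' B B' b b' : PreExp n} :
      Derivable T (typeEq .set Γ A A') → Derivable T (typeEq .set Γ B B') →
      Derivable T (termEq Γ b b' B) →
      Derivable T (termEq Γ (inr A B b) (inr A' B' b') (sum A B))
  | sum_elim {n : ℕ} {Γ : Ctx n} {A B d : PreExp n} {M l r : PreExp (n + 1)} :
      Derivable T (type .col (Γ ▹ sum A B) M) → Derivable T (term Γ d (sum A B)) →
      Derivable T (term (Γ ▹ A) l (M.instAt 1 (inl A.wk B.wk (var 0)))) →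
      Derivable T (term (Γ ▹ B) r (M.instAt 1 (inr A.wk B.wk (var 0)))) →
      Derivable T (term Γ (elSum A B M d l r) (M.inst d))
  | sum_elim_eq {n : ℕ} {Γ : Ctx n} {A A' B B' d d' : PreExp n}
      {M M' l l' r r' : PreExp (n + 1)} :
      Derivable T (typeEq .set Γ A A') → Derivable T (typeEq .set Γ B B') →
      Derivable T (typeEq .col (Γ ▹ sum A B) M M') → Derivable T (termEq Γ d d' (sum A B)) →
      Derivable T (termEq (Γ ▹ A) l l' (M.instAt 1 (inl A.wk B.wk (var 0)))) →
      Derivable T (termEq (Γ ▹ B) r r' (M.instAt 1 (inr A.wk B.wk (var 0)))) →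
      Derivable T (termEq Γ (elSum A B M d l r) (elSum A' B' M' d' l' r') (M.inst d))
  | sum_beta_inl {n : ℕ} {Γ : Ctx n} {A B a : PreExp n} {M l r : PreExp (n + 1)} :
      Derivable T (type .col (Γ ▹ sum A B) M) → Derivable T (term Γ a A) →
      Derivable T (term (Γ ▹ A) l (M.instAt 1 (inl A.wk B.wk (var 0)))) →
      Derivable T (term (Γ ▹ B) r (M.instAt 1 (inr A.wk B.wk (var 0)))) →
      Derivable T (termEq Γ (elSum A B M (inl A B a) l r) (l.inst a) (M.inst (inl A B a)))
  | sum_beta_inr {n : ℕ} {Γ : Ctx n} {A B b : PreExp n} {M l r : PreExp (n + 1)} :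
      Derivable T (type .col (Γ ▹ sum A B) M) → Derivable T (term Γ b B) →
      Derivable T (term (Γ ▹ A) l (M.instAt 1 (inl A.wk B.wk (var 0)))) →
      Derivable T (term (Γ ▹ B) r (M.instAt 1 (inr A.wk B.wk (var 0)))) →
      Derivable T (termEq Γ (elSum A B M (inr A B b) l r) (r.inst b) (M.inst (inr A B b)))
  -- Lists
  | list_form {n : ℕ} {Γ : Ctx n} {A : PreExp n} :
      Derivable T (type .set Γ A) → Derivable T (type .set Γ (list A))
  | list_form_eq {n : ℕ} {Γ : Ctx n} {A A' : PreExp n} :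
      Derivable T (typeEq .set Γ A A') → Derivable T (typeEq .set Γ (list A) (list A'))
  | list_nil {n : ℕ} {Γ : Ctx n} {A : PreExp n} :
      Derivable T (type .set Γ A) → Derivable T (term Γ (nil A) (list A))
  | list_nil_eq {n : ℕ} {Γ : Ctx n} {A A' : PreExp n} :
      Derivable T (typeEq .set Γ A A') → Derivable T (termEq Γ (nil A) (nil A') (list A))
  | list_cons {n : ℕ} {Γ : Ctx n} {A s a : PreExp n} :
      Derivable T (type .set Γ A) → Derivable T (term Γ s (list A)) → Derivable T (term Γ a A) →
      Derivable T (term Γ (cons A s a) (list A))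
  | list_cons_eq {n : ℕ} {Γ : Ctx n} {A A' s s' a a' : PreExp n} :
      Derivable T (typeEq .set Γ A A') → Derivable T (termEq Γ s s' (list A)) →
      Derivable T (termEq Γ a a' A) →
      Derivable T (termEq Γ (cons A s a) (cons A' s' a') (list A))
  | list_elim {n : ℕ} {Γ : Ctx n} {A s a : PreExp n} {M : PreExp (n + 1)}
      {l : PreExp (n + 3)} :
      Derivable T (type .col (Γ ▹ list A) M) → Derivable T (term Γ s (list A)) →
      Derivable T (term Γ a (M.inst (nil A))) →
      Derivable T (term (Γ ▹ list A ▹ A.wk ▹ M.instAt 2 (var 1)) l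
        (M.instAt 3 (cons A.wk.wk.wk (var 2) (var 1)))) →
      Derivable T (term Γ (elList A M s a l) (M.inst s))
  | list_elim_eq {n : ℕ} {Γ : Ctx n} {A A' s s' a a' : PreExp n} {M M' : PreExp (n + 1)}
      {l l' : PreExp (n + 3)} :
      Derivable T (typeEq .set Γ A A') → Derivable T (typeEq .col (Γ ▹ list A) M M') →
      Derivable T (termEq Γ s s' (list A)) → Derivable T (termEq Γ a a' (M.inst (nil A))) →
      Derivable T (termEq (Γ ▹ list A ▹ A.wk ▹ M.instAt 2 (var 1)) l l'
        (M.instAt 3 (cons A.wk.wk.wk (var 2) (var 1)))) →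
      Derivable T (termEq Γ (elList A M s a l) (elList A' M' s' a' l') (M.inst s))
  | list_beta_nil {n : ℕ} {Γ : Ctx n} {A a : PreExp n} {M : PreExp (n + 1)}
      {l : PreExp (n + 3)} :
      Derivable T (type .col (Γ ▹ list A) M) → Derivable T (term Γ a (M.inst (nil A))) →
      Derivable T (term (Γ ▹ list A ▹ A.wk ▹ M.instAt 2 (var 1)) l
        (M.instAt 3 (cons A.wk.wk.wk (var 2) (var 1)))) →
      Derivable T (termEq Γ (elList A M (nil A) a l) a (M.inst (nil A)))
  | list_beta_cons {n : ℕ} {Γ : Ctx n} {A s b a : PreExp n} {M : PreExp (n + 1)}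
      {l : PreExp (n + 3)} :
      Derivable T (type .col (Γ ▹ list A) M) → Derivable T (term Γ s (list A)) →
      Derivable T (term Γ b A) → Derivable T (term Γ a (M.inst (nil A))) →
      Derivable T (term (Γ ▹ list A ▹ A.wk ▹ M.instAt 2 (var 1)) l
        (M.instAt 3 (cons A.wk.wk.wk (var 2) (var 1)))) →
      Derivable T (termEq Γ (elList A M (cons A s b) a l) (l.inst₃ s b (elList A M s a l))
        (M.inst (cons A s b)))
  -- Quotients of sets by small equivalence relations
  | quot_form {n : ℕ} {Γ : Ctx n} {A : PreExp n} {R : PreExp (n + 2)} :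
      Derivable T (type .set Γ A) → Derivable T (type .props (Γ ▹ A ▹ A.wk) R) →
      Derivable T (holds (Γ ▹ A) (R.instAt₂ 1 (var 0) (var 0))) →
      Derivable T (holds (Γ ▹ A ▹ A.wk ▹ R) (R.instAt₂ 3 (var 1) (var 2))) →
      Derivable T (holds (Γ ▹ A ▹ A.wk ▹ A.wk.wk ▹ R.instAt₂ 3 (var 2) (var 1) ▹
        R.instAt₂ 4 (var 2) (var 1)) (R.instAt₂ 5 (var 4) (var 2))) →
      Derivable T (type .set Γ (quot A R))
  | quot_form_eq {n : ℕ} {Γ : Ctx n} {A A' : PreExp n} {R R' : PreExp (n + 2)} :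
      Derivable T (type .set Γ (quot A R)) → Derivable T (type .set Γ (quot A' R')) →
      Derivable T (typeEq .set Γ A A') → Derivable T (typeEq .props (Γ ▹ A ▹ A.wk) R R') →
      Derivable T (typeEq .set Γ (quot A R) (quot A' R'))
  | quot_intro {n : ℕ} {Γ : Ctx n} {A a : PreExp n} {R : PreExp (n + 2)} :
      Derivable T (type .set Γ (quot A R)) → Derivable T (term Γ a A) →
      Derivable T (term Γ (cls A R a) (quot A R))
  | quot_intro_eq {n : ℕ} {Γ : Ctx n} {A A' a a' : PreExp n} {R R' : PreExp (n + 2)} :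
      Derivable T (type .set Γ (quot A R)) → Derivable T (type .set Γ (quot A' R')) →
      Derivable T (typeEq .set Γ A A') → Derivable T (typeEq .props (Γ ▹ A ▹ A.wk) R R') →
      Derivable T (termEq Γ a a' A) →
      Derivable T (termEq Γ (cls A R a) (cls A' R' a') (quot A R))
  | quot_eq {n : ℕ} {Γ : Ctx n} {A a b : PreExp n} {R : PreExp (n + 2)} :
      Derivable T (type .set Γ (quot A R)) → Derivable T (term Γ a A) →
      Derivable T (term Γ b A) → Derivable T (holds Γ (R.inst₂ a b)) →
      Derivable T (termEq Γ (cls A R a) (cls A R b) (quot A R))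
  | quot_eff {n : ℕ} {Γ : Ctx n} {A a b : PreExp n} {R : PreExp (n + 2)} :
      Derivable T (type .set Γ (quot A R)) → Derivable T (term Γ a A) →
      Derivable T (term Γ b A) → Derivable T (termEq Γ (cls A R a) (cls A R b) (quot A R)) →
      Derivable T (holds Γ (R.inst₂ a b))
  | quot_elim {n : ℕ} {Γ : Ctx n} {A p : PreExp n} {R : PreExp (n + 2)}
      {M l : PreExp (n + 1)} :
      Derivable T (type .col (Γ ▹ quot A R) M) → Derivable T (term Γ p (quot A R)) →
      Derivable T (term (Γ ▹ A) l
        (M.instAt 1 (cls A.wk (R.subst (lift (lift (shift 1)))) (var 0)))) →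
      Derivable T (termEq (Γ ▹ A ▹ A.wk ▹ R) (l.instAt 3 (var 2)) (l.instAt 3 (var 1))
        (M.instAt 3 (cls A.wk.wk.wk (R.subst (lift (lift (shift 3)))) (var 2)))) →
      Derivable T (term Γ (elQuot A R M p l) (M.inst p))
  | quot_elim_eq {n : ℕ} {Γ : Ctx n} {A A' p p' : PreExp n} {R R' : PreExp (n + 2)}
      {M M' l l' : PreExp (n + 1)} :
      Derivable T (type .set Γ (quot A R)) → Derivable T (type .set Γ (quot A' R')) →
      Derivable T (typeEq .set Γ A A') → Derivable T (typeEq .props (Γ ▹ A ▹ A.wk) R R') →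
      Derivable T (typeEq .col (Γ ▹ quot A R) M M') →
      Derivable T (termEq Γ p p' (quot A R)) →
      Derivable T (termEq (Γ ▹ A) l l'
        (M.instAt 1 (cls A.wk (R.subst (lift (lift (shift 1)))) (var 0)))) →
      Derivable T (termEq (Γ ▹ A ▹ A.wk ▹ R) (l.instAt 3 (var 2)) (l.instAt 3 (var 1))
        (M.instAt 3 (cls A.wk.wk.wk (R.subst (lift (lift (shift 3)))) (var 2)))) →
      Derivable T (termEq Γ (elQuot A R M p l) (elQuot A' R' M' p' l') (M.inst p))
  | quot_beta {n : ℕ} {Γ : Ctx n} {A a : PreExp n} {R : PreExp (n + 2)}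
      {M l : PreExp (n + 1)} :
      Derivable T (type .col (Γ ▹ quot A R) M) → Derivable T (term Γ a A) →
      Derivable T (term (Γ ▹ A) l
        (M.instAt 1 (cls A.wk (R.subst (lift (lift (shift 1)))) (var 0)))) →
      Derivable T (termEq (Γ ▹ A ▹ A.wk ▹ R) (l.instAt 3 (var 2)) (l.instAt 3 (var 1))
        (M.instAt 3 (cls A.wk.wk.wk (R.subst (lift (lift (shift 3)))) (var 2)))) →
      Derivable T (termEq Γ (elQuot A R M (cls A R a) l) (l.inst a) (M.inst (cls A R a)))
  -- The power collection of the singleton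
  | pow_form {n : ℕ} {Γ : Ctx n} : Derivable T (ctx Γ) → Derivable T (type .col Γ pow)
  | pow_intro {n : ℕ} {Γ : Ctx n} {φ : PreExp n} :
      Derivable T (type .props Γ φ) → Derivable T (term Γ (code φ) pow)
  | pow_intro_eq {n : ℕ} {Γ : Ctx n} {φ ψ : PreExp n} :
      Derivable T (typeEq .props Γ φ ψ) → Derivable T (termEq Γ (code φ) (code ψ) pow)
  | pow_eq {n : ℕ} {Γ : Ctx n} {φ ψ : PreExp n} :
      Derivable T (type .props Γ φ) → Derivable T (type .props Γ ψ) →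
      Derivable T (holds Γ (iff φ ψ)) → Derivable T (termEq Γ (code φ) (code ψ) pow)
  | pow_eff {n : ℕ} {Γ : Ctx n} {φ ψ : PreExp n} :
      Derivable T (type .props Γ φ) → Derivable T (type .props Γ ψ) →
      Derivable T (termEq Γ (code φ) (code ψ) pow) → Derivable T (holds Γ (iff φ ψ))
  | pow_eta {n : ℕ} {Γ : Ctx n} {U : PreExp n} :
      Derivable T (term Γ U pow) → Derivable T (termEq Γ U (code (dc U)) pow)
  | pow_eq_small {n : ℕ} {Γ : Ctx n} {U V : PreExp n} :
      Derivable T (term Γ U pow) → Derivable T (term Γ V pow) →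
      Derivable T (type .props Γ (eq pow U V))
  | pow_eq_small_eq {n : ℕ} {Γ : Ctx n} {U U' V V' : PreExp n} :
      Derivable T (termEq Γ U U' pow) → Derivable T (termEq Γ V V' pow) →
      Derivable T (typeEq .props Γ (eq pow U V) (eq pow U' V'))
  -- Falsum
  | bot_form {n : ℕ} {Γ : Ctx n} : Derivable T (ctx Γ) → Derivable T (type .props Γ bot)
  | bot_elim {n : ℕ} {Γ : Ctx n} {φ : PreExp n} :
      Derivable T (type .prop Γ φ) → Derivable T (holds Γ bot) → Derivable T (holds Γ φ)
  -- Conjunction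
  | and_form {n : ℕ} {Γ : Ctx n} {φ ψ : PreExp n} {s : Size} :
      Derivable T (type (.proposition s) Γ φ) → Derivable T (type (.proposition s) Γ ψ) →
      Derivable T (type (.proposition s) Γ (and φ ψ))
  | and_form_eq {n : ℕ} {Γ : Ctx n} {φ φ' ψ ψ' : PreExp n} {s : Size} :
      Derivable T (typeEq (.proposition s) Γ φ φ') →
      Derivable T (typeEq (.proposition s) Γ ψ ψ') →
      Derivable T (typeEq (.proposition s) Γ (and φ ψ) (and φ' ψ'))
  | and_intro {n : ℕ} {Γ : Ctx n} {φ ψ : PreExp n} :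
      Derivable T (type .prop Γ φ) → Derivable T (type .prop Γ ψ) →
      Derivable T (holds Γ φ) → Derivable T (holds Γ ψ) → Derivable T (holds Γ (and φ ψ))
  | and_left {n : ℕ} {Γ : Ctx n} {φ ψ : PreExp n} :
      Derivable T (type .prop Γ φ) → Derivable T (type .prop Γ ψ) →
      Derivable T (holds Γ (and φ ψ)) → Derivable T (holds Γ φ)
  | and_right {n : ℕ} {Γ : Ctx n} {φ ψ : PreExp n} :
      Derivable T (type .prop Γ φ) → Derivable T (type .prop Γ ψ) →
      Derivable T (holds Γ (and φ ψ)) → Derivable T (holds Γ ψ)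
  -- Disjunction
  | or_form {n : ℕ} {Γ : Ctx n} {φ ψ : PreExp n} {s : Size} :
      Derivable T (type (.proposition s) Γ φ) → Derivable T (type (.proposition s) Γ ψ) →
      Derivable T (type (.proposition s) Γ (or φ ψ))
  | or_form_eq {n : ℕ} {Γ : Ctx n} {φ φ' ψ ψ' : PreExp n} {s : Size} :
      Derivable T (typeEq (.proposition s) Γ φ φ') →
      Derivable T (typeEq (.proposition s) Γ ψ ψ') →
      Derivable T (typeEq (.proposition s) Γ (or φ ψ) (or φ' ψ'))
  | or_inl {n : ℕ} {Γ : Ctx n} {φ ψ : PreExp n} :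
      Derivable T (type .prop Γ φ) → Derivable T (type .prop Γ ψ) →
      Derivable T (holds Γ φ) → Derivable T (holds Γ (or φ ψ))
  | or_inr {n : ℕ} {Γ : Ctx n} {φ ψ : PreExp n} :
      Derivable T (type .prop Γ φ) → Derivable T (type .prop Γ ψ) →
      Derivable T (holds Γ ψ) → Derivable T (holds Γ (or φ ψ))
  | or_elim {n : ℕ} {Γ : Ctx n} {φ ψ χ : PreExp n} :
      Derivable T (type .prop Γ φ) → Derivable T (type .prop Γ ψ) →
      Derivable T (type .prop Γ χ) → Derivable T (holds Γ (or φ ψ)) →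
      Derivable T (holds (Γ ▹ φ) χ.wk) → Derivable T (holds (Γ ▹ ψ) χ.wk) →
      Derivable T (holds Γ χ)
  -- Implication
  | imp_form {n : ℕ} {Γ : Ctx n} {φ ψ : PreExp n} {s : Size} :
      Derivable T (type (.proposition s) Γ φ) → Derivable T (type (.proposition s) Γ ψ) →
      Derivable T (type (.proposition s) Γ (imp φ ψ))
  | imp_form_eq {n : ℕ} {Γ : Ctx n} {φ φ' ψ ψ' : PreExp n} {s : Size} :
      Derivable T (typeEq (.proposition s) Γ φ φ') →
      Derivable T (typeEq (.proposition s) Γ ψ ψ') →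
      Derivable T (typeEq (.proposition s) Γ (imp φ ψ) (imp φ' ψ'))
  | imp_intro {n : ℕ} {Γ : Ctx n} {φ ψ : PreExp n} :
      Derivable T (type .prop Γ φ) → Derivable T (type .prop Γ ψ) →
      Derivable T (holds (Γ ▹ φ) ψ.wk) → Derivable T (holds Γ (imp φ ψ))
  | imp_elim {n : ℕ} {Γ : Ctx n} {φ ψ : PreExp n} :
      Derivable T (type .prop Γ φ) → Derivable T (type .prop Γ ψ) →
      Derivable T (holds Γ (imp φ ψ)) → Derivable T (holds Γ φ) → Derivable T (holds Γ ψ)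
  -- Existential quantification
  | ex_form {n : ℕ} {Γ : Ctx n} {A : PreExp n} {φ : PreExp (n + 1)} {s : Size} :
      Derivable T (type (.collection s) Γ A) → Derivable T (type (.proposition s) (Γ ▹ A) φ) →
      Derivable T (type (.proposition s) Γ (ex A φ))
  | ex_form_eq {n : ℕ} {Γ : Ctx n} {A A' : PreExp n} {φ φ' : PreExp (n + 1)} {s : Size} :
      Derivable T (typeEq (.collection s) Γ A A') →
      Derivable T (typeEq (.proposition s) (Γ ▹ A) φ φ') →
      Derivable T (typeEq (.proposition s) Γ (ex A φ) (ex A' φ'))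
  | ex_intro {n : ℕ} {Γ : Ctx n} {A a : PreExp n} {φ : PreExp (n + 1)} :
      Derivable T (type .prop (Γ ▹ A) φ) → Derivable T (term Γ a A) →
      Derivable T (holds Γ (φ.inst a)) → Derivable T (holds Γ (ex A φ))
  | ex_elim {n : ℕ} {Γ : Ctx n} {A χ : PreExp n} {φ : PreExp (n + 1)} :
      Derivable T (type .prop (Γ ▹ A) φ) → Derivable T (type .prop Γ χ) →
      Derivable T (holds Γ (ex A φ)) → Derivable T (holds (Γ ▹ A ▹ φ) χ.wk.wk) →
      Derivable T (holds Γ χ)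
  -- Universal quantification
  | all_form {n : ℕ} {Γ : Ctx n} {A : PreExp n} {φ : PreExp (n + 1)} {s : Size} :
      Derivable T (type (.collection s) Γ A) → Derivable T (type (.proposition s) (Γ ▹ A) φ) →
      Derivable T (type (.proposition s) Γ (all A φ))
  | all_form_eq {n : ℕ} {Γ : Ctx n} {A A' : PreExp n} {φ φ' : PreExp (n + 1)} {s : Size} :
      Derivable T (typeEq (.collection s) Γ A A') →
      Derivable T (typeEq (.proposition s) (Γ ▹ A) φ φ') →
      Derivable T (typeEq (.proposition s) Γ (all A φ) (all A' φ'))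
  | all_intro {n : ℕ} {Γ : Ctx n} {A : PreExp n} {φ : PreExp (n + 1)} :
      Derivable T (type .prop (Γ ▹ A) φ) → Derivable T (holds (Γ ▹ A) φ) →
      Derivable T (holds Γ (all A φ))
  | all_elim {n : ℕ} {Γ : Ctx n} {A a : PreExp n} {φ : PreExp (n + 1)} :
      Derivable T (type .prop (Γ ▹ A) φ) → Derivable T (holds Γ (all A φ)) →
      Derivable T (term Γ a A) → Derivable T (holds Γ (φ.inst a))
  -- Propositional equality, with reflection
  | eq_form {n : ℕ} {Γ : Ctx n} {A a b : PreExp n} {s : Size} :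
      Derivable T (type (.collection s) Γ A) → Derivable T (term Γ a A) →
      Derivable T (term Γ b A) → Derivable T (type (.proposition s) Γ (eq A a b))
  | eq_form_eq {n : ℕ} {Γ : Ctx n} {A A' a a' b b' : PreExp n} {s : Size} :
      Derivable T (typeEq (.collection s) Γ A A') → Derivable T (termEq Γ a a' A) →
      Derivable T (termEq Γ b b' A) →
      Derivable T (typeEq (.proposition s) Γ (eq A a b) (eq A' a' b'))
  | eq_intro {n : ℕ} {Γ : Ctx n} {A a : PreExp n} :
      Derivable T (type .col Γ A) → Derivable T (term Γ a A) → Derivable T (holds Γ (eq A a a))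
  | eq_reflection {n : ℕ} {Γ : Ctx n} {A a b : PreExp n} :
      Derivable T (type .col Γ A) → Derivable T (term Γ a A) → Derivable T (term Γ b A) →
      Derivable T (holds Γ (eq A a b)) → Derivable T (termEq Γ a b A)
  -- The Law of Excluded Middle
  | lem {n : ℕ} {Γ : Ctx n} {φ : PreExp n} : ExtraRule.lem ∈ T →
      Derivable T (type .prop Γ φ) → Derivable T (holds Γ (or φ (neg φ)))
  -- Propositional extensionality: `propext` and its version for small propositions
  | propext {n : ℕ} {Γ : Ctx n} {φ ψ : PreExp n} {s : Size} : ExtraRule.propext ∈ T →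
      Derivable T (type (.proposition s) Γ φ) → Derivable T (type (.proposition s) Γ ψ) →
      Derivable T (holds Γ (iff φ ψ)) → Derivable T (typeEq (.proposition s) Γ φ ψ)

/-- `T'` is conservative over `T`: every proposition of `T`, in any context, that is true in `T'` is
already true in `T`. -/
def Theory.ConservativeOver (T' T : Theory) : Prop :=
  ∀ {n : ℕ} (Γ : Ctx n) (φ : PreExp n), Derivable T (.type .prop Γ φ) →
    Derivable T' (.holds Γ φ) → Derivable T (.holds Γ φ)

end EmTT

set_option linter.unusedSectionVars false

/-! Let T be one of the two theories. By resizing, every proposition φ has a code [φ] in P(1), and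
codes of equiprovable propositions are judgementally equal. The proposition Dc([φ]), which says that
[φ] equals [⊤], is equiprovable with φ, and up to judgemental equality it depends only on the class
of φ under equiprovability. It is thus a canonical representative of that class, called `collapse`
below.

The map `canon` replaces, hereditarily, every proposition occurring in an expression by its
representative. It commutes with substitution, and each rule of T remains derivable after
translation. Propositional extensionality becomes derivable in T as well: equiprovable propositions
have equal representatives (`collapse_congr`), and a translated proposition, being a representative
already, equals its own representative by the η-rule of P(1) (`collapse_idem`). This is
`Derivable.canon`: if T + propext proves φ in the context Γ, then T proves the canonical form of φ
in the canonical form of Γ.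

It remains to return from canonical forms to the originals, inside T. A type and its canonical form
need not be judgementally equal, since propositions occur in types, in quotient relations and in
annotations of terms. They are, however, canonically isomorphic. Since no type is ever a variable or
an application, the isomorphism `cast` can be defined by recursion on the raw type: functorially on
Σ, Π, + and List, through representatives on quotients, as the identity on N₀, N₁ and P(1), and as
the proof-term `true` on propositions. A dependent type mentions variables whose own types have
changed, so `cast` takes two substitutions: one for the variables of the source and one for those of
the target. They are required to correspond to each other under the coercions (`CastRel`).

The main work is the coherence theorem `Derivable.coherent`, an induction on derivations in T. It
shows that the coercions of every type are well typed and mutually inverse, that judgementally equal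
types have equal coercions, and that the coercion of the type of a term carries the term to its
canonical form. Types and terms have to be treated together, because the proposition Eq(A, a, b) is
respected only if a and b are. On propositions all equations between coercions hold by
proof-irrelevance, and only entailments have to be checked. On eliminators, two families over an
inductive type or a quotient are compared by eliminating into the proposition that they are equal;
reflection then makes the equality judgemental. Extensionality of the theory is essential here.

Finally, coercing the variables of Γ one after another gives a substitution τ from Γ to its
canonical form (`CtxCoherent.exists_castRel`). The translated derivation, substituted along τ,
proves over Γ the canonical form of φ at τ, and the coercion back proves φ. -/

namespace EmTT

/-! ### Substitution calculus of the raw syntax -/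

namespace PreExp

/-- The substitution that weakens by one variable. -/
def S {n : ℕ} : Fin n → PreExp (n + 1) := fun i => var i.succ

/-- Composition of substitutions, in diagrammatic order. -/
def comp {n m k : ℕ} (σ : Fin n → PreExp m) (τ : Fin m → PreExp k) : Fin n → PreExp k :=
  fun i => (σ i).subst τ

infixr:80 " ⊚ " => comp

theorem lift_var_comp {n m : ℕ} (ρ : Fin n → Fin m) :
    lift (fun i => var (ρ i)) = fun i => var (liftRen ρ i) := by
  funext i
  cases i using Fin.cases <;> simp [lift, liftRen, wk, rename]

theorem rename_eq_subst {n m : ℕ} (ρ : Fin n → Fin m) (e : PreExp n) :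
    e.rename ρ = e.subst (fun i => var (ρ i)) := by
  induction e generalizing m <;> simp [rename, subst, lift_var_comp, *]

theorem wk_eq {n : ℕ} (e : PreExp n) : e.wk = e.subst S := rename_eq_subst _ _

theorem lift_eq {n m : ℕ} (σ : Fin n → PreExp m) : lift σ = scons (var 0) (σ ⊚ S) := by
  funext i
  cases i using Fin.cases <;> simp [lift, scons, comp, wk_eq]

theorem lift_comp_liftRen {n m k : ℕ} (ρ : Fin n → Fin m) (σ : Fin m → PreExp k) :
    (fun i => lift σ (liftRen ρ i)) = lift (fun i => σ (ρ i)) := by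
  funext i
  cases i using Fin.cases <;> simp [lift, liftRen]

/-- Lifting a substitution under a binder weakens its values, so composition with renamings has to
be settled first, on either side. Only then can `lift` be shown to commute with composition, which
is what `subst_subst` needs under binders. -/
theorem subst_rename {n m k : ℕ} (ρ : Fin n → Fin m) (σ : Fin m → PreExp k) (e : PreExp n) :
    (e.rename ρ).subst σ = e.subst (fun i => σ (ρ i)) := by
  induction e generalizing m k <;> simp [rename, subst, lift_comp_liftRen, *]

theorem lift_rename {n m k : ℕ} (σ : Fin n → PreExp m) (ρ : Fin m → Fin k) :
    (fun i => (lift σ i).rename (liftRen ρ)) = lift (fun i => (σ i).rename ρ) := by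
  funext i
  cases i using Fin.cases
  · simp [lift, liftRen, rename]
  · simp [lift, wk, rename_eq_subst (liftRen ρ), subst_rename]
    simp [rename_eq_subst, liftRen]
    rw [← rename_eq_subst ρ, subst_rename]

theorem rename_subst {n m k : ℕ} (σ : Fin n → PreExp m) (ρ : Fin m → Fin k) (e : PreExp n) :
    (e.subst σ).rename ρ = e.subst (fun i => (σ i).rename ρ) := by
  induction e generalizing m k <;> simp [rename, subst, lift_rename, *]

theorem lift_comp_lift {n m k : ℕ} (σ : Fin n → PreExp m) (τ : Fin m → PreExp k) :
    lift σ ⊚ lift τ = lift (σ ⊚ τ) := by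
  funext i
  cases i using Fin.cases
  · simp [lift, comp, subst]
  · simp [lift, comp, wk, subst_rename, rename_subst]

@[simp] theorem subst_subst {n m k : ℕ} (σ : Fin n → PreExp m) (τ : Fin m → PreExp k)
    (e : PreExp n) : (e.subst σ).subst τ = e.subst (σ ⊚ τ) := by
  induction e generalizing m k <;> simp [subst, lift_comp_lift, *]
  rfl

theorem lift_var {n : ℕ} : lift (var : Fin n → PreExp n) = var := by
  funext i
  cases i using Fin.cases <;> simp [lift, wk, rename]

@[simp] theorem subst_var {n : ℕ} (e : PreExp n) : e.subst var = e := by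
  induction e <;> simp [subst, lift_var, *]

@[simp] theorem var_comp {n m : ℕ} (σ : Fin n → PreExp m) : var ⊚ σ = σ := rfl

@[simp] theorem comp_var {n m : ℕ} (σ : Fin n → PreExp m) : σ ⊚ var = σ := by
  funext i; simp [comp]

@[simp] theorem comp_assoc {n m k l : ℕ} (σ : Fin n → PreExp m) (τ : Fin m → PreExp k)
    (υ : Fin k → PreExp l) : (σ ⊚ τ) ⊚ υ = σ ⊚ τ ⊚ υ := by
  funext i; simp [comp]

@[simp] theorem scons_comp {n m k : ℕ} (a : PreExp m) (σ : Fin n → PreExp m)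
    (τ : Fin m → PreExp k) : scons a σ ⊚ τ = scons (a.subst τ) (σ ⊚ τ) := by
  funext i
  cases i using Fin.cases <;> simp [scons, comp]

@[simp] theorem S_comp_scons {n m : ℕ} (a : PreExp m) (σ : Fin n → PreExp m) :
    S ⊚ scons a σ = σ := rfl

@[simp] theorem S_comp_scons_comp {n m k : ℕ} (a : PreExp m) (σ : Fin n → PreExp m)
    (τ : Fin m → PreExp k) : S ⊚ scons a σ ⊚ τ = σ ⊚ τ := rfl

@[simp] theorem scons_zero {n m : ℕ} (a : PreExp m) (σ : Fin n → PreExp m) :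
    scons a σ 0 = a := rfl

@[simp] theorem scons_succ {n m : ℕ} (a : PreExp m) (σ : Fin n → PreExp m) (i : Fin n) :
    scons a σ i.succ = σ i := rfl

@[simp] theorem scons_one {n m : ℕ} (a : PreExp m) (σ : Fin (n + 1) → PreExp m) :
    scons a σ 1 = σ 0 := rfl

@[simp] theorem scons_two {n m : ℕ} (a : PreExp m) (σ : Fin (n + 2) → PreExp m) :
    scons a σ 2 = σ 1 := rfl

@[simp] theorem scons_three {n m : ℕ} (a : PreExp m) (σ : Fin (n + 3) → PreExp m) :
    scons a σ 3 = σ 2 := rfl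

theorem S_apply {n : ℕ} (i : Fin n) : S i = var i.succ := rfl

@[simp] theorem S_zero {n : ℕ} : S (0 : Fin (n + 1)) = var 1 := rfl

@[simp] theorem S_one {n : ℕ} : S (1 : Fin (n + 2)) = var 2 := rfl

@[simp] theorem S_two {n : ℕ} : S (2 : Fin (n + 3)) = var 3 := rfl

theorem comp_apply {n m k : ℕ} (σ : Fin n → PreExp m) (τ : Fin m → PreExp k) (i : Fin n) :
    (σ ⊚ τ) i = (σ i).subst τ := rfl

@[simp] theorem S_comp_zero {n m : ℕ} (σ : Fin (n + 2) → PreExp m) : (S ⊚ σ) 0 = σ 1 := rfl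

@[simp] theorem S_comp_one {n m : ℕ} (σ : Fin (n + 3) → PreExp m) : (S ⊚ σ) 1 = σ 2 := rfl

@[simp] theorem S_comp_two {n m : ℕ} (σ : Fin (n + 4) → PreExp m) : (S ⊚ σ) 2 = σ 3 := rfl

@[simp] theorem scons_eta {n m : ℕ} (σ : Fin (n + 1) → PreExp m) :
    scons (σ 0) (S ⊚ σ) = σ := by
  funext i
  cases i using Fin.cases <;> rfl

@[simp] theorem scons_eta_comp {n m k : ℕ} (σ : Fin (n + 1) → PreExp m) (τ : Fin m → PreExp k) :
    scons ((σ 0).subst τ) (S ⊚ σ ⊚ τ) = σ ⊚ τ := scons_eta (σ ⊚ τ)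

@[simp] theorem scons_var_zero {n : ℕ} : scons (var 0) (S : Fin n → PreExp (n + 1)) = var :=
  scons_eta var

@[simp] theorem scons_var_one {n : ℕ} :
    scons (var 1) ((S : Fin n → PreExp (n + 1)) ⊚ S) = S :=
  scons_eta (S : Fin (n + 1) → PreExp (n + 2))

@[simp] theorem scons_var_two {n : ℕ} :
    scons (var 2) ((S : Fin n → PreExp (n + 1)) ⊚ S ⊚ S) = S ⊚ S :=
  scons_eta ((S : Fin (n + 1) → PreExp (n + 2)) ⊚ S)

@[simp] theorem shift_one {n : ℕ} : (shift 1 : Fin n → PreExp (n + 1)) = S := rfl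

@[simp] theorem shift_two {n : ℕ} : (shift 2 : Fin n → PreExp (n + 2)) = S ⊚ S := rfl

@[simp] theorem shift_three {n : ℕ} : (shift 3 : Fin n → PreExp (n + 3)) = S ⊚ S ⊚ S := rfl

@[simp] theorem shift_four {n : ℕ} : (shift 4 : Fin n → PreExp (n + 4)) = S ⊚ S ⊚ S ⊚ S := rfl

@[simp] theorem shift_five {n : ℕ} :
    (shift 5 : Fin n → PreExp (n + 5)) = S ⊚ S ⊚ S ⊚ S ⊚ S := rfl

-- Once weakening, lifting and all forms of instantiation are unfolded to `scons`, `S` and `⊚`, the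
-- rewrite rules above normalise simultaneous substitutions. Most uses of `simpa` below only
-- identify two such expressions.
attribute [simp] subst wk_eq lift_eq inst inst₂ inst₃ instAt instAt₂

end PreExp

open PreExp

theorem Ctx.get_zero {n : ℕ} (Γ : Ctx n) (A : PreExp n) : (Γ ▹ A).get 0 = A.subst S := by
  simp [Ctx.get]

theorem Ctx.get_succ {n : ℕ} (Γ : Ctx n) (A : PreExp n) (i : Fin n) :
    (Γ ▹ A).get i.succ = (Γ.get i).subst S := by
  simp [Ctx.get]

open PreExp Judgement

/-! ### Contexts of derivable judgements -/

/-- The context of a judgement. -/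
@[simp] abbrev Judgement.context {n : ℕ} : Judgement n → Ctx n
  | .ctx Γ => Γ
  | .type _ Γ _ => Γ
  | .typeEq _ Γ _ _ => Γ
  | .term Γ _ _ => Γ
  | .termEq Γ _ _ _ => Γ

/-- All declarations of a context are derivable collections. -/
def Ctx.Valid (T : Theory) : {n : ℕ} → Ctx n → Prop
  | _, .nil => True
  | _, .snoc Γ A => Γ.Valid T ∧ Derivable T (type .col Γ A)

/-- Each rule has a premise over the context of its conclusion or over a one-variable extension of
it, apart from the two rules forming contexts. Validity therefore passes from premises to
conclusion. -/
theorem Derivable.valid {T : Theory} {n : ℕ} {J : Judgement n} (h : Derivable T J) :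
    J.context.Valid T := by
  induction h <;> dsimp only [Judgement.context] at * <;>
    first
      | assumption
      | trivial
      | exact And.intro ‹_› ‹_›
      | exact And.left ‹_›

theorem Ctx.Valid.ctx {T : Theory} {n : ℕ} {Γ : Ctx n} (h : Γ.Valid T) :
    Derivable T (.ctx Γ) := by
  cases Γ with
  | nil => exact .ctx_nil
  | snoc Γ A => exact .ctx_snoc h.2

theorem Derivable.ctx {T : Theory} {n : ℕ} {J : Judgement n} (h : Derivable T J) :
    Derivable T (.ctx J.context) := h.valid.ctx

/-- Many rules do not ask separately for the type bound by their premises; it is recovered here from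
the context of such a premise. -/
theorem Derivable.head_type {T : Theory} {n : ℕ} {Γ : Ctx n} {A : PreExp n}
    {J : Judgement (n + 1)} (h : Derivable T J) (hJ : J.context = Γ ▹ A := by rfl) :
    Derivable T (type .col Γ A) := by
  have := h.valid
  rw [hJ] at this
  exact this.2

/-! ### Raw shape of types and propositions -/

/-- The outermost constructor forms a proposition. -/
def PreExp.IsProp {n : ℕ} : PreExp n → Prop
  | .bot | .and _ _ | .or _ _ | .imp _ _ | .ex _ _ | .all _ _ | .eq _ _ _ => True
  | _ => False

/-- The outermost constructor forms a type. -/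
def PreExp.IsType {n : ℕ} : PreExp n → Prop
  | .empty | .unit | .sigma _ _ | .pi _ _ | .sum _ _ | .list _ | .quot _ _ | .pow => True
  | A => A.IsProp

theorem PreExp.IsProp.isType {n : ℕ} {A : PreExp n} (h : A.IsProp) : A.IsType := by
  cases A <;> trivial

theorem PreExp.IsProp.subst {n m : ℕ} {A : PreExp n} (h : A.IsProp) (σ : Fin n → PreExp m) :
    (A.subst σ).IsProp := by
  cases A <;> trivial

theorem PreExp.IsType.subst {n m : ℕ} {A : PreExp n} (h : A.IsType) (σ : Fin n → PreExp m) :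
    (A.subst σ).IsType := by
  cases A <;> trivial

/-- The raw shape that a kind imposes. -/
def Kind.Shape {n : ℕ} : Kind → PreExp n → Prop
  | .proposition _, A => A.IsProp
  | .collection _, A => A.IsType

theorem Kind.Shape.isType {n : ℕ} {k : Kind} {A : PreExp n} (h : k.Shape A) : A.IsType := by
  cases k
  · exact PreExp.IsProp.isType h
  · exact h

theorem Kind.Shape.into {T : Theory} {n : ℕ} {k k' : Kind} {A : PreExp n} (h : k.Shape A)
    (hk : Kind.Into T k k') : k'.Shape A := by
  cases hk <;> first | exact h | exact PreExp.IsProp.isType h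

theorem Kind.Shape.subst {n m : ℕ} {k : Kind} {A : PreExp n} (h : k.Shape A)
    (σ : Fin n → PreExp m) : k.Shape (A.subst σ) := by
  cases k
  · exact PreExp.IsProp.subst h σ
  · exact PreExp.IsType.subst h σ

/-- There are no universes: an element of P(1) becomes a proposition only through an equality. Hence
formation rules always produce a type constructor at the root, and kind inclusions and substitutions
keep it. This is why recursion on raw types can reach every derivable type. -/
theorem Derivable.shape {T : Theory} {n : ℕ} {J : Judgement n} (h : Derivable T J) :
    match J with
    | .type k _ A => k.Shape A
    | _ => True := by
  induction h <;> dsimp only at * <;>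
    first
      | trivial
      | exact Kind.Shape.into ‹_› ‹_›
      | exact Kind.Shape.subst ‹_› _

/-! ### Resizing -/

/-- The theory contains the resizing rules. -/
class Theory.Impredicative (T : Theory) : Prop where
  resizing : ExtraRule.resizing ∈ T

section

variable {T : Theory}

namespace Derivable

theorem col {n : ℕ} {Γ : Ctx n} {A : PreExp n} {k : Kind} (h : Derivable T (type k Γ A)) :
    Derivable T (type .col Γ A) := by
  rcases k with ⟨_ | _⟩ | ⟨_ | _⟩
  · exact .type_into .set_into_col (.type_into .props_into_set h)
  · exact .type_into .prop_into_col h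
  · exact .type_into .set_into_col h
  · exact h

theorem eq_col {n : ℕ} {Γ : Ctx n} {A B : PreExp n} {k : Kind}
    (h : Derivable T (typeEq k Γ A B)) : Derivable T (typeEq .col Γ A B) := by
  rcases k with ⟨_ | _⟩ | ⟨_ | _⟩
  · exact .typeEq_into .set_into_col (.typeEq_into .props_into_set h)
  · exact .typeEq_into .prop_into_col h
  · exact .typeEq_into .set_into_col h
  · exact h

theorem prop {n : ℕ} {Γ : Ctx n} {A : PreExp n} {s : Size}
    (h : Derivable T (type (.proposition s) Γ A)) : Derivable T (type .prop Γ A) := by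
  cases s
  · exact .type_into .props_into_prop h
  · exact h

theorem eq_prop {n : ℕ} {Γ : Ctx n} {A B : PreExp n} {s : Size}
    (h : Derivable T (typeEq (.proposition s) Γ A B)) : Derivable T (typeEq .prop Γ A B) := by
  cases s
  · exact .typeEq_into .props_into_prop h
  · exact h

variable [hT : T.Impredicative]

/-- With resizing, sizes carry no information, and any type may be used where a rule asks for a set.
-/
theorem collection {n : ℕ} {Γ : Ctx n} {A : PreExp n} {k : Kind} (s : Size)
    (h : Derivable T (type k Γ A)) : Derivable T (type (.collection s) Γ A) := by
  cases s
  · exact .type_into (.col_into_set hT.resizing) h.col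
  · exact h.col

theorem eq_collection {n : ℕ} {Γ : Ctx n} {A B : PreExp n} {k : Kind} (s : Size)
    (h : Derivable T (typeEq k Γ A B)) : Derivable T (typeEq (.collection s) Γ A B) := by
  cases s
  · exact .typeEq_into (.col_into_set hT.resizing) h.eq_col
  · exact h.eq_col

theorem proposition {n : ℕ} {Γ : Ctx n} {A : PreExp n} {s : Size} (s' : Size)
    (h : Derivable T (type (.proposition s) Γ A)) :
    Derivable T (type (.proposition s') Γ A) := by
  cases s'
  · exact .type_into (.prop_into_props hT.resizing) h.prop
  · exact h.prop

theorem eq_proposition {n : ℕ} {Γ : Ctx n} {A B : PreExp n} {s : Size} (s' : Size)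
    (h : Derivable T (typeEq (.proposition s) Γ A B)) :
    Derivable T (typeEq (.proposition s') Γ A B) := by
  cases s'
  · exact .typeEq_into (.prop_into_props hT.resizing) h.eq_prop
  · exact h.eq_prop

end Derivable

/-! ### Typed substitutions -/

/-- `σ` is a telescopic substitution for `Γ` in the context `Δ`. -/
structure Sub (T : Theory) {n m : ℕ} (Δ : Ctx m) (σ : Fin n → PreExp m) (Γ : Ctx n) : Prop where
  ctx : Derivable T (.ctx Δ)
  term : ∀ i, Derivable T (.term Δ (σ i) ((Γ.get i).subst σ))

/-- `σ` and `τ` are equal telescopic substitutions for `Γ` in the context `Δ`. -/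
structure SubEq (T : Theory) {n m : ℕ} (Δ : Ctx m) (σ τ : Fin n → PreExp m) (Γ : Ctx n) :
    Prop where
  left : Sub T Δ σ Γ
  right : Sub T Δ τ Γ
  eq : ∀ i, Derivable T (.termEq Δ (σ i) (τ i) ((Γ.get i).subst σ))

namespace Derivable

variable {n m : ℕ} {Γ : Ctx n} {Δ : Ctx m} {σ τ : Fin n → PreExp m} {A B a b : PreExp n}
  {k : Kind}

theorem sub_type (h : Derivable T (type k Γ A)) (hσ : Sub T Δ σ Γ) :
    Derivable T (type k Δ (A.subst σ)) := .type_subst hσ.1 hσ.2 h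

theorem sub_typeEq (h : Derivable T (typeEq k Γ A B)) (hσ : Sub T Δ σ Γ) :
    Derivable T (typeEq k Δ (A.subst σ) (B.subst σ)) := .typeEq_subst hσ.1 hσ.2 h

theorem sub_term (h : Derivable T (term Γ a A)) (hσ : Sub T Δ σ Γ) :
    Derivable T (term Δ (a.subst σ) (A.subst σ)) := .term_subst hσ.1 hσ.2 h

theorem sub_termEq (h : Derivable T (termEq Γ a b A)) (hσ : Sub T Δ σ Γ) :
    Derivable T (termEq Δ (a.subst σ) (b.subst σ) (A.subst σ)) := .termEq_subst hσ.1 hσ.2 h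

theorem subEq_type (h : Derivable T (type k Γ A)) (hσ : SubEq T Δ σ τ Γ) :
    Derivable T (typeEq k Δ (A.subst σ) (A.subst τ)) :=
  .type_subst_eq hσ.1.1 hσ.1.2 hσ.2.2 hσ.3 h

theorem subEq_term (h : Derivable T (term Γ a A)) (hσ : SubEq T Δ σ τ Γ) :
    Derivable T (termEq Δ (a.subst σ) (a.subst τ) (A.subst σ)) :=
  .term_subst_eq hσ.1.1 hσ.1.2 hσ.2.2 hσ.3 h

theorem subEq_typeEq (h : Derivable T (typeEq k Γ A B)) (hB : Derivable T (type k Γ B))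
    (hσ : SubEq T Δ σ τ Γ) : Derivable T (typeEq k Δ (A.subst σ) (B.subst τ)) :=
  .typeEq_trans (h.sub_typeEq hσ.1) (hB.subEq_type hσ)

theorem subEq_termEq (h : Derivable T (termEq Γ a b A)) (hb : Derivable T (term Γ b A))
    (hσ : SubEq T Δ σ τ Γ) :
    Derivable T (termEq Δ (a.subst σ) (b.subst τ) (A.subst σ)) :=
  .termEq_trans (h.sub_termEq hσ.1) (hb.subEq_term hσ)

/-- Conversion up to syntactic equality of the components. -/
theorem term_cast {a' A' : PreExp n} (h : Derivable T (term Γ a A)) (ha : a = a' := by simp)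
    (hA : A = A' := by simp) : Derivable T (term Γ a' A') := ha ▸ hA ▸ h

theorem termEq_cast {a' b' A' : PreExp n} (h : Derivable T (termEq Γ a b A))
    (ha : a = a' := by simp) (hb : b = b' := by simp) (hA : A = A' := by simp) :
    Derivable T (termEq Γ a' b' A') := ha ▸ hb ▸ hA ▸ h

end Derivable

namespace Sub

variable {n m l : ℕ} {Γ : Ctx n} {Δ : Ctx m} {Ξ : Ctx l} {σ : Fin n → PreExp m}
  {τ : Fin m → PreExp l}

theorem id (h : Derivable T (.ctx Γ)) : Sub T Γ PreExp.var Γ :=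
  ⟨h, fun i => by simpa using Derivable.var i h⟩

theorem S {A : PreExp n} (h : Derivable T (type k Γ A)) : Sub T (Γ ▹ A) PreExp.S Γ := by
  refine ⟨.ctx_snoc h.col, fun i => ?_⟩
  have := Derivable.var i.succ (.ctx_snoc h.col)
  rwa [Ctx.get_succ] at this

theorem comp (hσ : Sub T Δ σ Γ) (hτ : Sub T Ξ τ Δ) : Sub T Ξ (σ ⊚ τ) Γ :=
  ⟨hτ.1, fun i => by simpa [comp_apply] using (hσ.2 i).sub_term hτ⟩

theorem scons {A : PreExp n} {a : PreExp m} (hσ : Sub T Δ σ Γ)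
    (ha : Derivable T (.term Δ a (A.subst σ))) : Sub T Δ (PreExp.scons a σ) (Γ ▹ A) := by
  refine ⟨hσ.1, fun i => ?_⟩
  cases i using Fin.cases with
  | zero => simpa [Ctx.get_zero] using ha
  | succ i => simpa [Ctx.get_succ] using hσ.2 i

theorem wk {A : PreExp m} (hσ : Sub T Δ σ Γ) (h : Derivable T (type k Δ A)) :
    Sub T (Δ ▹ A) (σ ⊚ PreExp.S) Γ := hσ.comp (.S h)

end Sub

theorem Derivable.var_zero {n : ℕ} {Γ : Ctx n} {A : PreExp n} {k : Kind}
    (h : Derivable T (type k Γ A)) : Derivable T (term (Γ ▹ A) (.var 0) (A.subst PreExp.S)) := by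
  simpa [Ctx.get_zero] using Derivable.var 0 (.ctx_snoc h.col)

namespace Sub

variable {n m l : ℕ} {Γ : Ctx n} {Δ : Ctx m} {Ξ : Ctx l} {σ : Fin n → PreExp m}
  {τ : Fin m → PreExp l} {k : Kind}

theorem lift {A : PreExp n} (hσ : Sub T Δ σ Γ) (h : Derivable T (type k Γ A)) :
    Sub T (Δ ▹ A.subst σ) (PreExp.lift σ) (Γ ▹ A) := by
  have hA := h.sub_type hσ
  rw [lift_eq]
  refine (hσ.wk hA).scons ?_
  simpa using hA.var_zero

theorem inst {A a : PreExp n} (h : Derivable T (.term Γ a A)) :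
    Sub T Γ (PreExp.scons a PreExp.var) (Γ ▹ A) :=
  (Sub.id h.ctx).scons (by rwa [subst_var])

/-- Context conversion. -/
theorem conv {A B : PreExp n} {Δ : Ctx n} (hσ : Sub T Δ PreExp.var Γ)
    (hA : Derivable T (type k Δ A)) (h : Derivable T (typeEq k Δ A B)) :
    Sub T (Δ ▹ A) PreExp.var (Γ ▹ B) := by
  rw [← scons_var_zero]
  refine Sub.scons ?_ (.conv hA.var_zero (h.eq_col.sub_typeEq (Sub.S hA)))
  simpa using hσ.wk hA

end Sub

namespace SubEq

variable {n m l : ℕ} {Γ : Ctx n} {Δ : Ctx m} {Ξ : Ctx l} {σ τ : Fin n → PreExp m}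
  {θ υ : Fin m → PreExp l} {k : Kind}

theorem refl (h : Sub T Δ σ Γ) : SubEq T Δ σ σ Γ := ⟨h, h, fun i => .termEq_refl (h.2 i)⟩

theorem comp_sub (hσ : SubEq T Δ σ τ Γ) (hθ : Sub T Ξ θ Δ) :
    SubEq T Ξ (σ ⊚ θ) (τ ⊚ θ) Γ :=
  ⟨hσ.1.comp hθ, hσ.2.comp hθ, fun i => by
    simpa [comp_apply] using (hσ.3 i).sub_termEq hθ⟩

/-- Both terms are given at the type seen from the left substitution; the typing of `b` required on
the right comes from substituting equals in `A`. -/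
theorem scons {A : PreExp n} {a b : PreExp m} (hσ : SubEq T Δ σ τ Γ)
    (hA : Derivable T (type k Γ A))
    (ha : Derivable T (.term Δ a (A.subst σ))) (hb : Derivable T (.term Δ b (A.subst σ)))
    (h : Derivable T (.termEq Δ a b (A.subst σ))) :
    SubEq T Δ (PreExp.scons a σ) (PreExp.scons b τ) (Γ ▹ A) := by
  refine ⟨hσ.1.scons ha, hσ.2.scons (hb.conv (hA.subEq_type hσ).eq_col), fun i => ?_⟩
  cases i using Fin.cases with
  | zero => simpa [Ctx.get_zero] using h
  | succ i => simpa [Ctx.get_succ] using hσ.3 i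

theorem inst {A a b : PreExp n} (hA : Derivable T (type k Γ A))
    (ha : Derivable T (.term Γ a A)) (hb : Derivable T (.term Γ b A))
    (h : Derivable T (.termEq Γ a b A)) :
    SubEq T Γ (PreExp.scons a PreExp.var) (PreExp.scons b PreExp.var) (Γ ▹ A) :=
  (SubEq.refl (Sub.id ha.ctx)).scons hA (by rwa [subst_var]) (by rwa [subst_var])
    (by rwa [subst_var])

end SubEq

end

section

variable {T : Theory}

/-! ### Inversion of products and quotients -/

/-- The components of a product, a list type, a quotient or an equality are derivable. -/
def ComponentsDerivable (T : Theory) {n : ℕ} (Γ : Ctx n) : PreExp n → Prop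
  | .pi A B => Derivable T (type .col Γ A) ∧ Derivable T (type .col (Γ ▹ A) B)
  | .quot A R => Derivable T (type .set Γ A) ∧ Derivable T (type .props (Γ ▹ A ▹ A.wk) R)
  | .list A => Derivable T (type .set Γ A)
  | .eq A a _ => Derivable T (term Γ a A)
  | _ => True

theorem ComponentsDerivable.subst {n m : ℕ} {Γ : Ctx n} {Δ : Ctx m} {σ : Fin n → PreExp m}
    {A : PreExp n} (h : ComponentsDerivable T Γ A) (hA : A.IsType) (hσ : Sub T Δ σ Γ) :
    ComponentsDerivable T Δ (A.subst σ) := by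
  cases A <;> try trivial
  case pi A B => exact ⟨h.1.sub_type hσ, h.2.sub_type (hσ.lift h.1)⟩
  case list A => exact Derivable.sub_type h hσ
  case eq A a b => exact Derivable.sub_term h hσ
  case quot A R =>
    refine ⟨h.1.sub_type hσ, ?_⟩
    have hw : Derivable T (type .set (Γ ▹ A) A.wk) := by
      rw [wk_eq]; exact h.1.sub_type (.S h.1)
    have := h.2.sub_type ((hσ.lift h.1).lift hw)
    convert this using 2
    simp

/-- A judgement that something is a type is derived only by formation rules, kind inclusions and
substitutions, so inversion is a plain induction as soon as the components are stable under
substitution. Products have two formation rules, one of them with codomain P(1). -/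
theorem Derivable.components {n : ℕ} {J : Judgement n} (h : Derivable T J) :
    match J with
    | .type _ Γ A => ComponentsDerivable T Γ A
    | _ => True := by
  induction h <;> dsimp only at * <;>
    first
      | trivial
      | exact ComponentsDerivable.subst ‹_› (Kind.Shape.isType (Derivable.shape ‹_›)) ⟨‹_›, ‹_›⟩
      | exact ⟨‹_›, ‹_›⟩
      | exact ‹Derivable T (type .set _ _)›
      | skip
  case pi_form h₁ h₂ _ _ => exact ⟨h₁.col, h₂.col⟩
  case pi_pow_form h _ => exact ⟨h.col, .pow_form (.ctx_snoc h.col)⟩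

namespace Derivable

variable {n : ℕ} {Γ : Ctx n} {A A' : PreExp n} {k : Kind}

theorem pi_left {B : PreExp (n + 1)} (h : Derivable T (type k Γ (pi A B))) :
    Derivable T (type .col Γ A) := h.components.1

theorem pi_right {B : PreExp (n + 1)} (h : Derivable T (type k Γ (pi A B))) :
    Derivable T (type .col (Γ ▹ A) B) := h.components.2

theorem list_left (h : Derivable T (type k Γ (list A))) : Derivable T (type .set Γ A) :=
  h.components

theorem eq_left {a b : PreExp n} (h : Derivable T (type k Γ (eq A a b))) :
    Derivable T (term Γ a A) := h.components

theorem quot_left {R : PreExp (n + 2)} (h : Derivable T (type k Γ (quot A R))) :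
    Derivable T (type .set Γ A) := h.components.1

theorem quot_right {R : PreExp (n + 2)} (h : Derivable T (type k Γ (quot A R))) :
    Derivable T (type .props (Γ ▹ A ▹ A.wk) R) := h.components.2

theorem wk_type {B : PreExp n} {k' : Kind} (h : Derivable T (type k Γ A))
    (hB : Derivable T (type k' Γ B)) : Derivable T (type k (Γ ▹ B) A.wk) := by
  rw [wk_eq]; exact h.sub_type (.S hB)

theorem wk_typeEq {B : PreExp n} {k' : Kind} (h : Derivable T (typeEq k Γ A A'))
    (hB : Derivable T (type k' Γ B)) : Derivable T (typeEq k (Γ ▹ B) A.wk A'.wk) := by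
  simp only [wk_eq]; exact h.sub_typeEq (.S hB)

theorem wk_term {a B : PreExp n} {k' : Kind} (h : Derivable T (term Γ a A))
    (hB : Derivable T (type k' Γ B)) : Derivable T (term (Γ ▹ B) a.wk A.wk) := by
  simp only [wk_eq]; exact h.sub_term (.S hB)

theorem conv_type {Δ : Ctx n} (h : Derivable T (type k Γ A)) (hσ : Sub T Δ PreExp.var Γ) :
    Derivable T (type k Δ A) := by simpa using h.sub_type hσ

theorem conv_typeEq {Δ : Ctx n} (h : Derivable T (typeEq k Γ A A'))
    (hσ : Sub T Δ PreExp.var Γ) : Derivable T (typeEq k Δ A A') := by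
  simpa using h.sub_typeEq hσ

theorem conv_term {Δ : Ctx n} {a : PreExp n} (h : Derivable T (term Γ a A))
    (hσ : Sub T Δ PreExp.var Γ) : Derivable T (term Δ a A) := by simpa using h.sub_term hσ

theorem conv_termEq {Δ : Ctx n} {a b : PreExp n} (h : Derivable T (termEq Γ a b A))
    (hσ : Sub T Δ PreExp.var Γ) : Derivable T (termEq Δ a b A) := by
  simpa using h.sub_termEq hσ

theorem inst_type {a : PreExp n} {B : PreExp (n + 1)} (hB : Derivable T (type k (Γ ▹ A) B))
    (ha : Derivable T (term Γ a A)) : Derivable T (type k Γ (B.inst a)) := hB.sub_type (.inst ha)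

theorem inst_typeEq {a a' : PreExp n} {B B' : PreExp (n + 1)}
    (hB' : Derivable T (type k (Γ ▹ A) B')) (h : Derivable T (typeEq k (Γ ▹ A) B B'))
    (ha : Derivable T (term Γ a A)) (ha' : Derivable T (term Γ a' A))
    (haa : Derivable T (termEq Γ a a' A)) :
    Derivable T (typeEq k Γ (B.inst a) (B'.inst a')) :=
  h.subEq_typeEq hB' (.inst hB'.head_type ha ha' haa)

end Derivable

theorem Sub.wk2 {n m : ℕ} {Γ : Ctx n} {Δ : Ctx m} {σ : Fin n → PreExp m}
    {k : Kind} {A : PreExp m} {B : PreExp (m + 1)}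
    (hσ : Sub T Δ σ Γ) (h : Derivable T (type k (Δ ▹ A) B)) :
    Sub T (Δ ▹ A ▹ B) (σ ⊚ PreExp.S ⊚ PreExp.S) Γ := by
  simpa using (hσ.wk h.head_type).wk h

/-! ### Presuppositions of derivable judgements -/

/-- What a judgement presupposes. -/
def Judgement.Presupposition (T : Theory) {n : ℕ} : Judgement n → Prop
  | .ctx _ => True
  | .type _ _ _ => True
  | .typeEq k Γ A B => Derivable T (type k Γ A) ∧ Derivable T (type k Γ B)
  | .term Γ _ A => Derivable T (type .col Γ A)
  | .termEq Γ a b A =>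
      Derivable T (type .col Γ A) ∧ Derivable T (term Γ a A) ∧ Derivable T (term Γ b A)

/-- The identity substitution, read between two contexts whose last declarations are equal types. It
moves the right-hand components of an equality, derived over `A`, to the context where they belong.
-/
theorem Sub.swap {n : ℕ} {Γ : Ctx n} {A A' : PreExp n} {k : Kind}
    (h : Derivable T (typeEq k Γ A A')) (hA' : Derivable T (type k Γ A')) :
    Sub T (Γ ▹ A') PreExp.var (Γ ▹ A) :=
  (Sub.id hA'.ctx).conv hA' h.typeEq_symm

namespace Derivable

variable {n : ℕ} {Γ : Ctx n} {A A' : PreExp n}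

theorem sigma_type {B : PreExp (n + 1)} (hB : Derivable T (type .col (Γ ▹ A) B)) :
    Derivable T (type .col Γ (sigma A B)) := .sigma_form hB.head_type hB

theorem generic_pair {B : PreExp (n + 1)} (hB : Derivable T (type .col (Γ ▹ A) B)) :
    Derivable T (term (Γ ▹ A ▹ B)
      (pair A.wk.wk (B.subst (lift (shift 2))) (.var 1) (.var 0))
      ((sigma A B).subst (PreExp.S ⊚ PreExp.S))) := by
  have hA := hB.head_type
  have hS := (Sub.id hB.head_type.ctx).wk2 hB
  have h := Derivable.sigma_intro (T := T) (hA.sub_type hS) (hB.sub_type (hS.lift hA))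
    (a := .var 1) (b := .var 0) (by simpa using hA.var_zero.sub_term (.S hB))
    (by simpa using hB.var_zero)
  simpa using h

theorem generic_pair_eq {B B' : PreExp (n + 1)} (hA : Derivable T (typeEq .col Γ A A'))
    (hB : Derivable T (typeEq .col (Γ ▹ A) B B')) (tB : Derivable T (type .col (Γ ▹ A) B)) :
    Derivable T (termEq (Γ ▹ A ▹ B)
      (pair A.wk.wk (B.subst (lift (shift 2))) (.var 1) (.var 0))
      (pair A'.wk.wk (B'.subst (lift (shift 2))) (.var 1) (.var 0))
      ((sigma A B).subst (PreExp.S ⊚ PreExp.S))) := by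
  have tA := tB.head_type
  have hS := (Sub.id tB.head_type.ctx).wk2 tB
  have h := Derivable.sigma_intro_eq (T := T) (hA.sub_typeEq hS) (hB.sub_typeEq (hS.lift tA))
    (a := .var 1) (b := .var 0) (a' := .var 1) (b' := .var 0)
    (.termEq_refl (by simpa using tA.var_zero.sub_term (.S tB)))
    (.termEq_refl (by simpa using tB.var_zero))
  simpa using h

end Derivable

theorem Derivable.trans_at {n m : ℕ} {Γ : Ctx n} {Δ : Ctx m} {M M' : PreExp (n + 1)}
    {A : PreExp n} {a a' : PreExp m} {σ : Fin n → PreExp m}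
    (hM : Derivable T (typeEq .col (Γ ▹ A) M M')) (hM' : Derivable T (type .col (Γ ▹ A) M'))
    (hσ : Sub T Δ σ Γ) (ha : Derivable T (term Δ a (A.subst σ)))
    (ha' : Derivable T (term Δ a' (A.subst σ)))
    (h : Derivable T (termEq Δ a a' (A.subst σ))) :
    Derivable T (typeEq .col Δ (M.subst (scons a σ)) (M'.subst (scons a' σ))) :=
  hM.subEq_typeEq hM' ((SubEq.refl hσ).scons hM'.head_type ha ha' h)

theorem Sub.S₂ {n : ℕ} {Γ : Ctx n} {A : PreExp n} {B : PreExp (n + 1)} {k : Kind}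
    (h : Derivable T (type k (Γ ▹ A) B)) :
    Sub T (Γ ▹ A ▹ B) (PreExp.S ⊚ PreExp.S) Γ := by
  simpa using (Sub.id h.head_type.ctx).wk2 h

theorem Sub.S₃ {n : ℕ} {Γ : Ctx n} {A : PreExp n} {B : PreExp (n + 1)} {C : PreExp (n + 2)}
    {k : Kind} (h : Derivable T (type k (Γ ▹ A ▹ B) C)) :
    Sub T (Γ ▹ A ▹ B ▹ C) (PreExp.S ⊚ PreExp.S ⊚ PreExp.S) Γ := by
  simpa using (Sub.S₂ h.head_type).wk h

namespace Derivable

variable {n : ℕ} {Γ : Ctx n} {A : PreExp n} {B : PreExp (n + 1)} {C : PreExp (n + 2)} {k : Kind}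

theorem var_one (h : Derivable T (type k (Γ ▹ A) B)) :
    Derivable T (term (Γ ▹ A ▹ B) (.var 1) (A.subst (PreExp.S ⊚ PreExp.S))) := by
  simpa using h.head_type.var_zero.sub_term (.S h)

theorem var_two (h : Derivable T (type k (Γ ▹ A ▹ B) C)) :
    Derivable T (term (Γ ▹ A ▹ B ▹ C) (.var 2)
      (A.subst (PreExp.S ⊚ PreExp.S ⊚ PreExp.S))) := by
  simpa using h.head_type.var_one.sub_term (.S h)

theorem quot_generic_eq {R : PreExp (n + 2)} (hQ : Derivable T (type .set Γ (quot A R))) :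
    Derivable T (termEq (Γ ▹ A ▹ A.wk ▹ R)
      (cls A.wk.wk.wk (R.subst (lift (lift (shift 3)))) (.var 2))
      (cls A.wk.wk.wk (R.subst (lift (lift (shift 3)))) (.var 1))
      ((quot A R).subst (PreExp.S ⊚ PreExp.S ⊚ PreExp.S))) := by
  have hR := hQ.quot_right
  have h := Derivable.quot_eq (T := T) (a := .var 2) (b := .var 1)
    (hQ.sub_type (.S₃ hR)) hR.var_two (by simpa using hR.var_one)
    (by simpa using Derivable.prop_true (hR.prop.sub_type (.S hR)) hR.var_zero)
  simpa using h

end Derivable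

/-- Compatibility with the relation is preserved by equality of families over a quotient. -/
theorem Derivable.quot_compat_congr {n : ℕ} {Γ : Ctx n} {A : PreExp n} {R : PreExp (n + 2)}
    {M l l' : PreExp (n + 1)} (hQ : Derivable T (type .set Γ (quot A R)))
    (hM : Derivable T (type .col (Γ ▹ quot A R) M))
    (hl : Derivable T (termEq (Γ ▹ A) l l'
      (M.instAt 1 (cls A.wk (R.subst (lift (lift (shift 1)))) (.var 0)))))
    (h : Derivable T (termEq (Γ ▹ A ▹ A.wk ▹ R) (l.instAt 3 (.var 2)) (l.instAt 3 (.var 1))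
      (M.instAt 3 (cls A.wk.wk.wk (R.subst (lift (lift (shift 3)))) (.var 2))))) :
    Derivable T (termEq (Γ ▹ A ▹ A.wk ▹ R) (l'.instAt 3 (.var 2)) (l'.instAt 3 (.var 1))
      (M.instAt 3 (cls A.wk.wk.wk (R.subst (lift (lift (shift 3)))) (.var 2)))) := by
  have hR := hQ.quot_right
  have tA := hQ.quot_left
  have h₂ := hl.sub_termEq (Sub.scons (.S₃ hR) hR.var_two)
  have h₁ := hl.sub_termEq (Sub.scons (.S₃ hR) (a := .var 1) (by simpa using hR.var_one))
  have hc (i) (hi : Derivable T (term (Γ ▹ A ▹ A.wk ▹ R) (.var i)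
      (A.subst (PreExp.S ⊚ PreExp.S ⊚ PreExp.S)))) :
      Derivable T (term (Γ ▹ A ▹ A.wk ▹ R)
      (cls A.wk.wk.wk (R.subst (lift (lift (shift 3)))) (.var i))
      ((quot A R).subst (PreExp.S ⊚ PreExp.S ⊚ PreExp.S))) := by
    simpa using Derivable.quot_intro (hQ.sub_type (.S₃ hR)) hi
  -- The equality of `l` and `l'` at the second representative is typed in the fibre over the class
  -- of the second, the goal in the fibre over the class of the first. The two fibres are equal
  -- because the classes are.
  have e := Derivable.trans_at (.typeEq_refl hM) hM (.S₃ hR)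
    (hc 2 hR.var_two) (hc 1 (by simpa using hR.var_one)) hQ.quot_generic_eq
  simp at h h₁ h₂ e ⊢
  exact h₂.termEq_symm.termEq_trans (h.termEq_trans (h₁.convEq e.typeEq_symm))

variable [T.Impredicative]

/-- The only real work is in the congruence rules. The right-hand side is first typed with its own
annotations, for which its subterms are converted to the primed types and contexts; the result is
then converted back to the type of the left-hand side. -/
theorem Derivable.presupposition {n : ℕ} {J : Judgement n} (h : Derivable T J) :
    J.Presupposition T := by
  induction h with
  | ctx_nil => trivial
  | ctx_snoc => trivial
  | @var n Γ i h ih =>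
    -- For variables the argument is an induction on the context instead, each declared type being
    -- supplied by validity.
    have hv := h.valid
    clear ih
    induction Γ with
    | nil => exact i.elim0
    | snoc Γ A ih =>
      simp only [Judgement.Presupposition]
      cases i using Fin.cases with
      | zero => rw [Ctx.get_zero]; exact hv.2.sub_type (.S hv.2)
      | succ i => rw [Ctx.get_succ]; exact (ih i hv.1.ctx hv.1).sub_type (.S hv.2)
  | type_into => trivial
  | typeEq_into hk _ ih => exact ⟨.type_into hk ih.1, .type_into hk ih.2⟩
  | typeEq_refl h _ => exact ⟨h, h⟩
  | typeEq_symm _ ih => exact ⟨ih.2, ih.1⟩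
  | typeEq_trans _ _ ih₁ ih₂ => exact ⟨ih₁.1, ih₂.2⟩
  | termEq_refl h ih => exact ⟨ih, h, h⟩
  | termEq_symm _ ih => exact ⟨ih.1, ih.2.2, ih.2.1⟩
  | termEq_trans _ _ ih₁ ih₂ => exact ⟨ih₁.1, ih₁.2.1, ih₂.2.2⟩
  | conv _ _ _ ih => exact ih.2
  | convEq _ hA ih₁ ih₂ => exact ⟨ih₂.2, .conv ih₁.2.1 hA, .conv ih₁.2.2 hA⟩
  | type_subst => trivial
  | typeEq_subst h hσ _ _ _ ih =>
    exact ⟨ih.1.sub_type ⟨h, hσ⟩, ih.2.sub_type ⟨h, hσ⟩⟩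
  | term_subst h hσ _ _ _ ih => exact Derivable.sub_type ih ⟨h, hσ⟩
  | termEq_subst h hσ _ _ _ ih =>
    exact ⟨ih.1.sub_type ⟨h, hσ⟩, ih.2.1.sub_term ⟨h, hσ⟩, ih.2.2.sub_term ⟨h, hσ⟩⟩
  | type_subst_eq h hσ hτ he hA _ _ _ _ ih =>
    exact ⟨hA.sub_type ⟨h, hσ⟩, hA.sub_type ⟨h, hτ⟩⟩
  | term_subst_eq h hσ hτ he ha _ _ _ _ ih =>
    exact ⟨Derivable.sub_type ih ⟨h, hσ⟩, ha.sub_term ⟨h, hσ⟩, (ha.sub_term ⟨h, hτ⟩).conv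
      (Derivable.subEq_type ih ⟨⟨h, hσ⟩, ⟨h, hτ⟩, he⟩).typeEq_symm⟩
  | prop_mono h hp hq => exact ⟨h.col, hp, hq⟩
  | prop_true h => exact h.col
  | empty_form => trivial
  | empty_elim hM hc => exact hM.inst_type hc
  | empty_elim_eq hM hc ihM ihc =>
    exact ⟨ihM.1.inst_type ihc.2.1, .empty_elim ihM.1 ihc.2.1,
      (Derivable.empty_elim ihM.2 ihc.2.2).conv
        (ihM.2.inst_typeEq hM ihc.2.1 ihc.2.2 hc).typeEq_symm⟩
  | unit_form => trivial
  | unit_intro h => exact (Derivable.unit_form h).col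
  | unit_elim hM ht => exact hM.inst_type ht
  | unit_elim_eq hM ht hc ihM iht ihc =>
    have hs := Derivable.unit_intro (T := T) iht.2.1.ctx
    exact ⟨ihM.1.inst_type iht.2.1, .unit_elim ihM.1 iht.2.1 ihc.2.1,
      (Derivable.unit_elim ihM.2 iht.2.2 (ihc.2.2.conv (hM.sub_typeEq (.inst hs)))).conv
        (ihM.2.inst_typeEq hM iht.2.1 iht.2.2 ht).typeEq_symm⟩
  | unit_beta hM hc ihM ihc =>
    exact ⟨ihc, .unit_elim hM (.unit_intro hc.ctx) hc, hc⟩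
  | sigma_form => trivial
  | sigma_form_eq hA hB ihA ihB =>
    exact ⟨.sigma_form ihA.1 ihB.1, .sigma_form ihA.2 (ihB.2.conv_type (.swap hA ihA.2))⟩
  | sigma_intro hA hB => exact .sigma_form hA hB
  | sigma_intro_eq hA hB ha hb ihA ihB iha ihb =>
    refine ⟨.sigma_form ihA.1 ihB.1, .sigma_intro ihA.1 ihB.1 iha.2.1 ihb.2.1, ?_⟩
    exact (Derivable.sigma_intro ihA.2 (ihB.2.conv_type (.swap hA ihA.2)) (iha.2.2.conv hA)
      (ihb.2.2.conv (ihB.2.inst_typeEq hB iha.2.1 iha.2.2 ha))).conv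
      (Derivable.sigma_form_eq hA hB).typeEq_symm
  | sigma_elim hM hd => exact hM.inst_type hd
  | sigma_elim_eq hA hB hM hd hm ihA ihB ihM ihd ihm =>
    have tB' := ihB.2.conv_type (.swap hA ihA.2)
    have hS := Derivable.sigma_form_eq hA hB
    refine ⟨ihM.1.inst_type ihd.2.1, .sigma_elim ihM.1 ihd.2.1 ihm.2.1,
      (Derivable.sigma_elim (ihM.2.conv_type (.swap hS (.sigma_form ihA.2 tB')))
        (ihd.2.2.conv hS) ?_).conv
        (ihM.2.inst_typeEq hM ihd.2.1 ihd.2.2 hd).typeEq_symm⟩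
    -- The branch `m'` is typed at the generic pair with unprimed annotations, whereas elimination
    -- with primed data expects the primed generic pair. The two pairs are equal, hence so are the
    -- fibres over them.
    have hp := Derivable.generic_pair_eq hA hB ihB.1
    have hp₁ := Derivable.generic_pair ihB.1
    have hp₂ := (Derivable.generic_pair tB').conv_term
      ((Sub.swap hA.typeEq_symm ihA.1).conv ihB.1 hB)
    have hs := (Sub.id ihA.1.ctx).wk2 ihB.1
    simp only [var_comp] at hs
    have e := hM.subEq_typeEq ihM.2 ((SubEq.refl hs).scons
      (Derivable.sigma_form ihA.1 ihB.1) hp₁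
      (hp₂.conv (hS.sub_typeEq hs).typeEq_symm) hp)
    exact (ihm.2.2.conv e).conv_term ((Sub.swap hA ihA.2).conv tB'
      (hB.typeEq_symm.conv_typeEq (.swap hA ihA.2)))
  | sigma_beta hM ha hb hm ihM iha ihb ihm =>
    have hp := Derivable.sigma_intro iha hm.head_type ha hb
    refine ⟨hM.inst_type hp, .sigma_elim hM hp hm, ?_⟩
    have := hm.sub_term ((Sub.inst ha).scons hb)
    simpa using this
  | pi_form => trivial
  | pi_form_eq hA hB ihA ihB =>
    exact ⟨.pi_form ihA.1 ihB.1, .pi_form ihA.2 (ihB.2.conv_type (.swap hA ihA.2))⟩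
  | pi_pow_form => trivial
  | pi_pow_form_eq hA ihA => exact ⟨.pi_pow_form ihA.1, .pi_pow_form ihA.2⟩
  | pi_intro h => exact h
  | pi_intro_eq hA hB hP hb ihA ihB ihP ihb =>
    refine ⟨ihP.1, .pi_intro ihP.1 ihb.2.1, (Derivable.pi_intro ihP.2 ?_).conv hP.typeEq_symm⟩
    exact (ihb.2.2.conv hB).conv_term (.swap hA ihA.2)
  | pi_elim hB hf ha => exact hB.inst_type ha
  | pi_elim_eq hA hB hP hf ha ihA ihB ihP ihf iha =>
    refine ⟨ihB.1.inst_type iha.2.1, .pi_elim ihB.1 ihf.2.1 iha.2.1,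
      (Derivable.pi_elim (ihB.2.conv_type (.swap hA ihA.2)) (ihf.2.2.conv hP)
        (iha.2.2.conv hA)).conv (ihB.2.inst_typeEq hB iha.2.1 iha.2.2 ha).typeEq_symm⟩
  | pi_beta hP hb ha ihP ihb iha =>
    exact ⟨Derivable.inst_type ihb ha, .pi_elim ihb (.pi_intro hP hb) ha,
      hb.sub_term (.inst ha)⟩
  | @pi_eta n Γ A f B hf ihf =>
    have hA : Derivable T (type .col Γ A) := Derivable.pi_left ihf
    have hB : Derivable T (type .col (Γ ▹ A) B) := Derivable.pi_right ihf
    refine ⟨ihf, .pi_intro ihf ?_, hf⟩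
    have := Derivable.pi_elim (T := T) (a := .var 0) (f := f.wk)
      (hB.sub_type ((Sub.S hA).lift hA))
      (by simpa using hf.wk_term hA) hA.var_zero
    simpa using this
  | sum_form => trivial
  | sum_form_eq hA hB ihA ihB =>
    exact ⟨.sum_form ihA.1 ihB.1, .sum_form ihA.2 ihB.2⟩
  | sum_inl hA hB => exact (Derivable.sum_form hA hB).col
  | sum_inl_eq hA hB ha ihA ihB iha =>
    exact ⟨(Derivable.sum_form ihA.1 ihB.1).col, .sum_inl ihA.1 ihB.1 iha.2.1,
      (Derivable.sum_inl ihA.2 ihB.2 (iha.2.2.conv hA.eq_col)).conv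
        (Derivable.sum_form_eq hA hB).typeEq_symm.eq_col⟩
  | sum_inr hA hB => exact (Derivable.sum_form hA hB).col
  | sum_inr_eq hA hB ha ihA ihB iha =>
    exact ⟨(Derivable.sum_form ihA.1 ihB.1).col, .sum_inr ihA.1 ihB.1 iha.2.1,
      (Derivable.sum_inr ihA.2 ihB.2 (iha.2.2.conv hB.eq_col)).conv
        (Derivable.sum_form_eq hA hB).typeEq_symm.eq_col⟩
  | sum_elim hM hd => exact hM.inst_type hd
  | @sum_elim_eq n Γ A A' B B' d d' M M' l l' r r' hA hB hM hd hl hr ihA ihB ihM ihd ihl ihr =>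
    have hS := (Derivable.sum_form_eq hA hB).eq_col
    have tS := (Derivable.sum_form ihA.1 ihB.1).col
    refine ⟨ihM.1.inst_type ihd.2.1, .sum_elim ihM.1 ihd.2.1 ihl.2.1 ihr.2.1,
      (Derivable.sum_elim (ihM.2.conv_type (.swap hS (Derivable.sum_form ihA.2 ihB.2).col))
        (ihd.2.2.conv hS) ?_ ?_).conv
        (ihM.2.inst_typeEq hM ihd.2.1 ihd.2.2 hd).typeEq_symm⟩
    · have hv : Derivable T (term (Γ ▹ A) (.var 0) A.wk) := by simpa using ihA.1.var_zero
      have e := hM.subEq_typeEq ihM.2 ((SubEq.refl (.S ihA.1)).scons tS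
        (a := inl A.wk B.wk (.var 0)) (b := inl A'.wk B'.wk (.var 0))
        (by simpa using Derivable.sum_inl (ihA.1.wk_type ihA.1) (ihB.1.wk_type ihA.1) hv)
        (by
          have := (Derivable.sum_inl (ihA.2.wk_type ihA.1) (ihB.2.wk_type ihA.1)
            (hv.conv (hA.eq_col.wk_typeEq ihA.1))).conv
              (hS.typeEq_symm.wk_typeEq ihA.1)
          simpa using this)
        (by
          simpa using Derivable.sum_inl_eq (hA.wk_typeEq ihA.1) (hB.wk_typeEq ihA.1)
            (.termEq_refl hv)))
      exact (ihl.2.2.conv e).conv_term (.swap hA ihA.2)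
    · have hv : Derivable T (term (Γ ▹ B) (.var 0) B.wk) := by simpa using ihB.1.var_zero
      have e := hM.subEq_typeEq ihM.2 ((SubEq.refl (.S ihB.1)).scons tS
        (a := inr A.wk B.wk (.var 0)) (b := inr A'.wk B'.wk (.var 0))
        (by simpa using Derivable.sum_inr (ihA.1.wk_type ihB.1) (ihB.1.wk_type ihB.1) hv)
        (by
          have := (Derivable.sum_inr (ihA.2.wk_type ihB.1) (ihB.2.wk_type ihB.1)
            (hv.conv (hB.eq_col.wk_typeEq ihB.1))).conv
              (hS.typeEq_symm.wk_typeEq ihB.1)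
          simpa using this)
        (by
          simpa using Derivable.sum_inr_eq (hA.wk_typeEq ihB.1) (hB.wk_typeEq ihB.1)
            (.termEq_refl hv)))
      exact (ihr.2.2.conv e).conv_term (.swap hB ihB.2)
  | sum_beta_inl hM ha hl hr ihM iha ihl ihr =>
    -- The summands are known only as declarations in the contexts of the branches, that is, as
    -- collections. Resizing is needed to see them as sets.
    have hp := Derivable.sum_inl (hl.head_type.collection .small) (hr.head_type.collection .small) ha
    refine ⟨hM.inst_type hp, .sum_elim hM hp hl hr, ?_⟩
    simpa using hl.sub_term (.inst ha)
  | sum_beta_inr hM ha hl hr ihM iha ihl ihr =>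
    have hp := Derivable.sum_inr (hl.head_type.collection .small) (hr.head_type.collection .small) ha
    refine ⟨hM.inst_type hp, .sum_elim hM hp hl hr, ?_⟩
    simpa using hr.sub_term (.inst ha)
  | list_form => trivial
  | list_form_eq hA ihA => exact ⟨.list_form ihA.1, .list_form ihA.2⟩
  | list_nil hA => exact (Derivable.list_form hA).col
  | list_nil_eq hA ihA =>
    exact ⟨(Derivable.list_form ihA.1).col, .list_nil ihA.1,
      (Derivable.list_nil ihA.2).conv (Derivable.list_form_eq hA).typeEq_symm.eq_col⟩
  | list_cons hA => exact (Derivable.list_form hA).col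
  | list_cons_eq hA hs ha ihA ihs iha =>
    have hL := (Derivable.list_form_eq hA).eq_col
    exact ⟨(Derivable.list_form ihA.1).col, .list_cons ihA.1 ihs.2.1 iha.2.1,
      (Derivable.list_cons ihA.2 (ihs.2.2.conv hL) (iha.2.2.conv hA.eq_col)).conv
        hL.typeEq_symm⟩
  | list_elim hM hs => exact hM.inst_type hs
  | @list_elim_eq n Γ A A' s s' a a' M M' l l' hA hM hs ha hl ihA ihM ihs iha ihl =>
    have hL := (Derivable.list_form_eq hA).eq_col
    have tL := (Derivable.list_form ihA.1).col
    have tL' := (Derivable.list_form ihA.2).col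
    have tN := ihl.2.1.head_type
    refine ⟨ihM.1.inst_type ihs.2.1, .list_elim ihM.1 ihs.2.1 iha.2.1 ihl.2.1,
      (Derivable.list_elim (ihM.2.conv_type (.swap hL tL')) (ihs.2.2.conv hL)
        (iha.2.2.conv ?_) ?_).conv (ihM.2.inst_typeEq hM ihs.2.1 ihs.2.2 hs).typeEq_symm⟩
    · exact ihM.2.inst_typeEq hM (.list_nil ihA.1)
        ((Derivable.list_nil ihA.2).conv hL.typeEq_symm) (.list_nil_eq hA)
    · have hv₂ : Derivable T (term (Γ ▹ list A ▹ A.wk ▹ M.instAt 2 (.var 1)) (.var 2)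
          (list A.wk.wk.wk)) := by simpa using tN.var_two
      have hv₁ : Derivable T (term (Γ ▹ list A ▹ A.wk ▹ M.instAt 2 (.var 1)) (.var 1)
          (A.wk.wk.wk)) := by simpa using tN.var_one
      have hA₃ : Derivable T (typeEq .set (Γ ▹ list A ▹ A.wk ▹ M.instAt 2 (.var 1))
          A.wk.wk.wk A'.wk.wk.wk) := by simpa using hA.sub_typeEq (Sub.S₃ tN)
      have tA₃ : Derivable T (type .set (Γ ▹ list A ▹ A.wk ▹ M.instAt 2 (.var 1))
          A.wk.wk.wk) := by simpa using ihA.1.sub_type (Sub.S₃ tN)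
      have tA₃' : Derivable T (type .set (Γ ▹ list A ▹ A.wk ▹ M.instAt 2 (.var 1))
          A'.wk.wk.wk) := by simpa using ihA.2.sub_type (Sub.S₃ tN)
      have hL₃ := (Derivable.list_form_eq hA₃).eq_col
      have e := Derivable.trans_at hM ihM.2 (.S₃ tN)
        (a := cons A.wk.wk.wk (.var 2) (.var 1)) (a' := cons A'.wk.wk.wk (.var 2) (.var 1))
        (by simpa using Derivable.list_cons tA₃ hv₂ hv₁)
        (by simpa using (Derivable.list_cons tA₃' (hv₂.conv hL₃) (hv₁.conv hA₃.eq_col)).conv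
                  hL₃.typeEq_symm)
        (by simpa using Derivable.list_cons_eq hA₃ (.termEq_refl hv₂) (.termEq_refl hv₁))
      have tA₁ := ihA.1.wk_type tL
      have tA₁' := ihA.2.wk_type tL'
      have h₂ := (Sub.swap hL tL').conv tA₁' (hA.typeEq_symm.wk_typeEq tL')
      have eN : Derivable T (typeEq .col (Γ ▹ list A ▹ A.wk) (M.instAt 2 (.var 1))
          (M'.instAt 2 (.var 1))) := hM.sub_typeEq (Sub.scons (.S₂ tA₁) tA₁.var_one)
      have tN' : Derivable T (type .col (Γ ▹ list A ▹ A.wk)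
          (M'.instAt 2 (.var 1))) := ihM.2.sub_type (Sub.scons (.S₂ tA₁) tA₁.var_one)
      exact (ihl.2.2.conv e).conv_term
        (h₂.conv (tN'.conv_type h₂) (eN.typeEq_symm.conv_typeEq h₂))
  | list_beta_nil hM ha hl ihM iha ihl =>
    exact ⟨iha, .list_elim hM (.list_nil hM.head_type.list_left) ha hl, ha⟩
  | @list_beta_cons n Γ A s b a M l hM hs hb ha hl ihM ihs ihb iha ihl =>
    have tA : Derivable T (type .set Γ A) := Derivable.collection .small ihb
    have hp := Derivable.list_cons tA hs hb
    have he := Derivable.list_elim hM hs ha hl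
    refine ⟨hM.inst_type hp, .list_elim hM hp ha hl, ?_⟩
    have := hl.sub_term (((Sub.inst hs).scons (a := b) (by simpa using hb)).scons
      (a := elList A M s a l) (by simpa using he))
    simpa using this
  | quot_form => trivial
  | quot_form_eq h h' => exact ⟨h, h'⟩
  | quot_intro h => exact h.col
  | quot_intro_eq h h' hA hR ha _ _ ihA ihR iha =>
    exact ⟨h.col, .quot_intro h iha.2.1, (Derivable.quot_intro h' (iha.2.2.conv hA.eq_col)).conv
      (Derivable.quot_form_eq h h' hA hR).typeEq_symm.eq_col⟩
  | quot_eq h ha hb => exact ⟨h.col, .quot_intro h ha, .quot_intro h hb⟩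
  | quot_eff h ha hb =>
    exact (h.quot_right.sub_type ((Sub.inst ha).scons (by simpa using hb))).col
  | quot_elim hM hp => exact hM.inst_type hp
  | @quot_elim_eq n Γ A A' p p' R R' M M' l l' h h' hA hR hM hp hl hc _ _ ihA ihR ihM ihp ihl ihc =>
    have hQ := (Derivable.quot_form_eq h h' hA hR).eq_col
    refine ⟨ihM.1.inst_type ihp.2.1, .quot_elim ihM.1 ihp.2.1 ihl.2.1 hc,
      (Derivable.quot_elim (ihM.2.conv_type (.swap hQ h'.col))
        (ihp.2.2.conv hQ) ?_ ?_).conv (ihM.2.inst_typeEq hM ihp.2.1 ihp.2.2 hp).typeEq_symm⟩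
    · have hv := ihA.1.var_zero
      have tQ := h.sub_type (Sub.S ihA.1)
      have tQ' := h'.sub_type (Sub.S ihA.1)
      have e := Derivable.trans_at hM ihM.2 (.S ihA.1)
        (.quot_intro tQ hv)
        ((Derivable.quot_intro tQ' (hv.conv (hA.eq_col.sub_typeEq (.S ihA.1)))).conv
          (hQ.sub_typeEq (.S ihA.1)).typeEq_symm)
        (.quot_intro_eq tQ tQ' (hA.sub_typeEq (.S ihA.1)) (by
          have := hR.sub_typeEq (((Sub.S ihA.1).lift ihA.1).lift (ihA.1.wk_type ihA.1))
          simpa using this) (.termEq_refl hv))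
      have := (ihl.2.2.conv (by simpa using e)).conv_term (.swap hA ihA.2)
      simpa using this
    -- The rule assumes compatibility with the relation for `l` only; it is transferred to `l'`
    -- along their equality.
    · have hc' := Derivable.quot_compat_congr h ihM.1 hl hc
      have tA' := ihA.2.wk_type ihA.2
      have hs := (Sub.swap hA ihA.2).conv tA' (hA.typeEq_symm.wk_typeEq ihA.2)
      have hs' := hs.conv (ihR.2.conv_type hs) (hR.typeEq_symm.conv_typeEq hs)
      have tR := h.quot_right
      have tQ := h.sub_type (Sub.S₃ tR)
      have tQ' := h'.sub_type (Sub.S₃ tR)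
      have hv := tR.var_two
      have e := Derivable.trans_at hM ihM.2 (.S₃ tR)
        (.quot_intro tQ hv)
        ((Derivable.quot_intro tQ' (hv.conv (hA.eq_col.sub_typeEq (.S₃ tR)))).conv
          (hQ.sub_typeEq (.S₃ tR)).typeEq_symm)
        (.quot_intro_eq tQ tQ' (hA.sub_typeEq (.S₃ tR)) (by
          have := hR.sub_typeEq (((Sub.S₃ tR).lift ihA.1).lift (ihA.1.wk_type ihA.1))
          simpa using this) (.termEq_refl hv))
      have := (hc'.convEq (by simpa using e)).conv_termEq hs'
      simpa using this
  | @quot_beta n Γ A a R M l hM ha hl hc ihM iha ihl =>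
    have hQ := hM.head_type.collection .small
    have hp := Derivable.quot_intro hQ ha
    refine ⟨hM.inst_type hp, .quot_elim hM hp hl hc, ?_⟩
    simpa using hl.sub_term (.inst ha)
  | pow_form => trivial
  | pow_intro h => exact .pow_form h.ctx
  | pow_intro_eq h ih => exact ⟨.pow_form ih.1.ctx, .pow_intro ih.1, .pow_intro ih.2⟩
  | pow_eq h h' => exact ⟨.pow_form h.ctx, .pow_intro h, .pow_intro h'⟩
  | pow_eff h h' =>
    exact (Derivable.and_form (.imp_form h h') (.imp_form h' h)).col
  | pow_eta h ih => 
    have := Derivable.bot_form (T := T) h.ctx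
    exact ⟨ih, h, .pow_intro (.pow_eq_small h (.pow_intro (.imp_form this this)))⟩
  | pow_eq_small => trivial
  | pow_eq_small_eq h h' ih ih' =>
    exact ⟨.pow_eq_small ih.2.1 ih'.2.1, .pow_eq_small ih.2.2 ih'.2.2⟩
  | bot_form => trivial
  | bot_elim h => exact h.col
  | and_form => trivial
  | and_form_eq _ _ ih ih' => exact ⟨.and_form ih.1 ih'.1, .and_form ih.2 ih'.2⟩
  | and_intro h h' => exact (Derivable.and_form h h').col
  | and_left h h' => exact h.col
  | and_right h h' => exact h'.col
  | or_form => trivial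
  | or_form_eq _ _ ih ih' => exact ⟨.or_form ih.1 ih'.1, .or_form ih.2 ih'.2⟩
  | or_inl h h' => exact (Derivable.or_form h h').col
  | or_inr h h' => exact (Derivable.or_form h h').col
  | or_elim _ _ h => exact h.col
  | imp_form => trivial
  | imp_form_eq _ _ ih ih' => exact ⟨.imp_form ih.1 ih'.1, .imp_form ih.2 ih'.2⟩
  | imp_intro h h' => exact (Derivable.imp_form h h').col
  | imp_elim h h' => exact h'.col
  | ex_form => trivial
  | ex_form_eq hA _ ih ih' =>
    exact ⟨.ex_form ih.1 ih'.1, .ex_form ih.2 (ih'.2.conv_type (.swap hA ih.2))⟩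
  | ex_intro h => exact (Derivable.ex_form h.head_type h).col
  | ex_elim _ h => exact h.col
  | all_form => trivial
  | all_form_eq hA _ ih ih' =>
    exact ⟨.all_form ih.1 ih'.1, .all_form ih.2 (ih'.2.conv_type (.swap hA ih.2))⟩
  | all_intro h => exact (Derivable.all_form h.head_type h).col
  | all_elim h _ ha => exact (h.inst_type ha).col
  | eq_form => trivial
  | eq_form_eq hA ha hb ihA iha ihb =>
    exact ⟨.eq_form ihA.1 iha.2.1 ihb.2.1, .eq_form ihA.2 (iha.2.2.conv hA.eq_col)
      (ihb.2.2.conv hA.eq_col)⟩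
  | eq_intro h ha => exact (Derivable.eq_form h ha ha).col
  | eq_reflection h ha hb => exact ⟨h, ha, hb⟩
  | lem _ h => exact (Derivable.or_form h (.imp_form h (Derivable.bot_form h.ctx).prop)).col
  | propext _ h h' => exact ⟨h, h'⟩

end

/-! ### Canonical representatives of propositions -/

namespace PreExp

/-- The canonical representative `Dc([φ])` of the propositions equiprovable with `φ`. -/
def collapse {n : ℕ} (φ : PreExp n) : PreExp n := dc (code φ)

@[simp] theorem collapse_subst {n m : ℕ} (σ : Fin n → PreExp m) (φ : PreExp n) :
    (collapse φ).subst σ = collapse (φ.subst σ) := rfl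

/-- Replacement of every proposition by its canonical representative. -/
def canon : {n : ℕ} → PreExp n → PreExp n
  | _, var i => var i
  | _, empty => empty
  | _, unit => unit
  | _, sigma A B => sigma A.canon B.canon
  | _, pi A B => pi A.canon B.canon
  | _, sum A B => sum A.canon B.canon
  | _, list A => list A.canon
  | _, quot A R => quot A.canon R.canon
  | _, pow => pow
  | _, bot => collapse bot
  | _, and φ ψ => collapse (and φ.canon ψ.canon)
  | _, or φ ψ => collapse (or φ.canon ψ.canon)
  | _, imp φ ψ => collapse (imp φ.canon ψ.canon)
  | _, ex A φ => collapse (ex A.canon φ.canon)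
  | _, all A φ => collapse (all A.canon φ.canon)
  | _, eq A a b => collapse (eq A.canon a.canon b.canon)
  | _, tt φ => tt φ.canon
  | _, elEmpty M c => elEmpty M.canon c.canon
  | _, star => star
  | _, elUnit M t c => elUnit M.canon t.canon c.canon
  | _, pair A B a b => pair A.canon B.canon a.canon b.canon
  | _, elSigma A B M d m => elSigma A.canon B.canon M.canon d.canon m.canon
  | _, lam A B b => lam A.canon B.canon b.canon
  | _, app A B f a => app A.canon B.canon f.canon a.canon
  | _, inl A B a => inl A.canon B.canon a.canon
  | _, inr A B b => inr A.canon B.canon b.canon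
  | _, elSum A B M d l r => elSum A.canon B.canon M.canon d.canon l.canon r.canon
  | _, nil A => nil A.canon
  | _, cons A s a => cons A.canon s.canon a.canon
  | _, elList A M s a l => elList A.canon M.canon s.canon a.canon l.canon
  | _, cls A R a => cls A.canon R.canon a.canon
  | _, elQuot A R M p l => elQuot A.canon R.canon M.canon p.canon l.canon
  | _, code φ => code φ.canon

/-- The canonical form of a substitution. -/
def canonS {n m : ℕ} (σ : Fin n → PreExp m) : Fin n → PreExp m := fun i => (σ i).canon

theorem canon_rename {n m : ℕ} (ρ : Fin n → Fin m) (e : PreExp n) :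
    (e.rename ρ).canon = e.canon.rename ρ := by
  induction e generalizing m <;> simp [rename, canon, collapse, *]

@[simp] theorem canon_wk {n : ℕ} (e : PreExp n) : e.wk.canon = e.canon.wk := canon_rename _ _

@[simp] theorem canonS_scons {n m : ℕ} (a : PreExp m) (σ : Fin n → PreExp m) :
    canonS (scons a σ) = scons a.canon (canonS σ) := by
  funext i
  cases i using Fin.cases <;> rfl

@[simp] theorem canonS_lift {n m : ℕ} (σ : Fin n → PreExp m) :
    canonS (lift σ) = lift (canonS σ) := by
  funext i
  cases i using Fin.cases with
  | zero => rfl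
  | succ i => exact canon_rename _ _

-- This holds on the nose because the frame Eq(P(1), [·], [⊤]) put around a proposition is closed.
-- Consequently the translation of a structural rule, or of a rule for a type constructor, is
-- literally an instance of the same rule.
@[simp] theorem canon_subst {n m : ℕ} (σ : Fin n → PreExp m) (e : PreExp n) :
    (e.subst σ).canon = e.canon.subst (canonS σ) := by
  induction e generalizing m <;>
    simp only [subst, canon, collapse, canonS_lift, *]
  rfl

@[simp] theorem canonS_shift {n k : ℕ} : canonS (shift k : Fin n → PreExp (n + k)) = shift k := rfl

@[simp] theorem canonS_S {n : ℕ} : canonS (S : Fin n → PreExp (n + 1)) = S := rfl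

@[simp] theorem canonS_var {n : ℕ} : canonS (var : Fin n → PreExp n) = var := rfl

@[simp] theorem canonS_comp {n m k : ℕ} (σ : Fin n → PreExp m) (τ : Fin m → PreExp k) :
    canonS (σ ⊚ τ) = canonS σ ⊚ canonS τ := by
  funext i
  exact canon_subst τ (σ i)

theorem canon_inst {n : ℕ} (B : PreExp (n + 1)) (a : PreExp n) :
    (B.inst a).canon = B.canon.inst a.canon := by
  simp only [inst, canon_subst, canonS_scons, canonS_var]

theorem canon_inst₂ {n : ℕ} (e : PreExp (n + 2)) (a b : PreExp n) :
    (e.inst₂ a b).canon = e.canon.inst₂ a.canon b.canon := by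
  simp only [inst₂, canon_subst, canonS_scons, canonS_var]

theorem canon_inst₃ {n : ℕ} (e : PreExp (n + 3)) (a b c : PreExp n) :
    (e.inst₃ a b c).canon = e.canon.inst₃ a.canon b.canon c.canon := by
  simp only [inst₃, canon_subst, canonS_scons, canonS_var]

theorem canon_instAt {n k : ℕ} (M : PreExp (n + 1)) (t : PreExp (n + k)) :
    (M.instAt k t).canon = M.canon.instAt k t.canon := by
  simp only [instAt, canon_subst, canonS_scons, canonS_shift]

theorem canon_instAt₂ {n k : ℕ} (R : PreExp (n + 2)) (a b : PreExp (n + k)) :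
    (R.instAt₂ k a b).canon = R.canon.instAt₂ k a.canon b.canon := by
  simp only [instAt₂, canon_subst, canonS_scons, canonS_shift]

theorem IsProp.exists_collapse {n : ℕ} {φ : PreExp n} (h : φ.IsProp) :
    ∃ ψ, φ.canon = collapse ψ := by
  cases φ <;> first | exact h.elim | exact ⟨_, rfl⟩

end PreExp

/-- The canonical form of a context. -/
def Ctx.canon : {n : ℕ} → Ctx n → Ctx n
  | _, .nil => .nil
  | _, .snoc Γ A => .snoc Γ.canon A.canon

theorem Ctx.get_canon {n : ℕ} (Γ : Ctx n) (i : Fin n) : Γ.canon.get i = (Γ.get i).canon := by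
  induction Γ with
  | nil => exact i.elim0
  | snoc Γ A ih =>
    cases i using Fin.cases with
    | zero => exact (canon_wk A).symm
    | succ i => exact (congrArg wk (ih i)).trans (canon_wk _).symm

/-- The canonical form of a judgement. -/
def Judgement.canon {n : ℕ} : Judgement n → Judgement n
  | .ctx Γ => .ctx Γ.canon
  | .type k Γ A => .type k Γ.canon A.canon
  | .typeEq k Γ A B => .typeEq k Γ.canon A.canon B.canon
  | .term Γ a A => .term Γ.canon a.canon A.canon
  | .termEq Γ a b A => .termEq Γ.canon a.canon b.canon A.canon

section

variable {T : Theory} [hT : T.Impredicative]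

namespace Derivable

variable {n : ℕ} {Γ : Ctx n} {φ ψ χ A a b : PreExp n} {s : Size} {k : Kind}

theorem presup (h : Derivable T (term Γ a A)) : Derivable T (type .col Γ A) := h.presupposition

theorem left (h : Derivable T (termEq Γ a b A)) : Derivable T (term Γ a A) := h.presupposition.2.1

theorem right (h : Derivable T (termEq Γ a b A)) : Derivable T (term Γ b A) :=
  h.presupposition.2.2

theorem eq_presup (h : Derivable T (termEq Γ a b A)) : Derivable T (type .col Γ A) :=
  h.presupposition.1

theorem type_left (h : Derivable T (typeEq k Γ A a)) : Derivable T (type k Γ A) :=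
  h.presupposition.1

theorem type_right (h : Derivable T (typeEq k Γ A a)) : Derivable T (type k Γ a) :=
  h.presupposition.2

theorem hyp (h : Derivable T (type .prop Γ φ)) : Derivable T (holds (Γ ▹ φ) φ.wk) := by
  simpa using Derivable.prop_true (h.wk_type h) (by simpa using h.var_zero)

theorem wk_holds (h : Derivable T (holds Γ φ)) (hA : Derivable T (type k Γ A)) :
    Derivable T (holds (Γ ▹ A) φ.wk) := by
  simpa using h.wk_term hA

theorem bot_type (h : Derivable T (.ctx Γ)) : Derivable T (type (.proposition s) Γ bot) :=
  (Derivable.bot_form h).proposition s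

theorem top_type (h : Derivable T (.ctx Γ)) : Derivable T (type (.proposition s) Γ top) :=
  .imp_form (bot_type h) (bot_type h)

theorem top_true (h : Derivable T (.ctx Γ)) : Derivable T (holds Γ top) :=
  .imp_intro (bot_type h) (bot_type h) (hyp (bot_type h))

theorem iff_intro (hφ : Derivable T (type .prop Γ φ)) (hψ : Derivable T (type .prop Γ ψ))
    (h₁ : Derivable T (holds (Γ ▹ φ) ψ.wk)) (h₂ : Derivable T (holds (Γ ▹ ψ) φ.wk)) :
    Derivable T (holds Γ (iff φ ψ)) :=
  .and_intro (.imp_form hφ hψ) (.imp_form hψ hφ) (.imp_intro hφ hψ h₁) (.imp_intro hψ hφ h₂)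

theorem iff_of_true (hφ : Derivable T (type .prop Γ φ)) (hψ : Derivable T (type .prop Γ ψ))
    (h₁ : Derivable T (holds Γ φ)) (h₂ : Derivable T (holds Γ ψ)) :
    Derivable T (holds Γ (iff φ ψ)) :=
  iff_intro hφ hψ (h₂.wk_holds hφ) (h₁.wk_holds hψ)

theorem iff_mpr (hφ : Derivable T (type .prop Γ φ)) (hψ : Derivable T (type .prop Γ ψ))
    (h : Derivable T (holds Γ (iff φ ψ))) (h₁ : Derivable T (holds Γ ψ)) :
    Derivable T (holds Γ φ) :=
  .imp_elim hψ hφ (.and_right (.imp_form hφ hψ) (.imp_form hψ hφ) h) h₁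

theorem holds_conv (h : Derivable T (holds Γ φ)) (hφ : Derivable T (typeEq .prop Γ φ ψ)) :
    Derivable T (holds Γ ψ) := .prop_true hφ.type_right (h.conv hφ.eq_col)

theorem code_term (h : Derivable T (type (.proposition s) Γ φ)) :
    Derivable T (term Γ (code φ) pow) := .pow_intro (h.proposition .small)

theorem code_top (h : Derivable T (.ctx Γ)) : Derivable T (term Γ (code top) pow) :=
  code_term (top_type (s := .small) h)

theorem collapse_form (h : Derivable T (type (.proposition s) Γ φ)) (s' : Size) :
    Derivable T (type (.proposition s') Γ (collapse φ)) :=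
  (Derivable.pow_eq_small h.code_term (code_top h.ctx)).proposition s'

theorem collapse_eq (h : Derivable T (typeEq (.proposition s) Γ φ ψ)) (s' : Size) :
    Derivable T (typeEq (.proposition s') Γ (collapse φ) (collapse ψ)) :=
  (Derivable.pow_eq_small_eq (.pow_intro_eq (h.eq_proposition .small))
    (.termEq_refl (code_top h.type_left.ctx))).eq_proposition s'

/-- A true proposition is equiprovable with ⊤, so its code equals [⊤], and reflexivity at [φ] proves
the representative. -/
theorem collapse_intro (h : Derivable T (type (.proposition s) Γ φ))
    (h' : Derivable T (holds Γ φ)) : Derivable T (holds Γ (collapse φ)) := by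
  have e : Derivable T (termEq Γ (code φ) (code top) pow) :=
    .pow_eq (h.proposition _) (top_type h.ctx)
      (iff_of_true h.prop (top_type h.ctx) h' (top_true h.ctx))
  exact (Derivable.eq_intro (.pow_form h.ctx) h.code_term).holds_conv
    (Derivable.pow_eq_small_eq (.termEq_refl h.code_term) e).eq_prop

/-- Reflection makes [φ] and [⊤] judgementally equal, and effectiveness of P(1) turns this back into
equiprovability of φ with ⊤. -/
theorem collapse_elim (h : Derivable T (type (.proposition s) Γ φ))
    (h' : Derivable T (holds Γ (collapse φ))) : Derivable T (holds Γ φ) := by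
  have e := Derivable.eq_reflection (.pow_form h.ctx) h.code_term (code_top h.ctx) h'
  exact iff_mpr h.prop (top_type h.ctx)
    (.pow_eff (h.proposition _) (top_type h.ctx) e) (top_true h.ctx)

theorem collapse_iff (h : Derivable T (type (.proposition s) Γ φ)) :
    Derivable T (holds Γ (iff φ (collapse φ))) := by
  have h' := h.collapse_form .large
  refine iff_intro h.prop h' ?_ ?_
  · simpa using (h.prop.wk_type h.prop).collapse_intro h.prop.hyp
  · refine (h.prop.wk_type h').collapse_elim ?_
    simpa using h'.hyp

/-- The key property of representatives: they depend on a proposition only through its code, and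
equiprovable propositions have equal codes. -/
theorem collapse_congr (hφ : Derivable T (type (.proposition s) Γ φ))
    (hψ : Derivable T (type (.proposition s) Γ ψ)) (h : Derivable T (holds Γ (iff φ ψ)))
    (s' : Size) : Derivable T (typeEq (.proposition s') Γ (collapse φ) (collapse ψ)) :=
  (Derivable.pow_eq_small_eq (.pow_eq (hφ.proposition _) (hψ.proposition _) h)
    (.termEq_refl (code_top hφ.ctx))).eq_proposition s'

/-- The η-rule of P(1) at [φ] reads [φ] = [Dc([φ])]; placing both sides in Eq(P(1), ·, [⊤]) gives
the claim. -/
theorem collapse_idem (h : Derivable T (type k Γ (collapse φ))) (s : Size) :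
    Derivable T (typeEq (.proposition s) Γ (collapse φ) (collapse (collapse φ))) :=
  (Derivable.pow_eq_small_eq (.pow_eta h.eq_left)
    (.termEq_refl (code_top h.ctx))).eq_proposition s

end Derivable

end

/-! ### Logical rules between canonical representatives -/

section

variable {T : Theory} [hT : T.Impredicative]

namespace Derivable

variable {n : ℕ} {Γ : Ctx n} {φ ψ χ A a b U : PreExp n} {s : Size} {k : Kind}

/-- The hypothesis is the shape in which an equivalence comes out of the translation, with a
representative around the conjunction and around both implications. The layers are removed from the
outside inwards. -/
theorem iff_collapse (hφ : Derivable T (type .prop Γ φ)) (hψ : Derivable T (type .prop Γ ψ))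
    (h : Derivable T (holds Γ
      (collapse (and (collapse (imp φ ψ)) (collapse (imp ψ φ)))))) :
    Derivable T (holds Γ (iff φ ψ)) := by
  have t₁ := Derivable.imp_form hφ hψ
  have t₂ := Derivable.imp_form hψ hφ
  have c₁ := t₁.collapse_form .large
  have c₂ := t₂.collapse_form .large
  have := (Derivable.and_form c₁ c₂).collapse_elim h
  exact .and_intro t₁ t₂ (t₁.collapse_elim (.and_left c₁ c₂ this))
    (t₂.collapse_elim (.and_right c₁ c₂ this))

theorem collapse_iff_iff (hφ : Derivable T (type .prop Γ φ)) (hψ : Derivable T (type .prop Γ ψ))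
    (h : Derivable T (holds Γ (iff φ ψ))) :
    Derivable T (holds Γ
      (collapse (and (collapse (imp φ ψ)) (collapse (imp ψ φ))))) := by
  have t₁ := Derivable.imp_form hφ hψ
  have t₂ := Derivable.imp_form hψ hφ
  have c₁ := t₁.collapse_form .large
  have c₂ := t₂.collapse_form .large
  exact (Derivable.and_form c₁ c₂).collapse_intro (.and_intro c₁ c₂
    (t₁.collapse_intro (.and_left t₁ t₂ h)) (t₂.collapse_intro (.and_right t₁ t₂ h)))

theorem code_congr_true (hφ : Derivable T (type .prop Γ φ)) (hψ : Derivable T (type .prop Γ ψ))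
    (h₁ : Derivable T (holds Γ φ)) (h₂ : Derivable T (holds Γ ψ)) :
    Derivable T (termEq Γ (code φ) (code ψ) pow) :=
  .pow_eq (hφ.proposition _) (hψ.proposition _) (iff_of_true hφ hψ h₁ h₂)

theorem code_congr (hφ : Derivable T (type .prop Γ φ)) (hψ : Derivable T (type .prop Γ ψ))
    (h : Derivable T (holds Γ (iff φ ψ))) :
    Derivable T (termEq Γ (code φ) (code ψ) pow) :=
  .pow_eq (hφ.proposition _) (hψ.proposition _) h

/-- The translation of Dc(U) compares U with the code of the translated ⊤. That proposition is
provable, so its code is [⊤], and the η-rule for the untranslated Dc(U) can be reused. -/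
theorem collapse_pow_eta (h : Derivable T (term Γ U pow)) :
    Derivable T (termEq Γ U
      (code (collapse (eq pow U (code (collapse (imp (collapse bot) (collapse bot))))))) pow) := by
  have tb := (bot_type (T := T) (s := .large) h.ctx).collapse_form .large
  have ti := Derivable.imp_form tb tb
  have e : Derivable T (termEq Γ (code top) (code (collapse (imp (collapse bot) (collapse bot))))
      pow) := by
    refine code_congr_true (top_type h.ctx) (ti.collapse_form _) (top_true h.ctx)
      (ti.collapse_intro (.imp_intro tb tb ?_))
    exact tb.hyp
  have e' := Derivable.pow_eq_small_eq (.termEq_refl h) e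
  have te := e'.type_right
  exact (Derivable.pow_eta h).termEq_trans ((Derivable.pow_intro_eq e').termEq_trans
    (code_congr te.prop (te.collapse_form _) te.collapse_iff))

theorem collapse_lem (hl : ExtraRule.lem ∈ T) (h : Derivable T (type .prop Γ φ)) :
    Derivable T (holds Γ (collapse (or φ (collapse (imp φ (collapse bot)))))) := by
  have tb := bot_type (T := T) (s := .large) h.ctx
  have cb := tb.collapse_form .large
  have tn := Derivable.imp_form h tb
  have ti := Derivable.imp_form h cb
  have ci := ti.collapse_form .large
  have tor := Derivable.or_form h ci
  refine tor.collapse_intro (.or_elim h tn tor (.lem hl h) ?_ ?_)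
  · exact .or_inl (h.wk_type h) (ci.wk_type h) h.hyp
  · have h' := h.wk_type tn
    refine .or_inr h' (ci.wk_type tn) ((ti.wk_type tn).collapse_intro
      (.imp_intro h' (cb.wk_type tn) ?_))
    have tb' := tb.wk_type tn
    refine (tb'.wk_type h').collapse_intro (.imp_elim (h'.wk_type h') (tb'.wk_type h') ?_ h'.hyp)
    exact tn.hyp.wk_holds h'

end Derivable

/-- No relation between the two theories is needed: under resizing all inclusions between kinds are
available. -/
theorem Kind.Into.mono {T T' : Theory} [hT : T.Impredicative] {k k' : Kind}
    (h : Kind.Into T' k k') : Kind.Into T k k' := by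
  cases h
  · exact .props_into_prop
  · exact .props_into_set
  · exact .prop_into_col
  · exact .set_into_col
  · exact .col_into_set hT.resizing
  · exact .prop_into_props hT.resizing

open Derivable in
/-- Taking canonical forms turns derivations with propositional extensionality into derivations
without it. -/
theorem Derivable.canon {T' : Theory} (hT' : ∀ r ∈ T', r = .propext ∨ r ∈ T) {n : ℕ}
    {J : Judgement n} (h : Derivable T' J) : Derivable T J.canon := by
  induction h with
    simp only [Judgement.canon, Ctx.canon, PreExp.canon, canon_inst, canon_inst₂, canon_inst₃,
      canon_instAt, canon_instAt₂, canon_wk, canon_subst, canonS_lift, canonS_shift] at *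
  | ctx_nil => exact .ctx_nil
  | ctx_snoc _ ih => exact .ctx_snoc ih
  | @var n Γ i _ ih => rw [← Ctx.get_canon]; exact .var i ih
  | type_into hk _ ih => exact .type_into hk.mono ih
  | typeEq_into hk _ ih => exact .typeEq_into hk.mono ih
  | typeEq_refl _ ih => exact .typeEq_refl ih
  | typeEq_symm _ ih => exact .typeEq_symm ih
  | typeEq_trans _ _ ih₁ ih₂ => exact .typeEq_trans ih₁ ih₂
  | termEq_refl _ ih => exact .termEq_refl ih
  | termEq_symm _ ih => exact .termEq_symm ih
  | termEq_trans _ _ ih₁ ih₂ => exact .termEq_trans ih₁ ih₂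
  | conv _ _ ih₁ ih₂ => exact .conv ih₁ ih₂
  | convEq _ _ ih₁ ih₂ => exact .convEq ih₁ ih₂
  | type_subst _ _ _ ih₁ ih₂ ih₃ =>
    simp only [← Ctx.get_canon] at ih₂
    exact .type_subst ih₁ ih₂ ih₃
  | typeEq_subst _ _ _ ih₁ ih₂ ih₃ =>
    simp only [← Ctx.get_canon] at ih₂
    exact .typeEq_subst ih₁ ih₂ ih₃
  | term_subst _ _ _ ih₁ ih₂ ih₃ =>
    simp only [← Ctx.get_canon] at ih₂
    exact .term_subst ih₁ ih₂ ih₃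
  | termEq_subst _ _ _ ih₁ ih₂ ih₃ =>
    simp only [← Ctx.get_canon] at ih₂
    exact .termEq_subst ih₁ ih₂ ih₃
  | type_subst_eq _ _ _ _ _ ih₁ ih₂ ih₃ ih₄ ih₅ =>
    simp only [← Ctx.get_canon] at ih₂ ih₃ ih₄
    exact .type_subst_eq ih₁ ih₂ ih₃ ih₄ ih₅
  | term_subst_eq _ _ _ _ _ ih₁ ih₂ ih₃ ih₄ ih₅ =>
    simp only [← Ctx.get_canon] at ih₂ ih₃ ih₄
    exact .term_subst_eq ih₁ ih₂ ih₃ ih₄ ih₅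
  | prop_mono _ _ _ ih₁ ih₂ ih₃ => exact .prop_mono ih₁ ih₂ ih₃
  | prop_true _ _ ih₁ ih₂ => exact .prop_true ih₁ ih₂
  | empty_form _ ih => exact .empty_form ih
  | empty_elim _ _ ih₁ ih₂ => exact .empty_elim ih₁ ih₂
  | empty_elim_eq _ _ ih₁ ih₂ => exact .empty_elim_eq ih₁ ih₂
  | unit_form _ ih => exact .unit_form ih
  | unit_intro _ ih => exact .unit_intro ih
  | unit_elim _ _ _ ih₁ ih₂ ih₃ => exact .unit_elim ih₁ ih₂ ih₃
  | unit_elim_eq _ _ _ ih₁ ih₂ ih₃ => exact .unit_elim_eq ih₁ ih₂ ih₃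
  | unit_beta _ _ ih₁ ih₂ => exact .unit_beta ih₁ ih₂
  | sigma_form _ _ ih₁ ih₂ => exact .sigma_form ih₁ ih₂
  | sigma_form_eq _ _ ih₁ ih₂ => exact .sigma_form_eq ih₁ ih₂
  | sigma_intro _ _ _ _ ih₁ ih₂ ih₃ ih₄ => exact .sigma_intro ih₁ ih₂ ih₃ ih₄
  | sigma_intro_eq _ _ _ _ ih₁ ih₂ ih₃ ih₄ => exact .sigma_intro_eq ih₁ ih₂ ih₃ ih₄
  | sigma_elim _ _ _ ih₁ ih₂ ih₃ => exact .sigma_elim ih₁ ih₂ ih₃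
  | sigma_elim_eq _ _ _ _ _ ih₁ ih₂ ih₃ ih₄ ih₅ => exact .sigma_elim_eq ih₁ ih₂ ih₃ ih₄ ih₅
  | sigma_beta _ _ _ _ ih₁ ih₂ ih₃ ih₄ => exact .sigma_beta ih₁ ih₂ ih₃ ih₄
  | pi_form _ _ ih₁ ih₂ => exact .pi_form ih₁ ih₂
  | pi_form_eq _ _ ih₁ ih₂ => exact .pi_form_eq ih₁ ih₂
  | pi_pow_form _ ih => exact .pi_pow_form ih
  | pi_pow_form_eq _ ih => exact .pi_pow_form_eq ih
  | pi_intro _ _ ih₁ ih₂ => exact .pi_intro ih₁ ih₂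
  | pi_intro_eq _ _ _ _ ih₁ ih₂ ih₃ ih₄ => exact .pi_intro_eq ih₁ ih₂ ih₃ ih₄
  | pi_elim _ _ _ ih₁ ih₂ ih₃ => exact .pi_elim ih₁ ih₂ ih₃
  | pi_elim_eq _ _ _ _ _ ih₁ ih₂ ih₃ ih₄ ih₅ => exact .pi_elim_eq ih₁ ih₂ ih₃ ih₄ ih₅
  | pi_beta _ _ _ ih₁ ih₂ ih₃ => exact .pi_beta ih₁ ih₂ ih₃
  | pi_eta _ ih => exact .pi_eta ih
  | sum_form _ _ ih₁ ih₂ => exact .sum_form ih₁ ih₂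
  | sum_form_eq _ _ ih₁ ih₂ => exact .sum_form_eq ih₁ ih₂
  | sum_inl _ _ _ ih₁ ih₂ ih₃ => exact .sum_inl ih₁ ih₂ ih₃
  | sum_inl_eq _ _ _ ih₁ ih₂ ih₃ => exact .sum_inl_eq ih₁ ih₂ ih₃
  | sum_inr _ _ _ ih₁ ih₂ ih₃ => exact .sum_inr ih₁ ih₂ ih₃
  | sum_inr_eq _ _ _ ih₁ ih₂ ih₃ => exact .sum_inr_eq ih₁ ih₂ ih₃
  | sum_elim _ _ _ _ ih₁ ih₂ ih₃ ih₄ => exact .sum_elim ih₁ ih₂ ih₃ ih₄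
  | sum_elim_eq _ _ _ _ _ _ ih₁ ih₂ ih₃ ih₄ ih₅ ih₆ =>
    exact .sum_elim_eq ih₁ ih₂ ih₃ ih₄ ih₅ ih₆
  | sum_beta_inl _ _ _ _ ih₁ ih₂ ih₃ ih₄ => exact .sum_beta_inl ih₁ ih₂ ih₃ ih₄
  | sum_beta_inr _ _ _ _ ih₁ ih₂ ih₃ ih₄ => exact .sum_beta_inr ih₁ ih₂ ih₃ ih₄
  | list_form _ ih => exact .list_form ih
  | list_form_eq _ ih => exact .list_form_eq ih
  | list_nil _ ih => exact .list_nil ih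
  | list_nil_eq _ ih => exact .list_nil_eq ih
  | list_cons _ _ _ ih₁ ih₂ ih₃ => exact .list_cons ih₁ ih₂ ih₃
  | list_cons_eq _ _ _ ih₁ ih₂ ih₃ => exact .list_cons_eq ih₁ ih₂ ih₃
  | list_elim _ _ _ _ ih₁ ih₂ ih₃ ih₄ => exact .list_elim ih₁ ih₂ ih₃ ih₄
  | list_elim_eq _ _ _ _ _ ih₁ ih₂ ih₃ ih₄ ih₅ => exact .list_elim_eq ih₁ ih₂ ih₃ ih₄ ih₅
  | list_beta_nil _ _ _ ih₁ ih₂ ih₃ => exact .list_beta_nil ih₁ ih₂ ih₃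
  | list_beta_cons _ _ _ _ _ ih₁ ih₂ ih₃ ih₄ ih₅ => exact .list_beta_cons ih₁ ih₂ ih₃ ih₄ ih₅
  | quot_form _ _ _ _ _ ih₁ ih₂ ih₃ ih₄ ih₅ => exact .quot_form ih₁ ih₂ ih₃ ih₄ ih₅
  | quot_form_eq _ _ _ _ ih₁ ih₂ ih₃ ih₄ => exact .quot_form_eq ih₁ ih₂ ih₃ ih₄
  | quot_intro _ _ ih₁ ih₂ => exact .quot_intro ih₁ ih₂
  | quot_intro_eq _ _ _ _ _ ih₁ ih₂ ih₃ ih₄ ih₅ => exact .quot_intro_eq ih₁ ih₂ ih₃ ih₄ ih₅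
  | quot_eq _ _ _ _ ih₁ ih₂ ih₃ ih₄ => exact .quot_eq ih₁ ih₂ ih₃ ih₄
  | quot_eff _ _ _ _ ih₁ ih₂ ih₃ ih₄ => exact .quot_eff ih₁ ih₂ ih₃ ih₄
  | quot_elim _ _ _ _ ih₁ ih₂ ih₃ ih₄ => exact .quot_elim ih₁ ih₂ ih₃ ih₄
  | quot_elim_eq _ _ _ _ _ _ _ _ ih₁ ih₂ ih₃ ih₄ ih₅ ih₆ ih₇ ih₈ =>
    exact .quot_elim_eq ih₁ ih₂ ih₃ ih₄ ih₅ ih₆ ih₇ ih₈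
  | quot_beta _ _ _ _ ih₁ ih₂ ih₃ ih₄ => exact .quot_beta ih₁ ih₂ ih₃ ih₄
  | pow_form _ ih => exact .pow_form ih
  | pow_intro _ ih => exact .pow_intro ih
  | pow_intro_eq _ ih => exact .pow_intro_eq ih
  | pow_eq _ _ _ ih₁ ih₂ ih₃ => exact .pow_eq ih₁ ih₂ (iff_collapse ih₁.prop ih₂.prop ih₃)
  | pow_eff _ _ _ ih₁ ih₂ ih₃ => exact collapse_iff_iff ih₁.prop ih₂.prop (.pow_eff ih₁ ih₂ ih₃)
  | pow_eta _ ih => exact collapse_pow_eta ih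
  | pow_eq_small _ _ ih₁ ih₂ => exact (Derivable.pow_eq_small ih₁ ih₂).collapse_form _
  | pow_eq_small_eq _ _ ih₁ ih₂ => exact (Derivable.pow_eq_small_eq ih₁ ih₂).collapse_eq _
  | bot_form _ ih => exact (Derivable.bot_form ih).collapse_form _
  | bot_elim _ _ ih₁ ih₂ =>
    exact .bot_elim ih₁ ((Derivable.bot_form ih₁.ctx).collapse_elim ih₂)
  | and_form _ _ ih₁ ih₂ => exact (Derivable.and_form ih₁ ih₂).collapse_form _
  | and_form_eq _ _ ih₁ ih₂ => exact (Derivable.and_form_eq ih₁ ih₂).collapse_eq _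
  | or_form _ _ ih₁ ih₂ => exact (Derivable.or_form ih₁ ih₂).collapse_form _
  | or_form_eq _ _ ih₁ ih₂ => exact (Derivable.or_form_eq ih₁ ih₂).collapse_eq _
  | imp_form _ _ ih₁ ih₂ => exact (Derivable.imp_form ih₁ ih₂).collapse_form _
  | imp_form_eq _ _ ih₁ ih₂ => exact (Derivable.imp_form_eq ih₁ ih₂).collapse_eq _
  | ex_form _ _ ih₁ ih₂ => exact (Derivable.ex_form ih₁ ih₂).collapse_form _
  | ex_form_eq _ _ ih₁ ih₂ => exact (Derivable.ex_form_eq ih₁ ih₂).collapse_eq _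
  | all_form _ _ ih₁ ih₂ => exact (Derivable.all_form ih₁ ih₂).collapse_form _
  | all_form_eq _ _ ih₁ ih₂ => exact (Derivable.all_form_eq ih₁ ih₂).collapse_eq _
  | eq_form _ _ _ ih₁ ih₂ ih₃ => exact (Derivable.eq_form ih₁ ih₂ ih₃).collapse_form _
  | eq_form_eq _ _ _ ih₁ ih₂ ih₃ => exact (Derivable.eq_form_eq ih₁ ih₂ ih₃).collapse_eq _
  | and_intro _ _ _ _ ih₁ ih₂ ih₃ ih₄ =>
    exact (Derivable.and_form ih₁ ih₂).collapse_intro (.and_intro ih₁ ih₂ ih₃ ih₄)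
  | and_left _ _ _ ih₁ ih₂ ih₃ =>
    exact .and_left ih₁ ih₂ ((Derivable.and_form ih₁ ih₂).collapse_elim ih₃)
  | and_right _ _ _ ih₁ ih₂ ih₃ =>
    exact .and_right ih₁ ih₂ ((Derivable.and_form ih₁ ih₂).collapse_elim ih₃)
  | or_inl _ _ _ ih₁ ih₂ ih₃ =>
    exact (Derivable.or_form ih₁ ih₂).collapse_intro (.or_inl ih₁ ih₂ ih₃)
  | or_inr _ _ _ ih₁ ih₂ ih₃ =>
    exact (Derivable.or_form ih₁ ih₂).collapse_intro (.or_inr ih₁ ih₂ ih₃)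
  | or_elim _ _ _ _ _ _ ih₁ ih₂ ih₃ ih₄ ih₅ ih₆ =>
    exact .or_elim ih₁ ih₂ ih₃ ((Derivable.or_form ih₁ ih₂).collapse_elim ih₄) ih₅ ih₆
  | imp_intro _ _ _ ih₁ ih₂ ih₃ =>
    exact (Derivable.imp_form ih₁ ih₂).collapse_intro (.imp_intro ih₁ ih₂ ih₃)
  | imp_elim _ _ _ _ ih₁ ih₂ ih₃ ih₄ =>
    exact .imp_elim ih₁ ih₂ ((Derivable.imp_form ih₁ ih₂).collapse_elim ih₃) ih₄
  | ex_intro _ _ _ ih₁ ih₂ ih₃ =>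
    exact (Derivable.ex_form ih₁.head_type ih₁).collapse_intro (.ex_intro ih₁ ih₂ ih₃)
  | ex_elim _ _ _ _ ih₁ ih₂ ih₃ ih₄ =>
    exact .ex_elim ih₁ ih₂ ((Derivable.ex_form ih₁.head_type ih₁).collapse_elim ih₃) ih₄
  | all_intro _ _ ih₁ ih₂ =>
    exact (Derivable.all_form ih₁.head_type ih₁).collapse_intro (.all_intro ih₁ ih₂)
  | all_elim _ _ _ ih₁ ih₂ ih₃ =>
    exact .all_elim ih₁ ((Derivable.all_form ih₁.head_type ih₁).collapse_elim ih₂) ih₃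
  | eq_intro _ _ ih₁ ih₂ =>
    exact (Derivable.eq_form ih₁ ih₂ ih₂).collapse_intro (.eq_intro ih₁ ih₂)
  | eq_reflection _ _ _ _ ih₁ ih₂ ih₃ ih₄ =>
    exact .eq_reflection ih₁ ih₂ ih₃ ((Derivable.eq_form ih₁ ih₂ ih₃).collapse_elim ih₄)
  | lem hr _ ih => exact collapse_lem ((hT' _ hr).resolve_left (by simp)) ih
  | propext _ h₁ h₂ _ ih₁ ih₂ ih₃ =>
    have h := iff_collapse ih₁.prop ih₂.prop ih₃
    -- Equiprovability makes the representatives of the two translations equal, which is one layer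
    -- too many. The translations are representatives themselves, by the raw shape of propositions,
    -- so idempotence strips the extra layer on both sides.
    obtain ⟨φ', hφ⟩ := IsProp.exists_collapse h₁.shape
    obtain ⟨ψ', hψ⟩ := IsProp.exists_collapse h₂.shape
    have e := collapse_congr ih₁ ih₂ h
    rw [hφ] at ih₁ e ⊢
    rw [hψ] at ih₂ e ⊢
    exact (collapse_idem ih₁ _).typeEq_trans ((e _).typeEq_trans (collapse_idem ih₂ _).typeEq_symm)

end

section

variable {T : Theory} [hT : T.Impredicative]

/-! ### Induction principles -/

namespace Derivable

variable {n : ℕ} {Γ : Ctx n} {φ ψ A A' C a b c d : PreExp n} {B M f g : PreExp (n + 1)} {s : Size}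
  {k : Kind}

theorem holds_eq (h : Derivable T (termEq Γ a b A)) : Derivable T (holds Γ (eq A a b)) :=
  (Derivable.eq_intro h.eq_presup h.left).holds_conv
    (.eq_form_eq (.typeEq_refl h.eq_presup) (.termEq_refl h.left) h)

theorem inst_term {e : PreExp (n + 1)} (h : Derivable T (term (Γ ▹ A) e B))
    (ha : Derivable T (term Γ a A)) : Derivable T (term Γ (e.inst a) (B.inst a)) :=
  h.sub_term (.inst ha)

theorem inst_termEq {e e' : PreExp (n + 1)} (h : Derivable T (termEq (Γ ▹ A) e e' B))
    (ha : Derivable T (termEq Γ a b A)) :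
    Derivable T (termEq Γ (e.inst a) (e'.inst b) (B.inst a)) :=
  h.subEq_termEq h.right (.inst ha.eq_presup ha.left ha.right ha)

theorem inst_congr (h : Derivable T (type k (Γ ▹ A) B))
    (ha : Derivable T (termEq Γ a b A)) : Derivable T (typeEq k Γ (B.inst a) (B.inst b)) :=
  h.subEq_type (.inst ha.eq_presup ha.left ha.right ha)

/-- Two families of terms agree at `d` if they are provably equal at `d`. -/
theorem termEq_of_holds_inst (hf : Derivable T (term (Γ ▹ A) f M))
    (hg : Derivable T (term (Γ ▹ A) g M)) (hd : Derivable T (term Γ d A))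
    (h : Derivable T (holds Γ ((eq M f g).inst d))) :
    Derivable T (termEq Γ (f.inst d) (g.inst d) (M.inst d)) :=
  .eq_reflection (hf.presup.inst_type hd) (hf.inst_term hd) (hg.inst_term hd) h

/-- The elimination rule is applied to the proposition that the two families are equal, and
reflection makes the resulting equality judgemental. The extensionality principles for the other
types below are obtained in the same way. -/
theorem unit_ext (hf : Derivable T (term (Γ ▹ unit) f M)) (hg : Derivable T (term (Γ ▹ unit) g M))
    (h : Derivable T (termEq Γ (f.inst star) (g.inst star) (M.inst star)))
    (hd : Derivable T (term Γ d unit)) :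
    Derivable T (termEq Γ (f.inst d) (g.inst d) (M.inst d)) := by
  have t := Derivable.eq_form (T := T) (s := .large) hf.presup hf hg
  exact termEq_of_holds_inst hf hg hd
    (.prop_true (t.inst_type hd) (.unit_elim t.col hd h.holds_eq))

theorem empty_ext (hf : Derivable T (term (Γ ▹ empty) f M))
    (hg : Derivable T (term (Γ ▹ empty) g M)) (hd : Derivable T (term Γ d empty)) :
    Derivable T (termEq Γ (f.inst d) (g.inst d) (M.inst d)) := by
  have t := Derivable.eq_form (T := T) (s := .large) hf.presup hf hg
  exact termEq_of_holds_inst hf hg hd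
    (.prop_true (t.inst_type hd) (.empty_elim t.col hd))

theorem sigma_ext (hf : Derivable T (term (Γ ▹ sigma A B) f M))
    (hg : Derivable T (term (Γ ▹ sigma A B) g M))
    (h : Derivable T (termEq (Γ ▹ A ▹ B)
      (f.instAt 2 (pair A.wk.wk (B.subst (lift (shift 2))) (.var 1) (.var 0)))
      (g.instAt 2 (pair A.wk.wk (B.subst (lift (shift 2))) (.var 1) (.var 0)))
      (M.instAt 2 (pair A.wk.wk (B.subst (lift (shift 2))) (.var 1) (.var 0)))))
    (hd : Derivable T (term Γ d (sigma A B))) :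
    Derivable T (termEq Γ (f.inst d) (g.inst d) (M.inst d)) := by
  have t := Derivable.eq_form (T := T) (s := .large) hf.presup hf hg
  exact termEq_of_holds_inst hf hg hd
    (.prop_true (t.inst_type hd) (.sigma_elim t.col hd h.holds_eq))

theorem sum_ext {A' : PreExp n} (hf : Derivable T (term (Γ ▹ sum A A') f M))
    (hg : Derivable T (term (Γ ▹ sum A A') g M))
    (h₁ : Derivable T (termEq (Γ ▹ A) (f.instAt 1 (inl A.wk A'.wk (.var 0)))
      (g.instAt 1 (inl A.wk A'.wk (.var 0))) (M.instAt 1 (inl A.wk A'.wk (.var 0)))))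
    (h₂ : Derivable T (termEq (Γ ▹ A') (f.instAt 1 (inr A.wk A'.wk (.var 0)))
      (g.instAt 1 (inr A.wk A'.wk (.var 0))) (M.instAt 1 (inr A.wk A'.wk (.var 0)))))
    (hd : Derivable T (term Γ d (sum A A'))) :
    Derivable T (termEq Γ (f.inst d) (g.inst d) (M.inst d)) := by
  have t := Derivable.eq_form (T := T) (s := .large) hf.presup hf hg
  exact termEq_of_holds_inst hf hg hd
    (.prop_true (t.inst_type hd) (.sum_elim t.col hd h₁.holds_eq h₂.holds_eq))

/-- Uniqueness of functions on lists; the hypothesis on `cons` may use the propositional equality at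
the tail. -/
theorem list_ext (hf : Derivable T (term (Γ ▹ list A) f M))
    (hg : Derivable T (term (Γ ▹ list A) g M))
    (h₁ : Derivable T (termEq Γ (f.inst (nil A)) (g.inst (nil A)) (M.inst (nil A))))
    (h₂ : Derivable T (termEq (Γ ▹ list A ▹ A.wk ▹ (eq M f g).instAt 2 (.var 1))
      (f.instAt 3 (cons A.wk.wk.wk (.var 2) (.var 1)))
      (g.instAt 3 (cons A.wk.wk.wk (.var 2) (.var 1)))
      (M.instAt 3 (cons A.wk.wk.wk (.var 2) (.var 1)))))
    (hd : Derivable T (term Γ d (list A))) :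
    Derivable T (termEq Γ (f.inst d) (g.inst d) (M.inst d)) := by
  have t := Derivable.eq_form (T := T) (s := .large) hf.presup hf hg
  exact termEq_of_holds_inst hf hg hd
    (.prop_true (t.inst_type hd) (.list_elim t.col hd h₁.holds_eq h₂.holds_eq))

theorem quot_ext {R : PreExp (n + 2)} (hf : Derivable T (term (Γ ▹ quot A R) f M))
    (hg : Derivable T (term (Γ ▹ quot A R) g M))
    (h : Derivable T (termEq (Γ ▹ A)
      (f.instAt 1 (cls A.wk (R.subst (lift (lift (shift 1)))) (.var 0)))
      (g.instAt 1 (cls A.wk (R.subst (lift (lift (shift 1)))) (.var 0)))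
      (M.instAt 1 (cls A.wk (R.subst (lift (lift (shift 1)))) (.var 0)))))
    (hd : Derivable T (term Γ d (quot A R))) :
    Derivable T (termEq Γ (f.inst d) (g.inst d) (M.inst d)) := by
  have t := Derivable.eq_form (T := T) (s := .large) hf.presup hf hg
  have hQ := hd.presup.collection .small
  refine termEq_of_holds_inst hf hg hd
    (.prop_true (t.inst_type hd) (.quot_elim t.col hd h.holds_eq ?_))
  have hR := hQ.quot_right
  -- Elimination from a quotient also demands compatibility with the relation. For a motive that is
  -- a proposition this costs nothing: once both proofs are typed in the same fibre, they are equal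
  -- by proof-irrelevance.
  have e := hQ.quot_generic_eq
  have e' := Derivable.trans_at (.typeEq_refl t.col) t.col (.S₃ hR) e.left e.right e
  have h₂ := h.holds_eq.sub_term (Sub.scons (.S₃ hR) hR.var_two)
  have h₁ := h.holds_eq.sub_term (Sub.scons (.S₃ hR) (a := .var 1) (by simpa using hR.var_one))
  have t₂ := t.sub_type (Sub.scons (.S₃ hR) e.left)
  simp at h₁ h₂ e' t₂ ⊢
  exact .prop_mono t₂ h₂ (h₁.conv e'.typeEq_symm)

end Derivable

end

/-! ### Projections of dependent pairs -/

namespace PreExp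

variable {n m : ℕ}

/-- First projection. -/
def fst (A : PreExp n) (B : PreExp (n + 1)) (d : PreExp n) : PreExp n :=
  elSigma A B A.wk d (var 1)

@[simp] theorem fst_subst (σ : Fin n → PreExp m) (A : PreExp n) (B : PreExp (n + 1))
    (d : PreExp n) : (fst A B d).subst σ = fst (A.subst σ) (B.subst (lift σ)) (d.subst σ) := by
  simp [fst]

/-- Second projection. -/
def snd (A : PreExp n) (B : PreExp (n + 1)) (d : PreExp n) : PreExp n :=
  elSigma A B (B.subst (scons (fst A.wk (B.subst (lift S)) (var 0)) S)) d (var 0)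

@[simp] theorem snd_subst (σ : Fin n → PreExp m) (A : PreExp n) (B : PreExp (n + 1))
    (d : PreExp n) : (snd A B d).subst σ = snd (A.subst σ) (B.subst (lift σ)) (d.subst σ) := by
  simp [snd]

end PreExp

section

variable {T : Theory} [hT : T.Impredicative]

namespace Derivable

variable {n : ℕ} {Γ : Ctx n} {φ ψ A A' C a b c d d' : PreExp n} {B B' M f g : PreExp (n + 1)}
  {s : Size} {k : Kind}

theorem fst_term (hB : Derivable T (type .col (Γ ▹ A) B)) (hd : Derivable T (term Γ d (sigma A B))) :
    Derivable T (term Γ (fst A B d) A) := by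
  have := Derivable.sigma_elim (m := .var 1) (hB.head_type.wk_type hB.sigma_type) hd
    (by simpa using hB.var_one)
  simpa [fst] using this

theorem fst_congr (hA : Derivable T (typeEq .col Γ A A'))
    (hB : Derivable T (typeEq .col (Γ ▹ A) B B')) (hd : Derivable T (termEq Γ d d' (sigma A B))) :
    Derivable T (termEq Γ (fst A B d) (fst A' B' d') A) := by
  have := Derivable.sigma_elim_eq (m := .var 1) (m' := .var 1) hA hB
    (hA.wk_typeEq hB.type_left.sigma_type) hd
    (by simpa using hB.type_left.var_one.termEq_refl)
  simpa [fst] using this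

theorem fst_beta (ha : Derivable T (term Γ a A)) (hB : Derivable T (type .col (Γ ▹ A) B))
    (hb : Derivable T (term Γ b (B.inst a))) :
    Derivable T (termEq Γ (fst A B (pair A B a b)) a A) := by
  have := Derivable.sigma_beta (m := .var 1) (hB.head_type.wk_type hB.sigma_type) ha hb
    (by simpa using hB.var_one)
  simpa [fst] using this

theorem snd_motive (hB : Derivable T (type .col (Γ ▹ A) B)) :
    Derivable T (type .col (Γ ▹ sigma A B)
      (B.subst (scons (fst A.wk (B.subst (lift PreExp.S)) (.var 0)) PreExp.S))) := by
  refine hB.sub_type (Sub.scons (.S hB.sigma_type) ?_)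
  have := fst_term (hB.sub_type ((Sub.S hB.sigma_type).lift hB.head_type)) hB.sigma_type.var_zero
  simpa using this

/-- The motive of the second projection is the fibre over the first projection. At a generic pair
this computes to the fibre over the first component, where the branch lives. -/
theorem snd_motive_pair (hB : Derivable T (type .col (Γ ▹ A) B)) :
    Derivable T (typeEq .col (Γ ▹ A ▹ B) B.wk
      ((B.subst (scons (fst A.wk (B.subst (lift PreExp.S)) (.var 0)) PreExp.S)).instAt 2
        (pair A.wk.wk (B.subst (lift (shift 2))) (.var 1) (.var 0)))) := by
  have hB₂ := hB.sub_type ((Sub.S₂ hB).lift hB.head_type)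
  have e := fst_beta (a := .var 1) (b := .var 0) hB.var_one hB₂ (by simpa using hB.var_zero)
  have := (Derivable.typeEq_refl hB).trans_at hB (.S₂ hB) e.left e.right e
  simpa using this.typeEq_symm

theorem snd_term (hB : Derivable T (type .col (Γ ▹ A) B)) (hd : Derivable T (term Γ d (sigma A B))) :
    Derivable T (term Γ (snd A B d) (B.inst (fst A B d))) := by
  have := Derivable.sigma_elim (snd_motive hB) hd
    (.conv (by simpa using hB.var_zero) (snd_motive_pair hB))
  simpa [snd] using this

theorem snd_congr (hA : Derivable T (typeEq .col Γ A A'))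
    (hB : Derivable T (typeEq .col (Γ ▹ A) B B')) (hd : Derivable T (termEq Γ d d' (sigma A B))) :
    Derivable T (termEq Γ (snd A B d) (snd A' B' d') (B.inst (fst A B d))) := by
  have tB := hB.type_left
  have tS := hB.type_left.sigma_type
  have e := fst_congr (hA.sub_typeEq (.S tS)) (hB.sub_typeEq ((Sub.S tS).lift tB.head_type))
    (Derivable.termEq_refl tS.var_zero)
  have eM := hB.trans_at hB.type_right (.S tS) e.left e.right e
  have := Derivable.sigma_elim_eq (m := .var 0) (m' := .var 0) hA hB (by simpa using eM) hd
    (.convEq (Derivable.termEq_refl (by simpa using tB.var_zero))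
      (by simpa using snd_motive_pair tB))
  simpa [snd] using this

theorem snd_beta (ha : Derivable T (term Γ a A)) (hB : Derivable T (type .col (Γ ▹ A) B))
    (hb : Derivable T (term Γ b (B.inst a))) :
    Derivable T (termEq Γ (snd A B (pair A B a b)) b (B.inst a)) := by
  have := Derivable.sigma_beta (m := .var 0) (snd_motive hB) ha hb
    (.conv (by simpa using hB.var_zero) (snd_motive_pair hB))
  have e := hB.inst_congr (fst_beta ha hB hb)
  simp at this e
  simpa [snd] using this.convEq e

/-- Surjective pairing is not among the rules; it follows from extensionality, since both
projections compute at the generic pair. -/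
theorem pair_eta (hB : Derivable T (type .col (Γ ▹ A) B))
    (hd : Derivable T (term Γ d (sigma A B))) :
    Derivable T (termEq Γ (pair A B (fst A B d) (snd A B d)) d (sigma A B)) := by
  have tS := hB.sigma_type
  have hA := hB.head_type
  have tB₁ := hB.sub_type ((Sub.S tS).lift hA)
  have hv := tS.var_zero
  have hf := Derivable.sigma_intro (hA.sub_type (.S tS)) tB₁
    (fst_term tB₁ hv) (snd_term tB₁ hv)
  have := sigma_ext hf hv ?_ hd
  · simpa using this
  · have tB₂ := hB.sub_type ((Sub.S₂ hB).lift hA)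
    have hb : Derivable T (term (Γ ▹ A ▹ B) (.var 0)
      ((B.subst (lift (PreExp.S ⊚ PreExp.S))).inst (.var 1))) := by simpa using hB.var_zero
    have e₁ := fst_beta (a := .var 1) (b := .var 0) hB.var_one tB₂ hb
    have e₂ := snd_beta (a := .var 1) (b := .var 0) hB.var_one tB₂ hb
    have := Derivable.sigma_intro_eq (.typeEq_refl tB₂.head_type) (.typeEq_refl tB₂) e₁
      (e₂.convEq (tB₂.inst_congr e₁).typeEq_symm)
    simpa using this

theorem app_congr {f f' : PreExp n} (hA : Derivable T (typeEq .col Γ A A'))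
    (hB : Derivable T (typeEq .col (Γ ▹ A) B B')) (hf : Derivable T (termEq Γ f f' (pi A B)))
    (ha : Derivable T (termEq Γ a b A)) :
    Derivable T (termEq Γ (app A B f a) (app A' B' f' b) (B.inst a)) :=
  .pi_elim_eq hA hB (.eq_col (Derivable.pi_form_eq (hA.eq_collection _) (hB.eq_collection _))) hf ha

/-- Products are formed from sets only, apart from those into P(1); resizing allows arbitrary
collections. -/
theorem pi_type (hB : Derivable T (type .col (Γ ▹ A) B)) : Derivable T (type .col Γ (pi A B)) :=
  (Derivable.pi_form (hB.head_type.collection _) (hB.collection _)).col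

theorem pi_ext {f g : PreExp n} (hf : Derivable T (term Γ f (pi A B)))
    (hg : Derivable T (term Γ g (pi A B)))
    (h : Derivable T (termEq (Γ ▹ A) (app A.wk (B.subst (lift PreExp.S)) f.wk (.var 0))
      (app A.wk (B.subst (lift PreExp.S)) g.wk (.var 0)) B)) :
    Derivable T (termEq Γ f g (pi A B)) := by
  have tB := hf.presup.pi_right
  have := Derivable.pi_intro_eq (.typeEq_refl tB.head_type) (.typeEq_refl tB)
    (.typeEq_refl hf.presup) h
  have e₁ := Derivable.pi_eta hf
  have e₂ := Derivable.pi_eta hg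
  simp only [shift_one] at e₁ e₂
  exact e₁.termEq_symm.termEq_trans (this.termEq_trans e₂)

end Derivable

end

/-! ### Functorial action of the type constructors -/

namespace PreExp

variable {n : ℕ}

/-- The action of `Σ` on a map `i` of bases and a map `k` of fibres, as an open term. -/
def sigmaMap (A : PreExp n) (B : PreExp (n + 1)) (A' : PreExp n) (B' : PreExp (n + 1))
    (i : PreExp (n + 1)) (k : PreExp (n + 2)) : PreExp (n + 1) :=
  pair A'.wk (B'.subst (lift S)) (i.subst (scons (fst A.wk (B.subst (lift S)) (var 0)) S))
    (k.subst (scons (snd A.wk (B.subst (lift S)) (var 0))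
      (scons (fst A.wk (B.subst (lift S)) (var 0)) S)))

/-- The action of `Π` on a map `j` of bases, in the opposite direction, and a map `k` of fibres. -/
def piMap (A : PreExp n) (B : PreExp (n + 1)) (A' : PreExp n) (B' : PreExp (n + 1))
    (j : PreExp (n + 1)) (k : PreExp (n + 2)) : PreExp (n + 1) :=
  lam A'.wk (B'.subst (lift S))
    (k.subst (scons (app A.wk.wk (B.subst (lift (S ⊚ S))) (var 1) (j.subst (lift S))) (lift S)))

/-- The action of `+` on a pair of maps. -/
def sumMap (A B A' B' : PreExp n) (i k : PreExp (n + 1)) : PreExp (n + 1) :=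
  elSum A.wk B.wk (sum A'.wk.wk B'.wk.wk) (var 0) (inl A'.wk.wk B'.wk.wk (i.subst (lift S)))
    (inr A'.wk.wk B'.wk.wk (k.subst (lift S)))

/-- The action of `List` on a map. -/
def listMap (A A' : PreExp n) (i : PreExp (n + 1)) : PreExp (n + 1) :=
  elList A.wk (list A'.wk.wk) (var 0) (nil A'.wk)
    (cons A'.wk.wk.wk.wk (var 0) (i.subst (scons (var 1) (S ⊚ S ⊚ S ⊚ S))))

/-- The action of quotients on a map compatible with the relations. -/
def quotMap (A : PreExp n) (R : PreExp (n + 2)) (A' : PreExp n) (R' : PreExp (n + 2))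
    (i : PreExp (n + 1)) : PreExp (n + 1) :=
  elQuot A.wk (R.subst (lift (lift S))) (quot A'.wk.wk (R'.subst (lift (lift (S ⊚ S))))) (var 0)
    (cls A'.wk.wk (R'.subst (lift (lift (S ⊚ S)))) (i.subst (lift S)))

end PreExp

section

variable {T : Theory} [hT : T.Impredicative]

/-- `i` is a term of type `A'` depending on a variable of type `A`. -/
structure IsMap (T : Theory) {n : ℕ} (Γ : Ctx n) (A A' : PreExp n) (i : PreExp (n + 1)) : Prop where
  dom : Derivable T (type .col Γ A)
  cod : Derivable T (type .col Γ A')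
  term : Derivable T (.term (Γ ▹ A) i (A'.subst S))

/-- `i` and `j` are mutually inverse. -/
structure IsIso (T : Theory) {n : ℕ} (Γ : Ctx n) (A A' : PreExp n) (i j : PreExp (n + 1)) :
    Prop where
  hom : IsMap T Γ A A' i
  inv : IsMap T Γ A' A j
  inv_hom : Derivable T (termEq (Γ ▹ A) (j.subst (scons i S)) (.var 0) (A.subst S))
  hom_inv : Derivable T (termEq (Γ ▹ A') (i.subst (scons j S)) (.var 0) (A'.subst S))

variable {n m : ℕ} {Γ : Ctx n} {Δ : Ctx m} {A A' C a b c d d' : PreExp n}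
  {B B' M i j i' j' : PreExp (n + 1)} {k l k' l' : PreExp (n + 2)} {θ : Fin n → PreExp m}

theorem IsMap.apply (h : IsMap T Γ A A' i) (hθ : Sub T Δ θ Γ) {a : PreExp m}
    (ha : Derivable T (.term Δ a (A.subst θ))) :
    Derivable T (.term Δ (i.subst (scons a θ)) (A'.subst θ)) := by
  simpa using h.term.sub_term (hθ.scons ha)

theorem IsMap.app (h : IsMap T Γ A A' i) (ha : Derivable T (.term Γ a A)) :
    Derivable T (.term Γ (i.inst a) A') := by
  simpa using h.apply (.id ha.ctx) (by simpa using ha)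

theorem IsMap.apply_congr (h : IsMap T Γ A A' i) (hθ : Sub T Δ θ Γ) {a b : PreExp m}
    (ha : Derivable T (.termEq Δ a b (A.subst θ))) :
    Derivable T (.termEq Δ (i.subst (scons a θ)) (i.subst (scons b θ)) (A'.subst θ)) := by
  simpa using h.term.subEq_term ((SubEq.refl hθ).scons h.dom ha.left ha.right ha)

theorem IsIso.inv_hom_apply (h : IsIso T Γ A A' i j) (hθ : Sub T Δ θ Γ) {a : PreExp m}
    (ha : Derivable T (.term Δ a (A.subst θ))) :
    Derivable T (termEq Δ (j.subst (scons (i.subst (scons a θ)) θ)) a (A.subst θ)) := by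
  simpa using h.inv_hom.sub_termEq (hθ.scons ha)

/-- Fibre maps over a map of bases, for `Σ`. -/
structure IsFibreMap (T : Theory) {n : ℕ} (Γ : Ctx n) (A : PreExp n) (B : PreExp (n + 1))
    (A' : PreExp n) (B' i : PreExp (n + 1)) (k : PreExp (n + 2)) : Prop where
  base : IsMap T Γ A A' i
  dom : Derivable T (type .col (Γ ▹ A) B)
  cod : Derivable T (type .col (Γ ▹ A') B')
  term : Derivable T (.term (Γ ▹ A ▹ B) k (B'.subst (scons (i.subst S) (S ⊚ S))))

open Derivable in
theorem fst_open (hB : Derivable T (type .col (Γ ▹ A) B)) :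
    Derivable T (.term (Γ ▹ sigma A B) (fst A.wk (B.subst (lift S)) (.var 0)) (A.subst S)) := by
  have hB₁ := hB.sub_type ((Sub.S hB.sigma_type).lift hB.head_type)
  simpa using fst_term hB₁ hB.sigma_type.var_zero

open Derivable in
theorem snd_open (hB : Derivable T (type .col (Γ ▹ A) B)) :
    Derivable T (.term (Γ ▹ sigma A B) (snd A.wk (B.subst (lift S)) (.var 0))
      (B.subst (scons (fst A.wk (B.subst (lift S)) (.var 0)) S))) := by
  have hB₁ := hB.sub_type ((Sub.S hB.sigma_type).lift hB.head_type)
  simpa using snd_term hB₁ hB.sigma_type.var_zero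

theorem fst_snd_sub (hB : Derivable T (type .col (Γ ▹ A) B)) :
    Sub T (Γ ▹ sigma A B) (scons (snd A.wk (B.subst (lift S)) (.var 0))
      (scons (fst A.wk (B.subst (lift S)) (.var 0)) S)) (Γ ▹ A ▹ B) :=
  ((Sub.S hB.sigma_type).scons (fst_open hB)).scons (snd_open hB)

open Derivable in
theorem fst_snd_subEq {A₁ : PreExp n} {B₁ : PreExp (n + 1)}
    (hA : Derivable T (typeEq .col Γ A A₁)) (hB : Derivable T (typeEq .col (Γ ▹ A) B B₁)) :
    SubEq T (Γ ▹ sigma A B)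
      (scons (snd A.wk (B.subst (lift S)) (.var 0))
        (scons (fst A.wk (B.subst (lift S)) (.var 0)) S))
      (scons (snd A₁.wk (B₁.subst (lift S)) (.var 0))
        (scons (fst A₁.wk (B₁.subst (lift S)) (.var 0)) S)) (Γ ▹ A ▹ B) := by
  have tB := hB.type_left
  have hS := Sub.S tB.sigma_type
  have hB₁ := hB.sub_typeEq (hS.lift tB.head_type)
  have e₁ : Derivable T (termEq (Γ ▹ sigma A B) (fst A.wk (B.subst (lift S)) (.var 0))
      (fst A₁.wk (B₁.subst (lift S)) (.var 0)) (A.subst S)) := by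
    simpa using fst_congr (hA.sub_typeEq hS) hB₁ (termEq_refl tB.sigma_type.var_zero)
  have e₂ : Derivable T (termEq (Γ ▹ sigma A B) (snd A.wk (B.subst (lift S)) (.var 0))
      (snd A₁.wk (B₁.subst (lift S)) (.var 0))
      (B.subst (scons (fst A.wk (B.subst (lift S)) (.var 0)) S))) := by
    simpa using snd_congr (hA.sub_typeEq hS) hB₁ (termEq_refl tB.sigma_type.var_zero)
  exact ((SubEq.refl hS).scons tB.head_type e₁.left e₁.right e₁).scons tB e₂.left e₂.right e₂

theorem IsFibreMap.sigmaMap (h : IsFibreMap T Γ A B A' B' i k) :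
    IsMap T Γ (sigma A B) (sigma A' B') (sigmaMap A B A' B' i k) := by
  refine ⟨h.dom.sigma_type, h.cod.sigma_type, ?_⟩
  have hS := Sub.S h.dom.sigma_type
  have h₁ := h.base.apply hS (fst_open h.dom)
  have h₂ := h.term.sub_term (fst_snd_sub h.dom)
  have := Derivable.sigma_intro (h.base.cod.sub_type hS) (h.cod.sub_type (hS.lift h.base.cod))
    h₁ (by simpa using h₂)
  simpa [PreExp.sigmaMap] using this

open Derivable in
-- The composite acts componentwise. Its first component is j(i(x)), which equals x, so the inverse
-- law for the fibres can be typed over x although `l` takes its values over j(i(x)). Surjective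
-- pairing concludes.
theorem IsFibreMap.sigmaMap_inv (h : IsFibreMap T Γ A B A' B' i k)
    (h' : IsFibreMap T Γ A' B' A B j l) (hi : IsIso T Γ A A' i j)
    (hl : Derivable T (termEq (Γ ▹ A ▹ B) (l.subst (scons k (scons (i.subst S) (S ⊚ S))))
      (.var 0) (B.subst S))) :
    Derivable T (termEq (Γ ▹ sigma A B)
      ((PreExp.sigmaMap A' B' A B j l).subst (scons (PreExp.sigmaMap A B A' B' i k) S)) (.var 0)
      ((sigma A B).subst S)) := by
  have tB := h.dom
  have tB' := h.cod
  have tS := tB.sigma_type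
  have hS := Sub.S tS
  have hx := fst_open tB
  have hy := snd_open tB
  have hix := h.base.apply hS hx
  have hk := h.term.sub_term (fst_snd_sub tB)
  have tB₁ := tB.sub_type (hS.lift tB.head_type)
  have tB₁' := tB'.sub_type (hS.lift tB'.head_type)
  have hk' := hk
  have hx' := hx
  simp at hk' hix hx'
  have e₁ := fst_beta hix tB₁' (by simpa using hk')
  have e₂ := snd_beta hix tB₁' (by simpa using hk')
  simp at e₁ e₂
  have f₁ := (h'.base.apply_congr hS e₁).termEq_trans (hi.inv_hom_apply hS hx')
  -- Unfolding the composite evaluates `j` and `l` at projections of a pair; this replaces the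
  -- projections by the components, to which the inverse laws apply.
  have es : SubEq T _ _ _ (Γ ▹ A' ▹ B') := ((SubEq.refl hS).scons tB'.head_type e₁.left e₁.right e₁).scons tB'
    (e₂.left.conv (by
      have := (typeEq_refl tB').trans_at tB' hS e₁.left e₁.right e₁
      exact this.typeEq_symm)) (e₂.right.conv (by
      have := (typeEq_refl tB').trans_at tB' hS e₁.left e₁.right e₁
      exact this.typeEq_symm)) (e₂.convEq (by
      have := (typeEq_refl tB').trans_at tB' hS e₁.left e₁.right e₁
      exact this.typeEq_symm))
  have g := h'.term.subEq_term es
  have g₂ := hl.sub_termEq (fst_snd_sub tB)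
  have ej := (typeEq_refl tB).trans_at tB hS f₁.left f₁.right f₁
  simp at g g₂ f₁ ej
  have f₂ := g.termEq_trans (g₂.convEq ej.typeEq_symm)
  have := Derivable.sigma_intro_eq (typeEq_refl tB₁.head_type) (typeEq_refl tB₁) f₁ (by simpa using f₂)
  have eta := pair_eta tB₁ tS.var_zero
  simp at this eta
  simpa [PreExp.sigmaMap] using this.termEq_trans eta

open Derivable in
theorem IsFibreMap.sigmaMap_congr {A₁ A₁' : PreExp n} {B₁ B₁' i₁ : PreExp (n + 1)}
    {k₁ : PreExp (n + 2)} (h : IsFibreMap T Γ A B A' B' i k)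
    (hA : Derivable T (typeEq .col Γ A A₁)) (hB : Derivable T (typeEq .col (Γ ▹ A) B B₁))
    (hA' : Derivable T (typeEq .col Γ A' A₁')) (hB' : Derivable T (typeEq .col (Γ ▹ A') B' B₁'))
    (hi : Derivable T (termEq (Γ ▹ A) i i₁ (A'.subst S)))
    (hk : Derivable T (termEq (Γ ▹ A ▹ B) k k₁ (B'.subst (scons (i.subst S) (S ⊚ S))))) :
    Derivable T (termEq (Γ ▹ sigma A B) (PreExp.sigmaMap A B A' B' i k)
      (PreExp.sigmaMap A₁ B₁ A₁' B₁' i₁ k₁) ((sigma A' B').subst S)) := by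
  have tB := h.dom
  have hS := Sub.S tB.sigma_type
  have es := fst_snd_subEq hA hB
  have e₁ := (hi.sub_termEq (.S tB)).subEq_termEq (hi.right.sub_term (.S tB)) es
  have e₂ := hk.subEq_termEq hk.right es
  simp at e₁ e₂
  have := Derivable.sigma_intro_eq (hA'.sub_typeEq hS)
    (hB'.sub_typeEq (hS.lift hA'.type_left)) e₁ (by simpa using e₂)
  simpa [PreExp.sigmaMap] using this

/-- Fibre maps against a map of bases, for `Π`. -/
structure IsCofibreMap (T : Theory) {n : ℕ} (Γ : Ctx n) (A : PreExp n) (B : PreExp (n + 1))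
    (A' : PreExp n) (B' j : PreExp (n + 1)) (k : PreExp (n + 2)) : Prop where
  base : IsMap T Γ A' A j
  dom : Derivable T (type .col (Γ ▹ A) B)
  cod : Derivable T (type .col (Γ ▹ A') B')
  term : Derivable T (.term (Γ ▹ A' ▹ B.subst (scons j S)) k (B'.subst S))

open Derivable in
theorem IsCofibreMap.body_sub (h : IsCofibreMap T Γ A B A' B' j k) :
    Sub T (Γ ▹ pi A B ▹ A'.subst S)
      (scons (PreExp.app A.wk.wk (B.subst (lift (S ⊚ S))) (.var 1) (j.subst (lift S))) (lift S))
      (Γ ▹ A' ▹ B.subst (scons j S)) := by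
  have tP := h.dom.pi_type
  have tA' := h.base.dom.sub_type (Sub.S tP)
  have hs := (Sub.S tP).lift h.base.dom
  have hs₂ := Sub.S₂ tA'
  refine Sub.scons hs ?_
  have := Derivable.pi_elim (h.dom.sub_type (hs₂.lift h.dom.head_type)) (f := .var 1)
    (by simpa using tA'.var_one) (a := j.subst (lift S))
    (by simpa using h.base.term.sub_term hs)
  simpa using this

open Derivable in
theorem IsCofibreMap.piMap (h : IsCofibreMap T Γ A B A' B' j k) :
    IsMap T Γ (pi A B) (pi A' B') (piMap A B A' B' j k) := by
  have tP := h.dom.pi_type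
  have hS := Sub.S tP
  refine ⟨tP, h.cod.pi_type, ?_⟩
  have := h.term.sub_term h.body_sub
  have := Derivable.pi_intro (h.cod.sub_type (hS.lift h.cod.head_type)).pi_type
    (b := k.subst (scons (PreExp.app A.wk.wk (B.subst (lift (S ⊚ S))) (.var 1)
      (j.subst (lift S))) (lift S))) (by simpa using this)
  simpa [PreExp.piMap] using this

open Derivable in
theorem IsCofibreMap.piMap_congr {A₁ A₁' : PreExp n} {B₁ B₁' j₁ : PreExp (n + 1)}
    {k₁ : PreExp (n + 2)} (h : IsCofibreMap T Γ A B A' B' j k)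
    (hA : Derivable T (typeEq .col Γ A A₁)) (hB : Derivable T (typeEq .col (Γ ▹ A) B B₁))
    (hA' : Derivable T (typeEq .col Γ A' A₁')) (hB' : Derivable T (typeEq .col (Γ ▹ A') B' B₁'))
    (hj : Derivable T (termEq (Γ ▹ A') j j₁ (A.subst S)))
    (hk : Derivable T (termEq (Γ ▹ A' ▹ B.subst (scons j S)) k k₁ (B'.subst S))) :
    Derivable T (termEq (Γ ▹ pi A B) (PreExp.piMap A B A' B' j k)
      (PreExp.piMap A₁ B₁ A₁' B₁' j₁ k₁) ((pi A' B').subst S)) := by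
  have tP := h.dom.pi_type
  have hS := Sub.S tP
  have tA' := h.base.dom.sub_type hS
  have hs := hS.lift h.base.dom
  have hs₂ := Sub.S₂ tA'
  have eb : Derivable T (termEq _ _ _ _) := Derivable.app_congr (hA.sub_typeEq hs₂)
    (hB.sub_typeEq (hs₂.lift hA.type_left)) (f := .var 1)
    (.termEq_refl (by simpa using tA'.var_one)) (a := j.subst (lift S)) (b := j₁.subst (lift S))
    (by simpa using hj.sub_termEq hs)
  have eb' := eb.termEq_cast rfl rfl (A' := (B.subst (scons j S)).subst (lift S)) (by simp)
  have es := (SubEq.refl hs).scons (h.dom.sub_type ((Sub.S h.base.dom).scons h.base.term))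
    eb'.left eb'.right eb'
  have := hk.subEq_termEq hk.right es
  simp at this
  have := Derivable.pi_intro_eq (hA'.sub_typeEq hS) (hB'.sub_typeEq (hS.lift hA'.type_left))
    (Derivable.eq_col (Derivable.pi_form_eq ((hA'.sub_typeEq hS).eq_collection _)
      ((hB'.sub_typeEq (hS.lift hA'.type_left)).eq_collection _))) (by simpa using this)
  simpa [PreExp.piMap] using this

open Derivable in
/-- Evaluation of the image of a function under `piMap`. -/
theorem IsCofibreMap.app_piMap (h : IsCofibreMap T Γ A B A' B' j k) {θ : Fin n → PreExp m}
    (hθ : Sub T Δ θ Γ) {f a : PreExp m} (hf : Derivable T (.term Δ f ((pi A B).subst θ)))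
    (ha : Derivable T (.term Δ a (A'.subst θ))) :
    Derivable T (termEq Δ (PreExp.app (A'.subst θ) (B'.subst (lift θ))
        ((PreExp.piMap A B A' B' j k).subst (scons f θ)) a)
      (k.subst (scons (PreExp.app (A.subst θ) (B.subst (lift θ)) f (j.subst (scons a θ)))
        (scons a θ))) (B'.subst (scons a θ))) := by
  have tP := h.dom.pi_type
  have hS := Sub.S tP
  have hf' := hθ.scons (A := pi A B) hf
  have hb := (h.term.sub_term h.body_sub).sub_term (hf'.lift (h.base.dom.sub_type hS))
  have := Derivable.pi_beta (h.cod.sub_type (hθ.lift h.cod.head_type)).pi_type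
    (by simpa using hb) ha
  simpa [PreExp.piMap] using this

open Derivable in
-- Functions are compared pointwise. At x, the composite sends f to l(x, k(i(x), f(j(i(x)))));
-- replacing j(i(x)) by x brings this to the form of the inverse law for the fibres, with the
-- variable of `B` instantiated by f(x).
theorem IsCofibreMap.piMap_inv (h : IsCofibreMap T Γ A B A' B' j k)
    (h' : IsCofibreMap T Γ A' B' A B i l) (hi : IsIso T Γ A A' i j)
    (hl : Derivable T (termEq (Γ ▹ A ▹ B)
      (l.subst (scons (k.subst (scons (.var 0) (scons (i.subst S) (S ⊚ S)))) S))
      (.var 0) (B.subst S))) :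
    Derivable T (termEq (Γ ▹ pi A B)
      ((PreExp.piMap A' B' A B i l).subst (scons (PreExp.piMap A B A' B' j k) S)) (.var 0)
      ((pi A B).subst S)) := by
  have tP := h.dom.pi_type
  have hS := Sub.S tP
  have tA := h.dom.head_type
  have tB₁ := h.dom.sub_type (hS.lift tA)
  have hs := hS.scons (A := pi A' B') h.piMap.term
  refine pi_ext (by simpa using h'.piMap.term.sub_term hs) (by simpa using tP.var_zero) ?_
  have tA₁ := tA.sub_type hS
  have hs₂ := Sub.S₂ tA₁
  have hx : Derivable T (.term (Γ ▹ pi A B ▹ A.subst S) (.var 0) (A.subst (S ⊚ S))) := by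
    simpa using tA₁.var_zero
  have hf : Derivable T (.term (Γ ▹ pi A B ▹ A.subst S) (.var 1) ((pi A B).subst (S ⊚ S))) := by
    simpa using tA₁.var_one
  have hF := h.piMap.apply hs₂ hf
  have e₁ := h'.app_piMap hs₂ hF hx
  have e₂ := h.app_piMap hs₂ hf (h'.base.apply hs₂ hx)
  have e₃ := hi.inv_hom_apply hs₂ hx
  have tB₂ := h.dom.sub_type (hs₂.lift tA)
  have e₄ := app_congr (typeEq_refl tB₂.head_type) (typeEq_refl tB₂) (termEq_refl hf) e₃
  have hv := e₄.right.conv (tB₂.inst_congr e₃)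
  have hix := h'.base.apply hs₂ hx
  have sk : SubEq T _ _ _ (Γ ▹ A' ▹ B.subst (scons j S)) := (SubEq.refl (hs₂.scons hix)).scons
    (h.dom.sub_type ((Sub.S h.base.dom).scons h.base.term)) (by simpa using e₄.left)
    (by simpa using e₄.right) (by simpa using e₄)
  have e₅ := h.term.subEq_term sk
  simp at e₁ e₂ e₅ hv
  have e₆ := e₂.termEq_trans e₅
  have sl : SubEq T _ _ _ (Γ ▹ A ▹ B'.subst (scons i S)) := (SubEq.refl (hs₂.scons hx)).scons
    (h'.dom.sub_type ((Sub.S h'.base.dom).scons h'.base.term)) (by simpa using e₆.left)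
    (by simpa using e₆.right) (by simpa using e₆)
  have e₇ := h'.term.subEq_term sl
  have e₈ := hl.sub_termEq ((hs₂.scons hx).scons (a := PreExp.app (A.subst (S ⊚ S))
    (B.subst (lift (S ⊚ S))) (.var 1) (.var 0)) (by simpa using hv))
  simp at e₇ e₈
  have := e₁.termEq_trans (e₇.termEq_trans e₈)
  simpa using this

end

/-! ### Extensionality at a generic element -/

section

variable {T : Theory} [hT : T.Impredicative]

variable {n m : ℕ} {Γ : Ctx n} {Δ : Ctx m} {A A' C a b c d d' : PreExp n}
  {B B' : PreExp n} {M i j i' j' k l f g : PreExp (n + 1)} {R R' : PreExp (n + 2)}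
  {θ : Fin n → PreExp m}

namespace Derivable

theorem sum_ext_open (hf : Derivable T (term (Γ ▹ sum A A') f M))
    (hg : Derivable T (term (Γ ▹ sum A A') g M))
    (h₁ : Derivable T (termEq (Γ ▹ A) (f.instAt 1 (inl A.wk A'.wk (.var 0)))
      (g.instAt 1 (inl A.wk A'.wk (.var 0))) (M.instAt 1 (inl A.wk A'.wk (.var 0)))))
    (h₂ : Derivable T (termEq (Γ ▹ A') (f.instAt 1 (inr A.wk A'.wk (.var 0)))
      (g.instAt 1 (inr A.wk A'.wk (.var 0))) (M.instAt 1 (inr A.wk A'.wk (.var 0))))) :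
    Derivable T (termEq (Γ ▹ sum A A') f g M) := by
  have tS := hf.head_type
  have hS := Sub.S tS
  have := sum_ext (hf.sub_term (hS.lift tS)) (hg.sub_term (hS.lift tS))
    (by simpa using h₁.sub_termEq (hS.lift h₁.head_type))
    (by simpa using h₂.sub_termEq (hS.lift h₂.head_type)) tS.var_zero
  simpa using this

theorem list_ext_open (hf : Derivable T (term (Γ ▹ list A) f M))
    (hg : Derivable T (term (Γ ▹ list A) g M))
    (h₁ : Derivable T (termEq Γ (f.inst (nil A)) (g.inst (nil A)) (M.inst (nil A))))
    (h₂ : Derivable T (termEq (Γ ▹ list A ▹ A.wk ▹ (eq M f g).instAt 2 (.var 1))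
      (f.instAt 3 (cons A.wk.wk.wk (.var 2) (.var 1)))
      (g.instAt 3 (cons A.wk.wk.wk (.var 2) (.var 1)))
      (M.instAt 3 (cons A.wk.wk.wk (.var 2) (.var 1))))) :
    Derivable T (termEq (Γ ▹ list A) f g M) := by
  have tL := hf.head_type
  have hS := Sub.S tL
  have h₃ := h₂.sub_termEq (((hS.lift tL).lift (tL.list_left.wk_type tL)).lift h₂.head_type)
  have := list_ext (hf.sub_term (hS.lift tL)) (hg.sub_term (hS.lift tL))
    (by simpa using h₁.sub_termEq hS) (by simpa using h₃) tL.var_zero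
  simpa using this

theorem quot_ext_open (hf : Derivable T (term (Γ ▹ quot A R) f M))
    (hg : Derivable T (term (Γ ▹ quot A R) g M))
    (h : Derivable T (termEq (Γ ▹ A)
      (f.instAt 1 (cls A.wk (R.subst (lift (lift (shift 1)))) (.var 0)))
      (g.instAt 1 (cls A.wk (R.subst (lift (lift (shift 1)))) (.var 0)))
      (M.instAt 1 (cls A.wk (R.subst (lift (lift (shift 1)))) (.var 0))))) :
    Derivable T (termEq (Γ ▹ quot A R) f g M) := by
  have tQ := hf.head_type
  have hS := Sub.S tQ
  have := quot_ext (hf.sub_term (hS.lift tQ)) (hg.sub_term (hS.lift tQ))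
    (by simpa using h.sub_termEq (hS.lift h.head_type)) tQ.var_zero
  simpa using this

end Derivable

/-! ### Sums -/

open Derivable in
theorem IsMap.sumMap (hi : IsMap T Γ A A' i) (hk : IsMap T Γ B B' k) :
    IsMap T Γ (sum A B) (sum A' B') (sumMap A B A' B' i k) := by
  have tS := (Derivable.sum_form (hi.dom.collection .small) (hk.dom.collection .small)).col
  have tS' := (Derivable.sum_form (hi.cod.collection .small) (hk.cod.collection .small)).col
  have hS := Sub.S tS
  refine ⟨tS, tS', ?_⟩
  have tS₁ := tS.sub_type hS
  have w₁ := (hS.wk (hi.dom.sub_type hS))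
  have w₂ := (hS.wk (hk.dom.sub_type hS))
  have := Derivable.sum_elim ((tS'.sub_type hS).sub_type (.S tS₁)) tS.var_zero
    (l := inl A'.wk.wk B'.wk.wk (i.subst (lift S)))
    (r := inr A'.wk.wk B'.wk.wk (k.subst (lift S)))
    (by
      simpa using Derivable.sum_inl ((hi.cod.collection .small).sub_type w₁)
        ((hk.cod.collection .small).sub_type w₁)
        (by simpa using hi.term.sub_term (hS.lift hi.dom)))
    (by
      simpa using Derivable.sum_inr ((hi.cod.collection .small).sub_type w₂)
        ((hk.cod.collection .small).sub_type w₂)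
        (by simpa using hk.term.sub_term (hS.lift hk.dom)))
  simpa [PreExp.sumMap] using this

open Derivable in
theorem IsMap.sumMap_congr {A₁ A₁' B₁ B₁' : PreExp n} {i₁ k₁ : PreExp (n + 1)}
    (hA : Derivable T (typeEq .col Γ A A₁)) (hA' : Derivable T (typeEq .col Γ A' A₁'))
    (hB : Derivable T (typeEq .col Γ B B₁)) (hB' : Derivable T (typeEq .col Γ B' B₁'))
    (hi : Derivable T (termEq (Γ ▹ A) i i₁ (A'.subst S)))
    (hk : Derivable T (termEq (Γ ▹ B) k k₁ (B'.subst S))) :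
    Derivable T (termEq (Γ ▹ sum A B) (PreExp.sumMap A B A' B' i k)
      (PreExp.sumMap A₁ B₁ A₁' B₁' i₁ k₁) ((sum A' B').subst S)) := by
  have sA := hA.eq_collection .small
  have sB := hB.eq_collection .small
  have sA' := hA'.eq_collection .small
  have sB' := hB'.eq_collection .small
  have tS := (Derivable.sum_form sA.type_left sB.type_left).col
  have eS' := Derivable.sum_form_eq sA' sB'
  have hS := Sub.S tS
  have tS₁ := tS.sub_type hS
  have w₁ := (hS.wk (sA.type_left.sub_type hS))
  have w₂ := (hS.wk (sB.type_left.sub_type hS))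
  have := Derivable.sum_elim_eq (sA.sub_typeEq hS) (sB.sub_typeEq hS)
    ((eS'.eq_col.sub_typeEq hS).sub_typeEq (.S tS₁)) (.termEq_refl tS.var_zero)
    (l := inl A'.wk.wk B'.wk.wk (i.subst (lift S)))
    (r := inr A'.wk.wk B'.wk.wk (k.subst (lift S)))
    (l' := inl A₁'.wk.wk B₁'.wk.wk (i₁.subst (lift S)))
    (r' := inr A₁'.wk.wk B₁'.wk.wk (k₁.subst (lift S)))
    (by
      simpa using Derivable.sum_inl_eq (sA'.sub_typeEq w₁) (sB'.sub_typeEq w₁)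
        (by simpa using hi.sub_termEq (hS.lift hA.type_left)))
    (by
      simpa using Derivable.sum_inr_eq (sA'.sub_typeEq w₂) (sB'.sub_typeEq w₂)
        (by simpa using hk.sub_termEq (hS.lift hB.type_left)))
  simpa [PreExp.sumMap] using this

open Derivable in
theorem IsMap.sumMap_inl (hi : IsMap T Γ A A' i) (hk : IsMap T Γ B B' k) (hθ : Sub T Δ θ Γ)
    {a : PreExp m} (ha : Derivable T (.term Δ a (A.subst θ))) :
    Derivable T (termEq Δ
      ((PreExp.sumMap A B A' B' i k).subst (scons (inl (A.subst θ) (B.subst θ) a) θ))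
      (inl (A'.subst θ) (B'.subst θ) (i.subst (scons a θ))) ((sum A' B').subst θ)) := by
  have tS := (hi.sumMap hk).dom.sub_type hθ
  have tS' := (hi.sumMap hk).cod.sub_type hθ
  have tA := hi.dom.sub_type hθ
  have tB := hk.dom.sub_type hθ
  have w₁ := hθ.wk tA
  have w₂ := hθ.wk tB
  have := Derivable.sum_beta_inl (tS'.sub_type (.S tS)) ha
    (l := inl (A'.subst θ).wk (B'.subst θ).wk (i.subst (lift θ)))
    (r := inr (A'.subst θ).wk (B'.subst θ).wk (k.subst (lift θ)))
    (by
      simpa using Derivable.sum_inl ((hi.cod.collection .small).sub_type w₁)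
        ((hk.cod.collection .small).sub_type w₁)
        (by simpa using hi.term.sub_term (hθ.lift hi.dom)))
    (by
      simpa using Derivable.sum_inr ((hi.cod.collection .small).sub_type w₂)
        ((hk.cod.collection .small).sub_type w₂)
        (by simpa using hk.term.sub_term (hθ.lift hk.dom)))
  simpa [PreExp.sumMap] using this

open Derivable in
theorem IsMap.sumMap_inr (hi : IsMap T Γ A A' i) (hk : IsMap T Γ B B' k) (hθ : Sub T Δ θ Γ)
    {a : PreExp m} (ha : Derivable T (.term Δ a (B.subst θ))) :
    Derivable T (termEq Δ
      ((PreExp.sumMap A B A' B' i k).subst (scons (inr (A.subst θ) (B.subst θ) a) θ))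
      (inr (A'.subst θ) (B'.subst θ) (k.subst (scons a θ))) ((sum A' B').subst θ)) := by
  have tS := (hi.sumMap hk).dom.sub_type hθ
  have tS' := (hi.sumMap hk).cod.sub_type hθ
  have tA := hi.dom.sub_type hθ
  have tB := hk.dom.sub_type hθ
  have w₁ := hθ.wk tA
  have w₂ := hθ.wk tB
  have := Derivable.sum_beta_inr (tS'.sub_type (.S tS)) ha
    (l := inl (A'.subst θ).wk (B'.subst θ).wk (i.subst (lift θ)))
    (r := inr (A'.subst θ).wk (B'.subst θ).wk (k.subst (lift θ)))
    (by
      simpa using Derivable.sum_inl ((hi.cod.collection .small).sub_type w₁)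
        ((hk.cod.collection .small).sub_type w₁)
        (by simpa using hi.term.sub_term (hθ.lift hi.dom)))
    (by
      simpa using Derivable.sum_inr ((hi.cod.collection .small).sub_type w₂)
        ((hk.cod.collection .small).sub_type w₂)
        (by simpa using hk.term.sub_term (hθ.lift hk.dom)))
  simpa [PreExp.sumMap] using this

open Derivable in
theorem IsIso.sumMap_inv (hi : IsIso T Γ A A' i j) (hk : IsIso T Γ B B' k l) :
    Derivable T (termEq (Γ ▹ sum A B)
      ((sumMap A' B' A B j l).subst (scons (sumMap A B A' B' i k) S)) (.var 0)
      ((sum A B).subst S)) := by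
  have h := hi.hom.sumMap hk.hom
  have h' := hi.inv.sumMap hk.inv
  have sA := hi.hom.dom.collection .small
  have sB := hk.hom.dom.collection .small
  refine sum_ext_open (by simpa using h'.apply (.S h.dom) h.term) h.dom.var_zero ?_ ?_
  · have hS := Sub.S sA
    have e₁ := hi.hom.sumMap_inl hk.hom hS sA.var_zero
    have e₂ := h'.apply_congr hS e₁
    have e₃ := hi.inv.sumMap_inl hk.inv hS (hi.hom.apply hS sA.var_zero)
    have e₄ := Derivable.sum_inl_eq (.typeEq_refl (sA.sub_type hS)) (.typeEq_refl (sB.sub_type hS))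
      (hi.inv_hom_apply hS sA.var_zero)
    simp at e₂ e₃ e₄
    simpa using e₂.termEq_trans (e₃.termEq_trans e₄)
  · have hS := Sub.S sB
    have e₁ := hi.hom.sumMap_inr hk.hom hS sB.var_zero
    have e₂ := h'.apply_congr hS e₁
    have e₃ := hi.inv.sumMap_inr hk.inv hS (hk.hom.apply hS sB.var_zero)
    have e₄ := Derivable.sum_inr_eq (.typeEq_refl (sA.sub_type hS)) (.typeEq_refl (sB.sub_type hS))
      (hk.inv_hom_apply hS sB.var_zero)
    simp at e₂ e₃ e₄
    simpa using e₂.termEq_trans (e₃.termEq_trans e₄)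

/-! ### Lists -/

open Derivable in
theorem IsMap.listMap_step (hi : IsMap T Γ A A' i) (hθ : Sub T Δ θ Γ) :
    Derivable T (.term (Δ ▹ list (A.subst θ) ▹ (A.subst θ).wk ▹
        ((list A').subst (θ ⊚ S)).instAt 2 (.var 1))
      (cons (A'.subst (θ ⊚ S ⊚ S ⊚ S)) (.var 0) (i.subst (scons (.var 1) (θ ⊚ S ⊚ S ⊚ S))))
      ((list A').subst (θ ⊚ S ⊚ S ⊚ S))) := by
  have sA := (hi.dom.collection .small).sub_type hθ
  have sA' := hi.cod.collection .small
  have tA₁ := sA.wk_type (Derivable.list_form sA)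
  have tL := (Derivable.list_form sA').sub_type (hθ.comp (Sub.S₂ tA₁))
  have h₃ : Derivable T (type .set (Δ ▹ list (A.subst θ) ▹ (A.subst θ).wk)
      (((list A').subst (θ ⊚ S)).instAt 2 (.var 1))) := by simpa using tL
  have w := hθ.comp (Sub.S₃ h₃)
  exact Derivable.list_cons (sA'.sub_type w) (by simpa using h₃.var_zero)
    (hi.apply w (by simpa using h₃.var_one))

theorem IsMap.listMap_nil_term (hi : IsMap T Γ A A' i) (hθ : Sub T Δ θ Γ) :
    Derivable T (.term Δ (nil (A'.subst θ)) ((list A').subst θ)) :=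
  Derivable.list_nil ((hi.cod.collection .small).sub_type hθ)

open Derivable in
theorem IsMap.listMap (hi : IsMap T Γ A A' i) :
    IsMap T Γ (list A) (list A') (listMap A A' i) := by
  have tL := (Derivable.list_form (hi.dom.collection .small)).col
  have tL' := (Derivable.list_form (hi.cod.collection .small)).col
  have hS := Sub.S tL
  refine ⟨tL, tL', ?_⟩
  have := Derivable.list_elim ((tL'.sub_type hS).sub_type (.S (tL.sub_type hS))) tL.var_zero
    (a := nil (A'.subst S))
    (l := cons (A'.subst (S ⊚ S ⊚ S ⊚ S)) (.var 0) (i.subst (scons (.var 1) (S ⊚ S ⊚ S ⊚ S))))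
    (by simpa using hi.listMap_nil_term hS)
    (by simpa using hi.listMap_step hS)
  simpa [PreExp.listMap] using this

open Derivable in
theorem IsMap.listMap_congr {A₁ A₁' : PreExp n} {i₁ : PreExp (n + 1)}
    (hi : IsMap T Γ A A' i)
    (hA : Derivable T (typeEq .col Γ A A₁)) (hA' : Derivable T (typeEq .col Γ A' A₁'))
    (he : Derivable T (termEq (Γ ▹ A) i i₁ (A'.subst S))) :
    Derivable T (termEq (Γ ▹ list A) (PreExp.listMap A A' i) (PreExp.listMap A₁ A₁' i₁)
      ((list A').subst S)) := by
  have sA := hA.eq_collection .small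
  have sA' := hA'.eq_collection .small
  have tL := (Derivable.list_form sA.type_left).col
  have eL' := (Derivable.list_form_eq sA').eq_col
  have hS := Sub.S tL
  have st := (hi.listMap_step hS).head_type
  have w := hS.comp (Sub.S₃ st)
  have := Derivable.list_elim_eq (sA.sub_typeEq hS)
    ((eL'.sub_typeEq hS).sub_typeEq (.S (tL.sub_type hS))) (.termEq_refl tL.var_zero)
    (a := nil (A'.subst S)) (a' := nil (A₁'.subst S))
    (l := cons (A'.subst (S ⊚ S ⊚ S ⊚ S)) (.var 0) (i.subst (scons (.var 1) (S ⊚ S ⊚ S ⊚ S))))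
    (l' := cons (A₁'.subst (S ⊚ S ⊚ S ⊚ S)) (.var 0)
      (i₁.subst (scons (.var 1) (S ⊚ S ⊚ S ⊚ S))))
    (by simpa using Derivable.list_nil_eq (sA'.sub_typeEq hS))
    (by
      simpa using Derivable.list_cons_eq (sA'.sub_typeEq w)
        (.termEq_refl (by simpa using st.var_zero))
        (by simpa using he.sub_termEq (w.scons (by simpa using st.var_one))))
  simpa [PreExp.listMap] using this

open Derivable in
theorem IsMap.listMap_nil (hi : IsMap T Γ A A' i) (hθ : Sub T Δ θ Γ) :
    Derivable T (termEq Δ ((PreExp.listMap A A' i).subst (scons (nil (A.subst θ)) θ))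
      (nil (A'.subst θ)) ((list A').subst θ)) := by
  have tL := hi.listMap.dom.sub_type hθ
  have tL' := hi.listMap.cod.sub_type hθ
  have := Derivable.list_beta_nil (A := A.subst θ) (tL'.sub_type (.S tL)) (a := nil (A'.subst θ))
    (l := cons (A'.subst (θ ⊚ S ⊚ S ⊚ S)) (.var 0) (i.subst (scons (.var 1) (θ ⊚ S ⊚ S ⊚ S))))
    (by simpa using hi.listMap_nil_term hθ)
    (by simpa using hi.listMap_step hθ)
  simpa [PreExp.listMap] using this

open Derivable in
theorem IsMap.listMap_cons (hi : IsMap T Γ A A' i) (hθ : Sub T Δ θ Γ) {s a : PreExp m}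
    (hs : Derivable T (.term Δ s ((list A).subst θ))) (ha : Derivable T (.term Δ a (A.subst θ))) :
    Derivable T (termEq Δ ((PreExp.listMap A A' i).subst (scons (cons (A.subst θ) s a) θ))
      (cons (A'.subst θ) ((PreExp.listMap A A' i).subst (scons s θ)) (i.subst (scons a θ)))
      ((list A').subst θ)) := by
  have tL := hi.listMap.dom.sub_type hθ
  have tL' := hi.listMap.cod.sub_type hθ
  have := Derivable.list_beta_cons (A := A.subst θ) (tL'.sub_type (.S tL)) hs ha
    (a := nil (A'.subst θ))
    (l := cons (A'.subst (θ ⊚ S ⊚ S ⊚ S)) (.var 0) (i.subst (scons (.var 1) (θ ⊚ S ⊚ S ⊚ S))))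
    (by simpa using hi.listMap_nil_term hθ)
    (by simpa using hi.listMap_step hθ)
  simpa [PreExp.listMap] using this

open Derivable in
theorem IsIso.listMap_inv (hi : IsIso T Γ A A' i j) :
    Derivable T (termEq (Γ ▹ list A)
      ((listMap A' A j).subst (scons (listMap A A' i) S)) (.var 0) ((list A).subst S)) := by
  have h := hi.hom.listMap
  have h' := hi.inv.listMap
  have sA := hi.hom.dom.collection .small
  have hf := h'.apply (.S h.dom) h.term
  have tE := Derivable.eq_form (s := .large) (h.dom.sub_type (.S h.dom)) hf h.dom.var_zero
  refine list_ext_open hf h.dom.var_zero ?_ ?_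
  · have hθ := Sub.id h.dom.ctx
    have e₁ := hi.hom.listMap_nil hθ
    have e₂ := h'.apply_congr hθ e₁
    have e₃ := hi.inv.listMap_nil hθ
    simp at e₂ e₃
    simpa using e₂.termEq_trans e₃
  · have tA₁ := sA.wk_type h.dom
    have tE₂ := tE.sub_type ((Sub.S₂ tA₁).scons tA₁.var_one)
    have hθ := Sub.S₃ tE₂
    have hx := tE₂.var_two
    have hy := tE₂.var_one.term_cast rfl (A' := A.subst (S ⊚ S ⊚ S)) (by simp)
    have e₁ := hi.hom.listMap_cons hθ hx hy
    have e₂ := h'.apply_congr hθ e₁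
    have e₃ := hi.inv.listMap_cons hθ (h.apply hθ hx) (hi.hom.apply hθ hy)
    -- The last declared variable is the induction hypothesis, a proof of the equality at the tail.
    -- Reflection makes it judgemental, so that it can be used under `cons`.
    have ex := Derivable.eq_reflection (h.dom.sub_type hθ) (h'.apply hθ (h.apply hθ hx)) hx
      (.prop_true (by simpa using tE₂.sub_type (.S tE₂)) (by simpa using tE₂.var_zero))
    have e₄ := Derivable.list_cons_eq (.typeEq_refl (sA.sub_type hθ)) ex (hi.inv_hom_apply hθ hy)
    simp at e₂ e₃ e₄
    simpa using e₂.termEq_trans (e₃.termEq_trans e₄)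

/-! ### Quotients -/

/-- A map compatible with the relations. -/
structure IsQuotMap (T : Theory) {n : ℕ} (Γ : Ctx n) (A : PreExp n) (R : PreExp (n + 2))
    (A' : PreExp n) (R' : PreExp (n + 2)) (i : PreExp (n + 1)) : Prop where
  base : IsMap T Γ A A' i
  dom : Derivable T (type .set Γ (quot A R))
  cod : Derivable T (type .set Γ (quot A' R'))
  compat : Derivable T (holds (Γ ▹ A ▹ A.wk ▹ R)
    (R'.subst (scons (i.subst (scons (.var 1) (S ⊚ S ⊚ S)))
      (scons (i.subst (scons (.var 2) (S ⊚ S ⊚ S))) (S ⊚ S ⊚ S)))))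

open Derivable in
theorem IsQuotMap.branch (h : IsQuotMap T Γ A R A' R' i) (hθ : Sub T Δ θ Γ) :
    Derivable T (.term (Δ ▹ A.subst θ)
      (cls (A'.subst (θ ⊚ S)) (R'.subst (lift (lift (θ ⊚ S)))) (i.subst (lift θ)))
      ((quot A' R').subst (θ ⊚ S))) := by
  have w := hθ.wk (h.base.dom.sub_type hθ)
  exact Derivable.quot_intro (h.cod.sub_type w)
    (by simpa using h.base.term.sub_term (hθ.lift h.base.dom))

open Derivable in
-- Related representatives have related images, and related elements have equal classes. The
-- equality is first derived over Γ and then substituted along θ.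
theorem IsQuotMap.branch_compat (h : IsQuotMap T Γ A R A' R' i) (hθ : Sub T Δ θ Γ) :
    Derivable T (termEq (Δ ▹ A.subst θ ▹ (A.subst θ).wk ▹ R.subst (lift (lift θ)))
      (cls (A'.subst (θ ⊚ S ⊚ S ⊚ S)) (R'.subst (lift (lift (θ ⊚ S ⊚ S ⊚ S))))
        (i.subst (scons (.var 2) (θ ⊚ S ⊚ S ⊚ S))))
      (cls (A'.subst (θ ⊚ S ⊚ S ⊚ S)) (R'.subst (lift (lift (θ ⊚ S ⊚ S ⊚ S))))
        (i.subst (scons (.var 1) (θ ⊚ S ⊚ S ⊚ S))))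
      ((quot A' R').subst (θ ⊚ S ⊚ S ⊚ S))) := by
  have tR := h.dom.quot_right
  have tA := h.base.dom
  have w := Sub.S₃ tR
  have e := Derivable.quot_eq (h.cod.sub_type w) (h.base.apply w tR.var_two)
    (h.base.apply w (a := .var 1) (by simpa using tR.var_one)) (by simpa using h.compat)
  have := e.sub_termEq (((hθ.lift tA).lift (tA.wk_type tA)).lift tR)
  simpa using this

open Derivable in
theorem IsQuotMap.quotMap (h : IsQuotMap T Γ A R A' R' i) :
    IsMap T Γ (quot A R) (quot A' R') (quotMap A R A' R' i) := by
  have hS := Sub.S h.dom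
  refine ⟨h.dom.col, h.cod.col, ?_⟩
  have := Derivable.quot_elim ((h.cod.col.sub_type hS).sub_type (.S (h.dom.sub_type hS)))
    h.dom.var_zero
    (l := cls (A'.subst (S ⊚ S)) (R'.subst (lift (lift (S ⊚ S)))) (i.subst (lift S)))
    (by simpa using h.branch hS)
    (by simpa using h.branch_compat hS)
  simpa [PreExp.quotMap] using this

open Derivable in
theorem IsQuotMap.quotMap_cls (h : IsQuotMap T Γ A R A' R' i) (hθ : Sub T Δ θ Γ) {a : PreExp m}
    (ha : Derivable T (.term Δ a (A.subst θ))) :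
    Derivable T (termEq Δ
      ((PreExp.quotMap A R A' R' i).subst
        (scons (cls (A.subst θ) (R.subst (lift (lift θ))) a) θ))
      (cls (A'.subst θ) (R'.subst (lift (lift θ))) (i.subst (scons a θ)))
      ((quot A' R').subst θ)) := by
  have := Derivable.quot_beta ((h.cod.col.sub_type hθ).sub_type (.S (h.dom.sub_type hθ))) ha
    (l := cls (A'.subst (θ ⊚ S)) (R'.subst (lift (lift (θ ⊚ S)))) (i.subst (lift θ)))
    (by simpa using h.branch hθ)
    (by simpa using h.branch_compat hθ)
  simpa [PreExp.quotMap] using this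

open Derivable in
theorem IsQuotMap.quotMap_congr {A₁ A₁' : PreExp n} {R₁ R₁' : PreExp (n + 2)}
    {i₁ : PreExp (n + 1)} (h : IsQuotMap T Γ A R A' R' i)
    (hQ : Derivable T (type .set Γ (quot A₁ R₁))) (hQ' : Derivable T (type .set Γ (quot A₁' R₁')))
    (hA : Derivable T (typeEq .col Γ A A₁)) (hA' : Derivable T (typeEq .col Γ A' A₁'))
    (hR : Derivable T (typeEq .props (Γ ▹ A ▹ A.wk) R R₁))
    (hR' : Derivable T (typeEq .props (Γ ▹ A' ▹ A'.wk) R' R₁'))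
    (he : Derivable T (termEq (Γ ▹ A) i i₁ (A'.subst S))) :
    Derivable T (termEq (Γ ▹ quot A R) (PreExp.quotMap A R A' R' i)
      (PreExp.quotMap A₁ R₁ A₁' R₁' i₁) ((quot A' R').subst S)) := by
  have sA := hA.eq_collection .small
  have sA' := hA'.eq_collection .small
  have hS := Sub.S h.dom
  have tA := hA.type_left
  have tA' := hA'.type_left
  have w := hS.wk (tA.sub_type hS)
  have eQ' := Derivable.quot_form_eq h.cod hQ' sA' hR'
  have := Derivable.quot_elim_eq (h.dom.sub_type hS) (hQ.sub_type hS) (sA.sub_typeEq hS)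
    (by simpa using hR.sub_typeEq ((hS.lift tA).lift (tA.wk_type tA)))
    ((eQ'.eq_col.sub_typeEq hS).sub_typeEq (.S (h.dom.sub_type hS))) (.termEq_refl h.dom.var_zero)
    (l := cls (A'.subst (S ⊚ S)) (R'.subst (lift (lift (S ⊚ S)))) (i.subst (lift S)))
    (l' := cls (A₁'.subst (S ⊚ S)) (R₁'.subst (lift (lift (S ⊚ S)))) (i₁.subst (lift S)))
    (by
      simpa using Derivable.quot_intro_eq (h.cod.sub_type w) (hQ'.sub_type w) (sA'.sub_typeEq w)
        (by simpa using hR'.sub_typeEq ((w.lift tA').lift (tA'.wk_type tA')))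
        (by simpa using he.sub_termEq (hS.lift tA)))
    (by simpa using h.branch_compat hS)
  simpa [PreExp.quotMap] using this

open Derivable in
theorem IsQuotMap.quotMap_inv (h : IsQuotMap T Γ A R A' R' i) (h' : IsQuotMap T Γ A' R' A R j)
    (hi : IsIso T Γ A A' i j) :
    Derivable T (termEq (Γ ▹ quot A R)
      ((PreExp.quotMap A' R' A R j).subst (scons (PreExp.quotMap A R A' R' i) S)) (.var 0)
      ((quot A R).subst S)) := by
  have tA := hi.hom.dom
  refine quot_ext_open (h'.quotMap.apply (.S h.dom) h.quotMap.term) h.dom.var_zero ?_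
  have hS := Sub.S tA
  have e₁ := h.quotMap_cls hS tA.var_zero
  have e₂ := h'.quotMap.apply_congr hS e₁
  have e₃ := h'.quotMap_cls hS (hi.hom.apply hS tA.var_zero)
  have tR := h.dom.quot_right
  have sA := tA.collection .small
  have e₄ := Derivable.quot_intro_eq (h.dom.sub_type hS) (h.dom.sub_type hS)
    (.typeEq_refl (sA.sub_type hS))
    (.typeEq_refl (by simpa using tR.sub_type ((hS.lift tA).lift (tA.wk_type tA))))
    (hi.inv_hom_apply hS tA.var_zero)
  simp at e₂ e₃ e₄
  simpa using e₂.termEq_trans (e₃.termEq_trans e₄)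

end

/-! ### Coercions between a type and its canonical form -/

namespace PreExp

variable {n m k : ℕ}

/-- Either the expression itself or its canonical form. -/
def tr : Bool → PreExp n → PreExp n
  | false, e => e
  | true, e => e.canon

/-- Componentwise `tr`. -/
def trS (b : Bool) (σ : Fin n → PreExp m) : Fin n → PreExp m := fun i => (σ i).tr b

section

variable (b : Bool)

@[simp] theorem tr_subst (σ : Fin n → PreExp m) (e : PreExp n) :
    (e.subst σ).tr b = (e.tr b).subst (trS b σ) := by
  cases b
  · rfl
  · exact canon_subst σ e

@[simp] theorem trS_scons (a : PreExp m) (σ : Fin n → PreExp m) :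
    trS b (scons a σ) = scons (a.tr b) (trS b σ) := by
  cases b
  · rfl
  · exact canonS_scons a σ

@[simp] theorem trS_comp (σ : Fin n → PreExp m) (τ : Fin m → PreExp k) :
    trS b (σ ⊚ τ) = trS b σ ⊚ trS b τ := by
  cases b
  · rfl
  · exact canonS_comp σ τ

@[simp] theorem trS_S : trS b (S : Fin n → PreExp (n + 1)) = S := by cases b <;> rfl

@[simp] theorem trS_var : trS b (var : Fin n → PreExp n) = var := by cases b <;> rfl

@[simp] theorem tr_var (i : Fin n) : (var i).tr b = var i := by cases b <;> rfl

@[simp] theorem tr_empty : (empty : PreExp n).tr b = empty := by cases b <;> rfl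

@[simp] theorem tr_unit : (unit : PreExp n).tr b = unit := by cases b <;> rfl

@[simp] theorem tr_pow : (pow : PreExp n).tr b = pow := by cases b <;> rfl

@[simp] theorem tr_star : (star : PreExp n).tr b = star := by cases b <;> rfl

variable (A A' a c d : PreExp n) (B M f g : PreExp (n + 1)) (R e : PreExp (n + 2))
  (l : PreExp (n + 3))

@[simp] theorem tr_sigma : (sigma A B).tr b = sigma (A.tr b) (B.tr b) := by cases b <;> rfl

@[simp] theorem tr_pi : (pi A B).tr b = pi (A.tr b) (B.tr b) := by cases b <;> rfl

@[simp] theorem tr_sum : (sum A A').tr b = sum (A.tr b) (A'.tr b) := by cases b <;> rfl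

@[simp] theorem tr_list : (list A).tr b = list (A.tr b) := by cases b <;> rfl

@[simp] theorem tr_quot : (quot A R).tr b = quot (A.tr b) (R.tr b) := by cases b <;> rfl

@[simp] theorem tr_pair : (pair A B a c).tr b = pair (A.tr b) (B.tr b) (a.tr b) (c.tr b) := by
  cases b <;> rfl

@[simp] theorem tr_lam : (lam A B f).tr b = lam (A.tr b) (B.tr b) (f.tr b) := by cases b <;> rfl

@[simp] theorem tr_app : (app A B a c).tr b = app (A.tr b) (B.tr b) (a.tr b) (c.tr b) := by
  cases b <;> rfl

@[simp] theorem tr_inl : (inl A A' a).tr b = inl (A.tr b) (A'.tr b) (a.tr b) := by cases b <;> rfl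

@[simp] theorem tr_inr : (inr A A' a).tr b = inr (A.tr b) (A'.tr b) (a.tr b) := by cases b <;> rfl

@[simp] theorem tr_nil : (nil A).tr b = nil (A.tr b) := by cases b <;> rfl

@[simp] theorem tr_cons : (cons A c a).tr b = cons (A.tr b) (c.tr b) (a.tr b) := by cases b <;> rfl

@[simp] theorem tr_cls : (cls A R a).tr b = cls (A.tr b) (R.tr b) (a.tr b) := by cases b <;> rfl

@[simp] theorem tr_code : (code A).tr b = code (A.tr b) := by cases b <;> rfl

end

/-- The coercion from `A(σ)` to the canonical form of `A` at `σ'` (for `b = false`) or from the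
canonical form of `A` at `σ` to `A(σ')` (for `b = true`), as an open term. -/
def cast : {n m : ℕ} → Bool → PreExp n → (σ σ' : Fin n → PreExp m) → PreExp (m + 1)
  -- In the fibre, the bound variable of the source is a fresh variable, and that of the target is
  -- its coercion.
  | _, _, b, sigma A B, σ, σ' =>
    sigmaMap ((A.tr b).subst σ) ((B.tr b).subst (lift σ)) ((A.tr (!b)).subst σ')
      ((B.tr (!b)).subst (lift σ')) (cast b A σ σ')
      (cast b B (lift σ) (scons (cast b A σ σ') (σ' ⊚ S)))
  -- Arguments travel backwards: the fresh variable belongs to the target, and the bound variable of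
  -- the source is its coercion in the opposite direction.
  | _, _, b, pi A B, σ, σ' =>
    piMap ((A.tr b).subst σ) ((B.tr b).subst (lift σ)) ((A.tr (!b)).subst σ')
      ((B.tr (!b)).subst (lift σ')) (cast (!b) A σ' σ)
      (cast b B (scons (cast (!b) A σ' σ) (σ ⊚ S)) (lift σ'))
  | _, _, b, sum A B, σ, σ' =>
    sumMap ((A.tr b).subst σ) ((B.tr b).subst σ) ((A.tr (!b)).subst σ') ((B.tr (!b)).subst σ')
      (cast b A σ σ') (cast b B σ σ')
  | _, _, b, list A, σ, σ' =>
    listMap ((A.tr b).subst σ) ((A.tr (!b)).subst σ') (cast b A σ σ')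
  -- Only representatives are coerced. The relation requires no coercion as data; the map on `A`
  -- will be shown to respect it.
  | _, _, b, quot A R, σ, σ' =>
    quotMap ((A.tr b).subst σ) ((R.tr b).subst (lift (lift σ))) ((A.tr (!b)).subst σ')
      ((R.tr (!b)).subst (lift (lift σ'))) (cast b A σ σ')
  -- A coercion between propositions is the proof-term of the target. It is well typed only if the
  -- source entails the target, which is left to the coherence theorem.
  | _, _, b, bot, _, σ' => tt ((bot.tr (!b)).subst (σ' ⊚ S))
  | _, _, b, and φ ψ, _, σ' => tt (((and φ ψ).tr (!b)).subst (σ' ⊚ S))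
  | _, _, b, or φ ψ, _, σ' => tt (((or φ ψ).tr (!b)).subst (σ' ⊚ S))
  | _, _, b, imp φ ψ, _, σ' => tt (((imp φ ψ).tr (!b)).subst (σ' ⊚ S))
  | _, _, b, ex A φ, _, σ' => tt (((ex A φ).tr (!b)).subst (σ' ⊚ S))
  | _, _, b, all A φ, _, σ' => tt (((all A φ).tr (!b)).subst (σ' ⊚ S))
  | _, _, b, eq A a c, _, σ' => tt (((eq A a c).tr (!b)).subst (σ' ⊚ S))
  -- The types N₀, N₁ and P(1) are their own canonical forms. The same clause also assigns a
  -- meaningless value to raw expressions that are not types.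
  | _, _, _, _, _, _ => var 0

/-- All subexpressions in type position have the raw shape of a type. -/
def TypeLike : {n : ℕ} → PreExp n → Prop
  | _, sigma A B => A.TypeLike ∧ B.TypeLike
  | _, pi A B => A.TypeLike ∧ B.TypeLike
  | _, sum A B => A.TypeLike ∧ B.TypeLike
  | _, list A => A.TypeLike
  | _, quot A _ => A.TypeLike
  | _, A => A.IsType

theorem TypeLike.subst {A : PreExp n} (h : A.TypeLike) (σ : Fin n → PreExp m) :
    (A.subst σ).TypeLike := by
  induction A generalizing m <;> try trivial
  case sigma ih₁ ih₂ => exact ⟨ih₁ h.1 _, ih₂ h.2 _⟩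
  case pi ih₁ ih₂ => exact ⟨ih₁ h.1 _, ih₂ h.2 _⟩
  case sum ih₁ ih₂ => exact ⟨ih₁ h.1 _, ih₂ h.2 _⟩
  case list ih => exact ih h _
  case quot ih _ => exact ih h _

theorem IsProp.cast_eq {φ : PreExp n} (h : φ.IsProp) (b : Bool) (σ σ' : Fin n → PreExp m) :
    cast b φ σ σ' = tt ((φ.tr (!b)).subst (σ' ⊚ S)) := by
  cases φ <;> first | exact h.elim | rfl

theorem sigmaMap_subst (A : PreExp n) (B : PreExp (n + 1)) (A' : PreExp n) (B' : PreExp (n + 1))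
    (i : PreExp (n + 1)) (k : PreExp (n + 2)) (θ : Fin n → PreExp m) :
    (sigmaMap A B A' B' i k).subst (lift θ) =
      sigmaMap (A.subst θ) (B.subst (lift θ)) (A'.subst θ) (B'.subst (lift θ)) (i.subst (lift θ))
        (k.subst (lift (lift θ))) := by
  simp [sigmaMap]

theorem piMap_subst (A : PreExp n) (B : PreExp (n + 1)) (A' : PreExp n) (B' : PreExp (n + 1))
    (j : PreExp (n + 1)) (k : PreExp (n + 2)) (θ : Fin n → PreExp m) :
    (piMap A B A' B' j k).subst (lift θ) =
      piMap (A.subst θ) (B.subst (lift θ)) (A'.subst θ) (B'.subst (lift θ)) (j.subst (lift θ))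
        (k.subst (lift (lift θ))) := by
  simp [piMap]

theorem sumMap_subst (A B A' B' : PreExp n) (i k : PreExp (n + 1)) (θ : Fin n → PreExp m) :
    (sumMap A B A' B' i k).subst (lift θ) =
      sumMap (A.subst θ) (B.subst θ) (A'.subst θ) (B'.subst θ) (i.subst (lift θ))
        (k.subst (lift θ)) := by
  simp [sumMap]

theorem listMap_subst (A A' : PreExp n) (i : PreExp (n + 1)) (θ : Fin n → PreExp m) :
    (listMap A A' i).subst (lift θ) =
      listMap (A.subst θ) (A'.subst θ) (i.subst (lift θ)) := by
  simp [listMap]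

theorem quotMap_subst (A : PreExp n) (R : PreExp (n + 2)) (A' : PreExp n) (R' : PreExp (n + 2))
    (i : PreExp (n + 1)) (θ : Fin n → PreExp m) :
    (quotMap A R A' R' i).subst (lift θ) =
      quotMap (A.subst θ) (R.subst (lift (lift θ))) (A'.subst θ) (R'.subst (lift (lift θ)))
        (i.subst (lift θ)) := by
  simp [quotMap]

theorem cast_subst_lift (b : Bool) (A : PreExp n) (σ σ' : Fin n → PreExp m) (θ : Fin m → PreExp k) :
    (cast b A σ σ').subst (lift θ) = cast b A (σ ⊚ θ) (σ' ⊚ θ) := by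
  induction A generalizing m k b <;>
    simp only [cast, sigmaMap_subst, piMap_subst, sumMap_subst, listMap_subst, quotMap_subst,
      scons_comp, *] <;>
    simp

theorem cast_subst (b : Bool) (A : PreExp n) (σ σ' : Fin n → PreExp m) (a : PreExp k)
    (θ : Fin m → PreExp k) :
    (cast b A σ σ').subst (scons a θ) = (cast b A (σ ⊚ θ) (σ' ⊚ θ)).inst a := by
  rw [← cast_subst_lift]
  simp

theorem cast_inst_subst (b : Bool) (A : PreExp n) (σ σ' : Fin n → PreExp m) (a : PreExp m)
    (θ : Fin m → PreExp k) :
    ((cast b A σ σ').inst a).subst θ = (cast b A (σ ⊚ θ) (σ' ⊚ θ)).inst (a.subst θ) := by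
  rw [← cast_subst]
  simp

/-- The restriction to type-like expressions is necessary: the coercion at a variable is the
identity by default, but a substitution might replace the variable by a compound type. On the right,
θ acts on the side of the original type and its canonical form on the other side. -/
theorem cast_tr {A : PreExp n} (hA : A.TypeLike) (b : Bool) (θ : Fin n → PreExp m)
    (σ σ' : Fin m → PreExp k) :
    cast b (A.subst θ) σ σ' = cast b A (trS b θ ⊚ σ) (trS (!b) θ ⊚ σ') := by
  induction A generalizing m k b with
  | sigma A B ih₁ ih₂ => simp [cast, ih₁ hA.1, ih₂ hA.2]
  | pi A B ih₁ ih₂ => simp [cast, ih₁ hA.1, ih₂ hA.2]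
  | sum A B ih₁ ih₂ => simp [cast, ih₁ hA.1, ih₂ hA.2]
  | list A ih => simp [cast, ih hA]
  | quot A R ih _ => simp [cast, ih hA]
  | empty => rfl
  | unit => rfl
  | pow => rfl
  | _ =>
    first
      | exact hA.elim
      | (rw [IsProp.cast_eq (by trivial), IsProp.cast_eq (by trivial), tr_subst]; simp)

end PreExp

theorem Derivable.typeLike {T : Theory} {n : ℕ} {J : Judgement n} (h : Derivable T J) :
    match J with
    | .type _ _ A => A.TypeLike
    | _ => True := by
  induction h <;> dsimp only at * <;>
    first
      | trivial
      | exact ⟨‹_›, ‹_›⟩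
      | exact TypeLike.subst ‹_› _

/-- Either the context itself or its canonical form. -/
def Ctx.tr {n : ℕ} : Bool → Ctx n → Ctx n
  | false, Γ => Γ
  | true, Γ => Γ.canon

@[simp] theorem Ctx.tr_snoc {n : ℕ} (b : Bool) (Γ : Ctx n) (A : PreExp n) :
    (Γ ▹ A).tr b = Γ.tr b ▹ A.tr b := by
  cases b <;> rfl

theorem Ctx.get_tr {n : ℕ} (b : Bool) (Γ : Ctx n) (i : Fin n) :
    (Γ.tr b).get i = (Γ.get i).tr b := by
  cases b
  · rfl
  · exact Ctx.get_canon Γ i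

namespace Derivable

variable {T : Theory} [hT : T.Impredicative] {n : ℕ} {Γ : Ctx n} {A B a c : PreExp n} {k : Kind}

/-- In the case `true` this is the translation of the theory into itself. -/
theorem tr_type (h : Derivable T (type k Γ A)) (b : Bool) :
    Derivable T (type k (Γ.tr b) (A.tr b)) := by
  cases b
  · exact h
  · exact h.canon fun _ => .inr

theorem tr_typeEq (h : Derivable T (typeEq k Γ A B)) (b : Bool) :
    Derivable T (typeEq k (Γ.tr b) (A.tr b) (B.tr b)) := by
  cases b
  · exact h
  · exact h.canon fun _ => .inr

theorem tr_term (h : Derivable T (term Γ a A)) (b : Bool) :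
    Derivable T (term (Γ.tr b) (a.tr b) (A.tr b)) := by
  cases b
  · exact h
  · exact h.canon fun _ => .inr

theorem tr_termEq (h : Derivable T (termEq Γ a c A)) (b : Bool) :
    Derivable T (termEq (Γ.tr b) (a.tr b) (c.tr b) (A.tr b)) := by
  cases b
  · exact h
  · exact h.canon fun _ => .inr

end Derivable

/-! ### Coherence of coercions -/

section

variable {T : Theory}

/-- `σ` and `σ'` substitute for `Γ` and its canonical form, in an order determined by `b`, and
correspond to each other under the coercions. -/
structure CastRel (T : Theory) (b : Bool) {n m : ℕ} (Δ : Ctx m) (σ σ' : Fin n → PreExp m)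
    (Γ : Ctx n) : Prop where
  src : Sub T Δ σ (Γ.tr b)
  tgt : Sub T Δ σ' (Γ.tr (!b))
  hom : ∀ i, Derivable T (termEq Δ ((cast b (Γ.get i) σ σ').inst (σ i)) (σ' i)
    (((Γ.get i).tr (!b)).subst σ'))
  inv : ∀ i, Derivable T (termEq Δ ((cast (!b) (Γ.get i) σ' σ).inst (σ' i)) (σ i)
    (((Γ.get i).tr b).subst σ))

/-- Equality of corresponding substitutions. -/
structure CastRelEq (T : Theory) (b : Bool) {n m : ℕ} (Δ : Ctx m) (σ σ' τ τ' : Fin n → PreExp m)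
    (Γ : Ctx n) : Prop where
  left : CastRel T b Δ σ σ' Γ
  right : CastRel T b Δ τ τ' Γ
  src : SubEq T Δ σ τ (Γ.tr b)
  tgt : SubEq T Δ σ' τ' (Γ.tr (!b))

/-- The coercions of `A` are mutually inverse, and they agree with those of the equal type `B`. -/
structure TypeCoherent (T : Theory) {n : ℕ} (Γ : Ctx n) (A B : PreExp n) : Prop where
  eq : Derivable T (typeEq .col Γ A B)
  map : ∀ {b m} {Δ : Ctx m} {σ σ'}, CastRel T b Δ σ σ' Γ →
    IsMap T Δ ((A.tr b).subst σ) ((A.tr (!b)).subst σ') (cast b A σ σ')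
  inv : ∀ {b m} {Δ : Ctx m} {σ σ'}, CastRel T b Δ σ σ' Γ →
    Derivable T (termEq (Δ ▹ (A.tr b).subst σ) ((cast (!b) A σ' σ).subst (scons (cast b A σ σ') S))
      (.var 0) ((A.tr b).subst (σ ⊚ S)))
  congr : ∀ {b m} {Δ : Ctx m} {σ σ' τ τ'}, CastRelEq T b Δ σ σ' τ τ' Γ →
    Derivable T (termEq (Δ ▹ (A.tr b).subst σ) (cast b A σ σ') (cast b B τ τ')
      ((A.tr (!b)).subst (σ' ⊚ S)))

/-- The coercions of `A` carry `a` to its canonical form. -/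
structure TermCoherent (T : Theory) {n : ℕ} (Γ : Ctx n) (a A : PreExp n) : Prop where
  type : TypeCoherent T Γ A A
  term : Derivable T (.term Γ a A)
  cast : ∀ {b m} {Δ : Ctx m} {σ σ'}, CastRel T b Δ σ σ' Γ →
    Derivable T (termEq Δ ((cast b A σ σ').inst ((a.tr b).subst σ)) ((a.tr (!b)).subst σ')
      ((A.tr (!b)).subst σ'))

/-- Composition with `θ` preserves the correspondence of substitutions. -/
structure SubCoherent (T : Theory) {n m : ℕ} (Δ : Ctx m) (θ : Fin n → PreExp m) (Γ : Ctx n) :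
    Prop where
  sub : Sub T Δ θ Γ
  rel : ∀ {b k} {Ξ : Ctx k} {σ σ'}, CastRel T b Ξ σ σ' Δ →
    CastRel T b Ξ (trS b θ ⊚ σ) (trS (!b) θ ⊚ σ') Γ

variable [hT : T.Impredicative]

variable {n m l : ℕ} {b : Bool} {Γ : Ctx n} {Δ : Ctx m} {Ξ : Ctx l} {σ σ' τ τ' θ υ : Fin n → PreExp m}
  {A B C a c : PreExp n}

theorem Sub.tr (h : Sub T Δ θ Γ) (b : Bool) : Sub T (Δ.tr b) (trS b θ) (Γ.tr b) := by
  cases b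
  · exact h
  · refine ⟨(h.ctx.canon fun _ => .inr), fun i => ?_⟩
    have := (h.term i).tr_term true
    rw [Ctx.get_tr, ← tr_subst]
    exact this

theorem SubEq.tr (h : SubEq T Δ θ υ Γ) (b : Bool) :
    SubEq T (Δ.tr b) (trS b θ) (trS b υ) (Γ.tr b) := by
  refine ⟨h.left.tr b, h.right.tr b, fun i => ?_⟩
  have := (h.eq i).tr_termEq b
  rw [Ctx.get_tr, ← tr_subst]
  exact this

theorem Sub.comp_subEq {ρ υ : Fin m → PreExp l} (hθ : Sub T Δ θ Γ) (h : SubEq T Ξ ρ υ Δ) :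
    SubEq T Ξ (θ ⊚ ρ) (θ ⊚ υ) Γ :=
  ⟨hθ.comp h.left, hθ.comp h.right, fun i => by
    simpa [comp_apply] using (hθ.term i).subEq_term h⟩

theorem SubEq.trans (h : SubEq T Δ σ τ Γ) (h' : SubEq T Δ τ υ Γ) (hΓ : Derivable T (.ctx Γ)) :
    SubEq T Δ σ υ Γ :=
  ⟨h.left, h'.right, fun i => (h.eq i).termEq_trans ((h'.eq i).convEq
    ((Derivable.var i hΓ).presup.subEq_type h).typeEq_symm)⟩

theorem SubEq.symm (h : SubEq T Δ σ τ Γ) (hΓ : Derivable T (.ctx Γ)) : SubEq T Δ τ σ Γ :=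
  ⟨h.right, h.left, fun i => (h.eq i).termEq_symm.convEq
    ((Derivable.var i hΓ).presup.subEq_type h)⟩

theorem SubEq.comp {ρ ρ' : Fin m → PreExp l} (h : SubEq T Δ θ υ Γ) (hΓ : Derivable T (.ctx Γ))
    (h' : SubEq T Ξ ρ ρ' Δ) : SubEq T Ξ (θ ⊚ ρ) (υ ⊚ ρ') Γ :=
  (h.left.comp_subEq h').trans (h.comp_sub h'.right) hΓ

theorem Ctx.get_typeLike (h : Derivable T (.ctx Γ)) (i : Fin n) : (Γ.get i).TypeLike :=
  (Derivable.var i h).presup.typeLike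

namespace CastRel

theorem symm (h : CastRel T b Δ σ σ' Γ) : CastRel T (!b) Δ σ' σ Γ :=
  ⟨h.tgt, by simpa using h.src, by simpa using h.inv, by simpa using h.hom⟩

theorem comp {θ : Fin m → PreExp l} (h : CastRel T b Δ σ σ' Γ) (hθ : Sub T Ξ θ Δ) :
    CastRel T b Ξ (σ ⊚ θ) (σ' ⊚ θ) Γ := by
  refine ⟨h.src.comp hθ, h.tgt.comp hθ, fun i => ?_, fun i => ?_⟩
  · have := (h.hom i).sub_termEq hθ
    rw [cast_inst_subst] at this
    simpa [comp_apply] using this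
  · have := (h.inv i).sub_termEq hθ
    rw [cast_inst_subst] at this
    simpa [comp_apply] using this

theorem ctx (h : CastRel T b Δ σ σ' Γ) : Derivable T (.ctx Δ) := h.src.ctx

/-- Correspondence of the new values is required in one direction only; the other follows by
applying the inverse coercion. -/
theorem scons {a a' : PreExp m} (h : CastRel T b Δ σ σ' Γ) (hA : TypeCoherent T Γ A B)
    (ha : Derivable T (.term Δ a ((A.tr b).subst σ)))
    (e : Derivable T (termEq Δ ((PreExp.cast b A σ σ').inst a) a' ((A.tr (!b)).subst σ'))) :
    CastRel T b Δ (PreExp.scons a σ) (PreExp.scons a' σ') (Γ ▹ A) := by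
  have tA := hA.eq.type_left
  refine ⟨by simpa using h.src.scons ha, by simpa using h.tgt.scons e.right, fun i => ?_,
    fun i => ?_⟩
  · cases i using Fin.cases with
    | zero => simpa [Ctx.get_zero, cast_tr tA.typeLike] using e
    | succ i => simpa [Ctx.get_succ, cast_tr (Ctx.get_typeLike tA.ctx i)] using h.hom i
  · cases i using Fin.cases with
    | zero =>
      have e₁ := (hA.map h.symm).apply_congr (.id h.ctx) (by simpa using e.termEq_symm)
      have e₂ := (hA.inv h).sub_termEq (.inst ha)
      simp at e₁ e₂
      simpa [Ctx.get_zero, cast_tr tA.typeLike] using e₁.termEq_trans e₂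
    | succ i => simpa [Ctx.get_succ, cast_tr (Ctx.get_typeLike tA.ctx i)] using h.inv i

theorem tail {σ σ' : Fin (n + 1) → PreExp m} (h : CastRel T b Δ σ σ' (Γ ▹ A))
    (hA : Derivable T (.type .col Γ A)) : CastRel T b Δ (S ⊚ σ) (S ⊚ σ') Γ := by
  have hS := Sub.S hA
  have hl := fun i => Ctx.get_typeLike hA.ctx i
  refine ⟨by simpa using (hS.tr b).comp h.src, by simpa using (hS.tr (!b)).comp h.tgt,
    fun i => ?_, fun i => ?_⟩
  · simpa [Ctx.get_succ, cast_tr (hl i), comp_apply S, S_apply] using h.hom i.succ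
  · simpa [Ctx.get_succ, cast_tr (hl i), comp_apply S, S_apply] using h.inv i.succ

/-- How a correspondence passes under a covariant binder: the fresh variable belongs to the source.
The mirror image `colift`, with the fresh variable in the target, serves the contravariant binders Π
and ∀. -/
theorem lift (h : CastRel T b Δ σ σ' Γ) (hA : TypeCoherent T Γ A B) :
    CastRel T b (Δ ▹ (A.tr b).subst σ) (PreExp.scons (var 0) (σ ⊚ S))
      (PreExp.scons (PreExp.cast b A σ σ') (σ' ⊚ S)) (Γ ▹ A) := by
  have hm := hA.map h
  refine (h.comp (.S hm.dom)).scons hA (by simpa using hm.dom.var_zero) ?_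
  have := cast_subst b A σ σ' (var 0) S
  simp at this
  simpa [← this] using hm.term.termEq_refl

theorem colift (h : CastRel T b Δ σ σ' Γ) (hA : TypeCoherent T Γ A B) :
    CastRel T b (Δ ▹ (A.tr (!b)).subst σ') (PreExp.scons (PreExp.cast (!b) A σ' σ) (σ ⊚ S))
      (PreExp.scons (var 0) (σ' ⊚ S)) (Γ ▹ A) := by
  simpa using (h.symm.lift hA).symm

end CastRel

namespace CastRelEq

theorem refl (h : CastRel T b Δ σ σ' Γ) : CastRelEq T b Δ σ σ' σ σ' Γ :=
  ⟨h, h, .refl h.src, .refl h.tgt⟩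

theorem flip (h : CastRelEq T b Δ σ σ' τ τ' Γ) : CastRelEq T (!b) Δ σ' σ τ' τ Γ :=
  ⟨h.left.symm, h.right.symm, h.tgt, by simpa using h.src⟩

theorem symm (h : CastRelEq T b Δ σ σ' τ τ' Γ) (hΓ : Derivable T (.ctx Γ)) :
    CastRelEq T b Δ τ τ' σ σ' Γ := by
  have hc : ∀ b, Derivable T (.ctx (Γ.tr b)) := fun b => by simpa using ((Sub.id hΓ).tr b).ctx
  exact ⟨h.right, h.left, h.src.symm (hc _), h.tgt.symm (hc _)⟩

theorem comp {θ : Fin m → PreExp l} (h : CastRelEq T b Δ σ σ' τ τ' Γ) (hθ : Sub T Ξ θ Δ) :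
    CastRelEq T b Ξ (σ ⊚ θ) (σ' ⊚ θ) (τ ⊚ θ) (τ' ⊚ θ) Γ :=
  ⟨h.left.comp hθ, h.right.comp hθ, h.src.comp_sub hθ, h.tgt.comp_sub hθ⟩

end CastRelEq

namespace TypeCoherent

theorem iso (h : TypeCoherent T Γ A B) (hr : CastRel T b Δ σ σ' Γ) :
    IsIso T Δ ((A.tr b).subst σ) ((A.tr (!b)).subst σ') (PreExp.cast b A σ σ')
      (PreExp.cast (!b) A σ' σ) :=
  ⟨h.map hr, by simpa using h.map hr.symm, by simpa using h.inv hr, by simpa using h.inv hr.symm⟩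

theorem congr_apply {a c : PreExp m} (h : TypeCoherent T Γ A B)
    (hr : CastRelEq T b Δ σ σ' τ τ' Γ)
    (ha : Derivable T (termEq Δ a c ((A.tr b).subst σ))) :
    Derivable T (termEq Δ ((PreExp.cast b A σ σ').inst a) ((PreExp.cast b B τ τ').inst c)
      ((A.tr (!b)).subst σ')) := by
  simpa using (h.congr hr).inst_termEq ha

theorem typeEq_subst (h : TypeCoherent T Γ A B) (hr : CastRelEq T b Δ σ σ' τ τ' Γ) :
    Derivable T (typeEq .col Δ ((A.tr b).subst σ) ((B.tr b).subst τ)) :=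
  (h.eq.tr_typeEq b).subEq_typeEq (h.eq.type_right.tr_type b) hr.src

/-- The coercion of `A` at either pair of substitutions agrees with that of `B` at the second pair.
-/
theorem left (h : TypeCoherent T Γ A B) : TypeCoherent T Γ A A := by
  refine ⟨.typeEq_refl h.eq.type_left, h.map, h.inv, fun hr => ?_⟩
  have tA := h.eq.type_left
  have e₁ := (tA.tr_type _).subEq_type hr.src
  have e₂ := (tA.tr_type _).subEq_type hr.tgt
  have e₃ := (h.congr (.refl hr.right)).conv_termEq (Sub.swap e₁.typeEq_symm e₁.type_left)
  exact (h.congr hr).termEq_trans (e₃.termEq_symm.convEq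
    (by simpa using (e₂.sub_typeEq (.S e₁.type_left)).typeEq_symm))

/-- Typing and the inverse laws are recorded for the left type only. They pass to the right type
because its coercions equal those of the left one, after conversion of domain and codomain. -/
theorem symm (h : TypeCoherent T Γ A B) : TypeCoherent T Γ B A := by
  have tA := h.eq.type_left
  have tB := h.eq.type_right
  have hmap : ∀ {b m} {Δ : Ctx m} {σ σ'}, CastRel T b Δ σ σ' Γ →
      IsMap T Δ ((B.tr b).subst σ) ((B.tr (!b)).subst σ') (PreExp.cast b B σ σ') := by
    intro b m Δ σ σ' hr
    have e₁ := h.typeEq_subst (.refl hr)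
    have e₂ := h.typeEq_subst (.refl hr.symm)
    refine ⟨e₁.type_right, e₂.type_right, ?_⟩
    have := (h.congr (.refl hr)).right.conv_term (Sub.swap e₁ e₁.type_right)
    exact this.conv (by simpa using e₂.sub_typeEq (.S e₁.type_right))
  refine ⟨h.eq.typeEq_symm, hmap, fun {b m Δ σ σ'} hr => ?_, fun {b m Δ σ σ' τ τ'} hr => ?_⟩
  · have e₁ := h.typeEq_subst (.refl hr)
    have e₂ := h.typeEq_subst (.refl hr.symm)
    have f₁ := h.congr (.refl hr)
    have hS := Sub.S e₁.type_left
    have f₂ := h.congr_apply (.refl (hr.symm.comp hS)) (by simpa using f₁)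
    have f₃ := h.inv hr
    simp only [cast_subst] at f₃ ⊢
    have f₄ := f₂.termEq_symm.termEq_trans (by simpa using f₃)
    have f₅ := f₄.conv_termEq (Sub.swap e₁ e₁.type_right)
    exact f₅.convEq (by simpa using e₁.sub_typeEq (.S e₁.type_right))
  · have e := hr.symm tA.ctx
    have e₁ := h.typeEq_subst e
    have e₂ := h.typeEq_subst e.flip
    exact ((h.congr e).termEq_symm.conv_termEq (Sub.swap e₁ e₁.type_right)).convEq
      (by simpa using e₂.sub_typeEq (.S e₁.type_right))

theorem trans (h : TypeCoherent T Γ A B) (h' : TypeCoherent T Γ B C) : TypeCoherent T Γ A C := by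
  refine ⟨h.eq.typeEq_trans h'.eq, h.map, h.inv, fun hr => ?_⟩
  have e₁ := h.typeEq_subst (.refl hr.left)
  have e₂ := h.typeEq_subst (.refl hr.left.symm)
  refine (h.congr (.refl hr.left)).termEq_trans
    (((h'.congr hr).conv_termEq (Sub.swap e₁.typeEq_symm e₁.type_left)).convEq ?_)
  simpa using (e₂.sub_typeEq (.S e₁.type_left)).typeEq_symm

end TypeCoherent

namespace CastRelEq

theorem scons {a a' c c' : PreExp m} (h : CastRelEq T b Δ σ σ' τ τ' Γ)
    (hA : TypeCoherent T Γ A B) (ha : Derivable T (termEq Δ a c ((A.tr b).subst σ)))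
    (e : Derivable T (termEq Δ ((PreExp.cast b A σ σ').inst a) a' ((A.tr (!b)).subst σ')))
    (ha' : Derivable T (termEq Δ a' c' ((A.tr (!b)).subst σ'))) :
    CastRelEq T b Δ (PreExp.scons a σ) (PreExp.scons a' σ') (PreExp.scons c τ)
      (PreExp.scons c' τ') (Γ ▹ A) := by
  have e₁ := hA.left.typeEq_subst h
  have e₂ := hA.left.typeEq_subst h.flip
  refine ⟨h.left.scons hA ha.left e, h.right.scons hA (ha.right.conv e₁) ?_, ?_, ?_⟩
  · exact ((hA.left.congr_apply h ha).termEq_symm.termEq_trans (e.termEq_trans ha')).convEq e₂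
  · simpa using h.src.scons (hA.eq.type_left.tr_type b) ha.left ha.right ha
  · simpa using h.tgt.scons (hA.eq.type_left.tr_type (!b)) ha'.left ha'.right ha'

theorem lift (h : CastRelEq T b Δ σ σ' τ τ' Γ) (hA : TypeCoherent T Γ A B) :
    CastRelEq T b (Δ ▹ (A.tr b).subst σ) (PreExp.scons (var 0) (σ ⊚ S))
      (PreExp.scons (PreExp.cast b A σ σ') (σ' ⊚ S)) (PreExp.scons (var 0) (τ ⊚ S))
      (PreExp.scons (PreExp.cast b B τ τ') (τ' ⊚ S)) (Γ ▹ A) := by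
  have hm := hA.map h.left
  refine (h.comp (.S hm.dom)).scons hA (by simpa using hm.dom.var_zero.termEq_refl) ?_
    (hA.congr h)
  have := cast_subst b A σ σ' (var 0) S
  simp at this
  simpa [← this] using hm.term.termEq_refl

theorem colift (h : CastRelEq T b Δ σ σ' τ τ' Γ) (hA : TypeCoherent T Γ A B) :
    CastRelEq T b (Δ ▹ (A.tr (!b)).subst σ') (PreExp.scons (PreExp.cast (!b) A σ' σ) (σ ⊚ S))
      (PreExp.scons (var 0) (σ' ⊚ S)) (PreExp.scons (PreExp.cast (!b) B τ' τ) (τ ⊚ S))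
      (PreExp.scons (var 0) (τ' ⊚ S)) (Γ ▹ A) := by
  simpa using (h.flip.lift hA).flip

end CastRelEq

end

/-! ### Coherent substitutions and terms -/

section

variable {T : Theory} [hT : T.Impredicative]

variable {n m l : ℕ} {b : Bool} {Γ : Ctx n} {Δ : Ctx m} {Ξ : Ctx l} {θ υ : Fin n → PreExp m}
  {A A' B C D D' a c φ φ' ψ ψ' : PreExp n} {k : Kind} {s : Size}

namespace SubCoherent

theorem id (h : Derivable T (.ctx Γ)) : SubCoherent T Γ PreExp.var Γ :=
  ⟨.id h, fun hr => by simpa using hr⟩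

theorem S (h : Derivable T (.type k Γ A)) : SubCoherent T (Γ ▹ A) PreExp.S Γ :=
  ⟨.S h, fun hr => by simpa using hr.tail h.col⟩

theorem comp {ρ : Fin m → PreExp l} (h : SubCoherent T Δ θ Γ) (h' : SubCoherent T Ξ ρ Δ) :
    SubCoherent T Ξ (θ ⊚ ρ) Γ :=
  ⟨h.sub.comp h'.sub, fun hr => by simpa using h.rel (h'.rel hr)⟩

theorem scons {a : PreExp m} (h : SubCoherent T Δ θ Γ) (hA : TypeCoherent T Γ A B)
    (ha : TermCoherent T Δ a (A.subst θ)) : SubCoherent T Δ (PreExp.scons a θ) (Γ ▹ A) := by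
  refine ⟨h.sub.scons ha.term, fun {b k Ξ σ σ'} hr => ?_⟩
  have e := ha.cast hr
  rw [cast_tr hA.eq.type_left.typeLike] at e
  simpa using (h.rel hr).scons hA (by simpa using (ha.term.tr_term b).sub_term hr.src)
    (by simpa using e)

/-- The coercion at a substituted type is the coercion at the original type along composite
substitutions, so coherence of the components of θ is exactly the correspondence of these
composites. -/
theorem of_terms (h : Sub T Δ θ Γ) (hΓ : Derivable T (.ctx Γ))
    (ht : ∀ i, TermCoherent T Δ (θ i) ((Γ.get i).subst θ)) : SubCoherent T Δ θ Γ := by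
  refine ⟨h, fun {b k Ξ σ σ'} hr => ⟨(h.tr b).comp hr.src, (h.tr (!b)).comp hr.tgt,
    fun i => ?_, fun i => ?_⟩⟩
  · have := (ht i).cast hr
    rw [cast_tr (Ctx.get_typeLike hΓ i)] at this
    simpa [comp_apply, trS] using this
  · have := (ht i).cast hr.symm
    rw [cast_tr (Ctx.get_typeLike hΓ i)] at this
    simpa [comp_apply, trS] using this

theorem relEq {σ σ' τ τ' : Fin m → PreExp l} (hθ : SubCoherent T Δ θ Γ)
    (hυ : SubCoherent T Δ υ Γ) (h : SubEq T Δ θ υ Γ) (hΓ : Derivable T (.ctx Γ))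
    (hr : CastRelEq T b Ξ σ σ' τ τ' Δ) :
    CastRelEq T b Ξ (trS b θ ⊚ σ) (trS (!b) θ ⊚ σ') (trS b υ ⊚ τ) (trS (!b) υ ⊚ τ') Γ := by
  have hc : ∀ b, Derivable T (.ctx (Γ.tr b)) := fun b => ((Sub.id hΓ).tr b).ctx
  exact ⟨hθ.rel hr.left, hυ.rel hr.right, (h.tr b).comp (hc _) hr.src,
    (h.tr (!b)).comp (hc _) hr.tgt⟩

end SubCoherent

namespace TypeCoherent

/-- Coherence quantifies over all corresponding pairs of substitutions, so its closure under
substitution reduces to composing with θ or υ. -/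
theorem sub_eq (h : TypeCoherent T Γ A B) (hθ : SubCoherent T Δ θ Γ)
    (hυ : SubCoherent T Δ υ Γ) (he : SubEq T Δ θ υ Γ) :
    TypeCoherent T Δ (A.subst θ) (B.subst υ) := by
  have tA := h.eq.type_left
  have tB := h.eq.type_right
  refine ⟨h.eq.subEq_typeEq tB he, fun hr => ?_, fun hr => ?_, fun hr => ?_⟩
  · rw [cast_tr tA.typeLike]
    simpa using h.map (hθ.rel hr)
  · rw [cast_tr tA.typeLike, cast_tr tA.typeLike]
    simpa using h.inv (hθ.rel hr)
  · rw [cast_tr tA.typeLike, cast_tr tB.typeLike]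
    simpa using h.congr (hθ.relEq hυ he tA.ctx hr)

theorem sub (h : TypeCoherent T Γ A B) (hθ : SubCoherent T Δ θ Γ) :
    TypeCoherent T Δ (A.subst θ) (B.subst θ) := h.sub_eq hθ hθ (.refl hθ.sub)

end TypeCoherent

namespace TermCoherent

theorem sub (h : TermCoherent T Γ a A) (hθ : SubCoherent T Δ θ Γ) :
    TermCoherent T Δ (a.subst θ) (A.subst θ) := by
  refine ⟨h.type.sub hθ, h.term.sub_term hθ.sub, fun hr => ?_⟩
  rw [cast_tr h.type.eq.type_left.typeLike]
  simpa using h.cast (hθ.rel hr)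

/-- Coherence of a term depends only on the term up to judgemental equality. For this reason an
equality of terms needs to record coherence of one side only. -/
theorem of_eq (h : TermCoherent T Γ a A) (e : Derivable T (.termEq Γ a c A)) :
    TermCoherent T Γ c A := by
  refine ⟨h.type, e.right, fun {b _ _ _ _} hr => ?_⟩
  have e₁ := h.type.congr_apply (.refl hr) ((e.tr_termEq b).sub_termEq hr.src)
  have e₂ := (e.tr_termEq (!b)).sub_termEq hr.tgt
  exact e₁.termEq_symm.termEq_trans ((h.cast hr).termEq_trans e₂)

theorem conv (h : TermCoherent T Γ a A) (hA : TypeCoherent T Γ A B) : TermCoherent T Γ a B := by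
  refine ⟨hA.symm.left, h.term.conv hA.eq, fun {b _ _ _ _} hr => ?_⟩
  have e₁ := hA.congr_apply (.refl hr) (((h.term.tr_term b).sub_term hr.src).termEq_refl)
  exact (e₁.termEq_symm.termEq_trans (h.cast hr)).convEq (hA.typeEq_subst (.refl hr.symm))

theorem inst (h : TermCoherent T Γ a A) : SubCoherent T Γ (PreExp.scons a var) (Γ ▹ A) :=
  (SubCoherent.id h.term.ctx).scons h.type (by simpa using h)

end TermCoherent

/-! ### Coherence of propositions -/

namespace TypeCoherent

/-- Proof-irrelevance makes every equation between coercions of propositions automatic, so only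
their existence is at stake. As `b` ranges over both values, the single hypothesis contains both
entailments. -/
theorem of_entails (h : Derivable T (.typeEq .prop Γ φ ψ))
    (he : ∀ {b m} {Δ : Ctx m} {σ σ'}, CastRel T b Δ σ σ' Γ →
      Derivable T (.holds Δ ((φ.tr b).subst σ)) → Derivable T (.holds Δ ((φ.tr (!b)).subst σ'))) :
    TypeCoherent T Γ φ ψ := by
  have tφ := h.type_left
  have pφ : φ.IsProp := tφ.shape
  have pψ : ψ.IsProp := h.type_right.shape
  have hmap : ∀ {b m} {Δ : Ctx m} {σ σ'}, CastRel T b Δ σ σ' Γ →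
      IsMap T Δ ((φ.tr b).subst σ) ((φ.tr (!b)).subst σ') (PreExp.cast b φ σ σ') := by
    intro b m Δ σ σ' hr
    have t₁ := (tφ.tr_type b).sub_type hr.src
    refine ⟨t₁.col, ((tφ.tr_type (!b)).sub_type hr.tgt).col, ?_⟩
    have := he (hr.comp (.S t₁)) (by simpa using t₁.hyp)
    simpa [pφ.cast_eq] using this
  refine ⟨h.eq_col, hmap, fun {b m Δ σ σ'} hr => ?_, fun {b m Δ σ σ' τ τ'} hr => ?_⟩
  · have t₁ := (tφ.tr_type b).sub_type hr.src
    have := (hmap hr.symm).apply (.S t₁) (hmap hr).term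
    exact .prop_mono (by simpa using t₁.sub_type (.S t₁)) (by simpa using this)
      (by simpa using t₁.var_zero)
  · have t₁ := (tφ.tr_type b).sub_type hr.left.src
    have t₂ := (tφ.tr_type (!b)).sub_type hr.left.tgt
    have e := (h.tr_typeEq (!b)).subEq_typeEq (h.type_right.tr_type (!b)) hr.tgt
    have h₁ := (hmap hr.left).term
    have h₂ := ((Derivable.prop_true (t₂.sub_type (.S t₁)) h₁).holds_conv
      (by simpa using e.sub_typeEq (.S t₁))).conv (by simpa using (e.sub_typeEq (.S t₁)).eq_col.typeEq_symm)
    refine .prop_mono (by simpa using t₂.sub_type (.S t₁)) (by simpa using h₁) ?_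
    simpa [pψ.cast_eq] using h₂

theorem entails {σ σ' : Fin n → PreExp m} (h : TypeCoherent T Γ φ ψ)
    (hφ : Derivable T (.type (.proposition s) Γ φ)) (hr : CastRel T b Δ σ σ' Γ)
    (h' : Derivable T (.holds Δ ((φ.tr b).subst σ))) :
    Derivable T (.holds Δ ((φ.tr (!b)).subst σ')) :=
  .prop_true ((hφ.prop.tr_type _).sub_type hr.tgt) ((h.map hr).app h')

theorem tr_iff {σ σ' : Fin n → PreExp m} (h : TypeCoherent T Γ φ ψ)
    (hφ : Derivable T (.type (.proposition s) Γ φ)) (hr : CastRel T b Δ σ σ' Γ) :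
    Derivable T (.holds Δ (iff ((φ.tr b).subst σ) ((φ.tr (!b)).subst σ'))) := by
  have t₁ := (hφ.prop.tr_type b).sub_type hr.src
  have t₂ := (hφ.prop.tr_type (!b)).sub_type hr.tgt
  refine .iff_intro t₁ t₂ ?_ ?_
  · simpa using h.entails hφ (hr.comp (.S t₁)) (by simpa using t₁.hyp)
  · simpa using h.entails hφ (hr.comp (.S t₂)).symm (by simpa using t₂.hyp)

end TypeCoherent

theorem TermCoherent.of_prop (hφ : Derivable T (.type (.proposition s) Γ φ))
    (h : TypeCoherent T Γ φ ψ) (ha : Derivable T (.term Γ a φ)) : TermCoherent T Γ a φ :=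
  ⟨h.left, ha, fun {b _ _ _ _} hr => .prop_mono ((hφ.prop.tr_type _).sub_type hr.tgt)
    ((h.map hr).app ((ha.tr_term b).sub_term hr.src)) ((ha.tr_term _).sub_term hr.tgt)⟩

namespace Derivable

variable {χ ω : PreExp n}

/-- Either version of a compound proposition is the bare connective or its representative, with the
same truth. This allows each connective to be treated once, uniformly in `b`. -/
theorem holds_iff_of_collapse (hω : Derivable T (type (.proposition s) Γ ω))
    (h : χ = ω ∨ χ = collapse ω) : Derivable T (holds Γ χ) ↔ Derivable T (holds Γ ω) := by
  rcases h with rfl | rfl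
  · rfl
  · exact ⟨hω.collapse_elim, hω.collapse_intro⟩

end Derivable

namespace PreExp

variable (b : Bool) (σ : Fin n → PreExp m) (φ ψ : PreExp n) (χ : PreExp (n + 1))

theorem tr_bot_subst :
    (bot.tr b).subst σ = bot ∨ (bot.tr b).subst σ = collapse bot := by
  cases b <;> simp [tr, canon]

theorem tr_and_subst :
    ((and φ ψ).tr b).subst σ = and ((φ.tr b).subst σ) ((ψ.tr b).subst σ) ∨
      ((and φ ψ).tr b).subst σ = collapse (and ((φ.tr b).subst σ) ((ψ.tr b).subst σ)) := by
  cases b <;> simp [tr, canon]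

theorem tr_or_subst :
    ((or φ ψ).tr b).subst σ = or ((φ.tr b).subst σ) ((ψ.tr b).subst σ) ∨
      ((or φ ψ).tr b).subst σ = collapse (or ((φ.tr b).subst σ) ((ψ.tr b).subst σ)) := by
  cases b <;> simp [tr, canon]

theorem tr_imp_subst :
    ((imp φ ψ).tr b).subst σ = imp ((φ.tr b).subst σ) ((ψ.tr b).subst σ) ∨
      ((imp φ ψ).tr b).subst σ = collapse (imp ((φ.tr b).subst σ) ((ψ.tr b).subst σ)) := by
  cases b <;> simp [tr, canon]

theorem tr_ex_subst :
    ((ex φ χ).tr b).subst σ = ex ((φ.tr b).subst σ) ((χ.tr b).subst (lift σ)) ∨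
      ((ex φ χ).tr b).subst σ = collapse (ex ((φ.tr b).subst σ) ((χ.tr b).subst (lift σ))) := by
  cases b <;> simp [tr, canon]

theorem tr_all_subst :
    ((all φ χ).tr b).subst σ = all ((φ.tr b).subst σ) ((χ.tr b).subst (lift σ)) ∨
      ((all φ χ).tr b).subst σ = collapse (all ((φ.tr b).subst σ) ((χ.tr b).subst (lift σ))) := by
  cases b <;> simp [tr, canon]

theorem tr_eq_subst (a : PreExp n) :
    ((eq φ ψ a).tr b).subst σ = eq ((φ.tr b).subst σ) ((ψ.tr b).subst σ) ((a.tr b).subst σ) ∨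
      ((eq φ ψ a).tr b).subst σ =
        collapse (eq ((φ.tr b).subst σ) ((ψ.tr b).subst σ) ((a.tr b).subst σ)) := by
  cases b <;> simp [tr, canon]

end PreExp

namespace TypeCoherent

open Derivable

theorem bot (hΓ : Derivable T (.ctx Γ)) : TypeCoherent T Γ bot bot :=
  of_entails (.typeEq_refl (bot_type hΓ)) fun hr h =>
    have t := bot_type (s := .large) hr.ctx
    (holds_iff_of_collapse t (tr_bot_subst _ _)).2 ((holds_iff_of_collapse t (tr_bot_subst _ _)).1 h)

theorem and (hφ : TypeCoherent T Γ φ φ') (hψ : TypeCoherent T Γ ψ ψ')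
    (tφ : Derivable T (.typeEq (.proposition s) Γ φ φ'))
    (tψ : Derivable T (.typeEq (.proposition s) Γ ψ ψ')) :
    TypeCoherent T Γ (and φ ψ) (and φ' ψ') := by
  refine of_entails (Derivable.and_form_eq tφ tψ).eq_prop fun {b _ _ _ _} hr h => ?_
  have p₁ := (tφ.type_left.prop.tr_type b).sub_type hr.src
  have p₂ := (tψ.type_left.prop.tr_type b).sub_type hr.src
  have q₁ := (tφ.type_left.prop.tr_type (!b)).sub_type hr.tgt
  have q₂ := (tψ.type_left.prop.tr_type (!b)).sub_type hr.tgt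
  rw [holds_iff_of_collapse (.and_form p₁ p₂) (tr_and_subst _ _ _ _)] at h
  rw [holds_iff_of_collapse (.and_form q₁ q₂) (tr_and_subst _ _ _ _)]
  exact .and_intro q₁ q₂ (hφ.entails tφ.type_left hr (.and_left p₁ p₂ h))
    (hψ.entails tψ.type_left hr (.and_right p₁ p₂ h))

theorem or (hφ : TypeCoherent T Γ φ φ') (hψ : TypeCoherent T Γ ψ ψ')
    (tφ : Derivable T (.typeEq (.proposition s) Γ φ φ'))
    (tψ : Derivable T (.typeEq (.proposition s) Γ ψ ψ')) :
    TypeCoherent T Γ (or φ ψ) (or φ' ψ') := by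
  refine of_entails (Derivable.or_form_eq tφ tψ).eq_prop fun {b _ _ _ _} hr h => ?_
  have p₁ := (tφ.type_left.prop.tr_type b).sub_type hr.src
  have p₂ := (tψ.type_left.prop.tr_type b).sub_type hr.src
  have q₁ := (tφ.type_left.prop.tr_type (!b)).sub_type hr.tgt
  have q₂ := (tψ.type_left.prop.tr_type (!b)).sub_type hr.tgt
  rw [holds_iff_of_collapse (.or_form p₁ p₂) (tr_or_subst _ _ _ _)] at h
  rw [holds_iff_of_collapse (.or_form q₁ q₂) (tr_or_subst _ _ _ _)]
  refine .or_elim p₁ p₂ (.or_form q₁ q₂) h ?_ ?_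
  · simpa using Derivable.or_inl (q₁.wk_type p₁) (q₂.wk_type p₁)
      (by simpa using hφ.entails tφ.type_left (hr.comp (.S p₁)) (by simpa using p₁.hyp))
  · simpa using Derivable.or_inr (q₁.wk_type p₂) (q₂.wk_type p₂)
      (by simpa using hψ.entails tψ.type_left (hr.comp (.S p₂)) (by simpa using p₂.hyp))

theorem imp (hφ : TypeCoherent T Γ φ φ') (hψ : TypeCoherent T Γ ψ ψ')
    (tφ : Derivable T (.typeEq (.proposition s) Γ φ φ'))
    (tψ : Derivable T (.typeEq (.proposition s) Γ ψ ψ')) :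
    TypeCoherent T Γ (imp φ ψ) (imp φ' ψ') := by
  refine of_entails (Derivable.imp_form_eq tφ tψ).eq_prop fun {b _ _ _ _} hr h => ?_
  have p₁ := (tφ.type_left.prop.tr_type b).sub_type hr.src
  have p₂ := (tψ.type_left.prop.tr_type b).sub_type hr.src
  have q₁ := (tφ.type_left.prop.tr_type (!b)).sub_type hr.tgt
  have q₂ := (tψ.type_left.prop.tr_type (!b)).sub_type hr.tgt
  rw [holds_iff_of_collapse (.imp_form p₁ p₂) (tr_imp_subst _ _ _ _)] at h
  rw [holds_iff_of_collapse (.imp_form q₁ q₂) (tr_imp_subst _ _ _ _)]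
  refine .imp_intro q₁ q₂ ?_
  have hr' := hr.comp (.S q₁)
  -- The antecedent is carried backwards, along the reversed correspondence.
  have h₁ := hφ.entails tφ.type_left hr'.symm (by simpa using q₁.hyp)
  have h₂ := Derivable.imp_elim (p₁.wk_type q₁) (p₂.wk_type q₁) (h.wk_holds q₁)
    (by simpa using h₁)
  simpa using hψ.entails tψ.type_left hr' (by simpa using h₂)

variable {χ χ' : PreExp (n + 1)}

theorem ex (hA : TypeCoherent T Γ A A') (hχ : TypeCoherent T (Γ ▹ A) χ χ')
    (tχ : Derivable T (.typeEq (.proposition s) (Γ ▹ A) χ χ')) :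
    TypeCoherent T Γ (ex A χ) (ex A' χ') := by
  refine of_entails (Derivable.ex_form_eq (s := .large) hA.eq tχ.eq_prop)
    fun {b _ _ _ _} hr h => ?_
  have t := hA.eq.type_left
  have p₁ := (t.tr_type b).sub_type hr.src
  have q₁ := (t.tr_type (!b)).sub_type hr.tgt
  have p₂ := (tχ.type_left.prop.tr_type b).sub_type (by simpa using hr.src.lift (t.tr_type b))
  have q₂ := (tχ.type_left.prop.tr_type (!b)).sub_type
    (by simpa using hr.tgt.lift (t.tr_type (!b)))
  rw [← lift_eq] at p₂ q₂
  rw [holds_iff_of_collapse (.ex_form (s := .large) p₁ p₂) (tr_ex_subst _ _ _ _)] at h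
  rw [holds_iff_of_collapse (.ex_form (s := .large) q₁ q₂) (tr_ex_subst _ _ _ _)]
  have tE := Derivable.ex_form (s := .large) q₁ q₂
  refine .ex_elim p₂ tE h ?_
  have hr' := (hr.lift hA).comp (.S p₂)
  have h₁ := hχ.entails tχ.type_left hr' (by simpa using p₂.hyp)
  -- The new witness is the coercion of the given one.
  have hi := (hA.map hr).term.sub_term (.S p₂)
  have hS := Sub.S₂ p₂
  have := Derivable.ex_intro (q₂.sub_type (hS.lift q₁)) (by simpa using hi) (by simpa using h₁)
  simpa using this

theorem all (hA : TypeCoherent T Γ A A') (hχ : TypeCoherent T (Γ ▹ A) χ χ')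
    (tχ : Derivable T (.typeEq (.proposition s) (Γ ▹ A) χ χ')) :
    TypeCoherent T Γ (all A χ) (all A' χ') := by
  refine of_entails (Derivable.all_form_eq (s := .large) hA.eq tχ.eq_prop)
    fun {b _ _ _ _} hr h => ?_
  have t := hA.eq.type_left
  have p₁ := (t.tr_type b).sub_type hr.src
  have q₁ := (t.tr_type (!b)).sub_type hr.tgt
  have p₂ := (tχ.type_left.prop.tr_type b).sub_type (by simpa using hr.src.lift (t.tr_type b))
  have q₂ := (tχ.type_left.prop.tr_type (!b)).sub_type
    (by simpa using hr.tgt.lift (t.tr_type (!b)))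
  rw [← lift_eq] at p₂ q₂
  rw [holds_iff_of_collapse (.all_form (s := .large) p₁ p₂) (tr_all_subst _ _ _ _)] at h
  rw [holds_iff_of_collapse (.all_form (s := .large) q₁ q₂) (tr_all_subst _ _ _ _)]
  refine .all_intro q₂ ?_
  have hS := Sub.S q₁
  have hj := (hA.map hr.symm).term
  -- The given statement is instantiated at the backward coercion of the variable.
  have h₁ := Derivable.all_elim (p₂.sub_type (hS.lift p₁)) (by simpa using h.wk_holds q₁)
    (by simpa using hj)
  simpa using hχ.entails tχ.type_left (hr.colift hA) (by simpa using h₁)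

/-- By reflection the equality on one side is judgemental, so the coercion of `A` may be applied to
it; coherence of the two terms identifies the results with their other versions. This is where
propositions depend on the coherence of terms. -/
theorem eq_prop {a' c' : PreExp n} (hA : TypeCoherent T Γ A A') (ha : TermCoherent T Γ a A)
    (hc : TermCoherent T Γ c A) (ea : Derivable T (.termEq Γ a a' A))
    (ec : Derivable T (.termEq Γ c c' A)) : TypeCoherent T Γ (PreExp.eq A a c) (.eq A' a' c') := by
  refine of_entails (Derivable.eq_form_eq (s := .large) hA.eq ea ec) fun {b _ _ _ _} hr h => ?_
  have t := hA.eq.type_left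
  have p₁ := (t.tr_type b).sub_type hr.src
  have q₁ := (t.tr_type (!b)).sub_type hr.tgt
  have p₂ := (ha.term.tr_term b).sub_term hr.src
  have q₂ := (ha.term.tr_term (!b)).sub_term hr.tgt
  have p₃ := (hc.term.tr_term b).sub_term hr.src
  have q₃ := (hc.term.tr_term (!b)).sub_term hr.tgt
  rw [holds_iff_of_collapse (.eq_form (s := .large) p₁ p₂ p₃) (tr_eq_subst _ _ _ _ _)] at h
  rw [holds_iff_of_collapse (.eq_form (s := .large) q₁ q₂ q₃) (tr_eq_subst _ _ _ _ _)]
  have e := hA.left.congr_apply (.refl hr) (.eq_reflection p₁ p₂ p₃ h)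
  exact ((ha.cast hr).termEq_symm.termEq_trans (e.termEq_trans (hc.cast hr))).holds_eq

end TypeCoherent

end

section

variable {T : Theory} [hT : T.Impredicative]

variable {n m l : ℕ} {b : Bool} {Γ : Ctx n} {Δ : Ctx m} {Ξ : Ctx l} {σ σ' : Fin n → PreExp m}
  {A A' C D D' a c : PreExp n} {B B' : PreExp (n + 1)} {R R' : PreExp (n + 2)} {k : Kind} {s : Size}

/-! ### Coherence of type constructors -/

namespace TypeCoherent

theorem tr_lift_type (hA : TypeCoherent T Γ A A') (hB : TypeCoherent T (Γ ▹ A) B B')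
    (hr : CastRel T b Δ σ σ' Γ) :
    Derivable T (.type .col (Δ ▹ (A.tr b).subst σ) ((B.tr b).subst (lift σ))) := by
  have t := hA.eq.type_left.tr_type b
  exact (hB.eq.type_left.tr_type b).sub_type (by simpa using hr.src.lift t)

theorem fibreMap (hA : TypeCoherent T Γ A A') (hB : TypeCoherent T (Γ ▹ A) B B')
    (hr : CastRel T b Δ σ σ' Γ) :
    IsFibreMap T Δ ((A.tr b).subst σ) ((B.tr b).subst (lift σ)) ((A.tr (!b)).subst σ')
      ((B.tr (!b)).subst (lift σ')) (PreExp.cast b A σ σ')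
      (PreExp.cast b B (lift σ) (scons (PreExp.cast b A σ σ') (σ' ⊚ S))) :=
  ⟨hA.map hr, tr_lift_type hA hB hr, tr_lift_type hA hB hr.symm,
    by simpa using (hB.map (hr.lift hA)).term⟩

theorem cofibreMap (hA : TypeCoherent T Γ A A') (hB : TypeCoherent T (Γ ▹ A) B B')
    (hr : CastRel T b Δ σ σ' Γ) :
    IsCofibreMap T Δ ((A.tr b).subst σ) ((B.tr b).subst (lift σ)) ((A.tr (!b)).subst σ')
      ((B.tr (!b)).subst (lift σ')) (PreExp.cast (!b) A σ' σ)
      (PreExp.cast b B (scons (PreExp.cast (!b) A σ' σ) (σ ⊚ S)) (lift σ')) :=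
  ⟨by simpa using hA.map hr.symm, tr_lift_type hA hB hr, tr_lift_type hA hB hr.symm,
    by simpa using (hB.map (hr.colift hA)).term⟩

/-- Over the total context, the variable of type `A` corresponds to its image. -/
theorem relEq_roundtrip (hA : TypeCoherent T Γ A A') (hB : TypeCoherent T (Γ ▹ A) B B')
    (hr : CastRel T b Δ σ σ' Γ) :
    CastRelEq T b (Δ ▹ (A.tr b).subst σ ▹ (B.tr b).subst (lift σ))
      (scons ((PreExp.cast (!b) A (σ' ⊚ S ⊚ S) (σ ⊚ S ⊚ S)).inst ((PreExp.cast b A σ σ').subst S))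
        (σ ⊚ S ⊚ S))
      (scons ((PreExp.cast b A σ σ').subst S) (σ' ⊚ S ⊚ S))
      (scons (.var 1) (σ ⊚ S ⊚ S))
      (scons ((PreExp.cast b A σ σ').subst S) (σ' ⊚ S ⊚ S)) (Γ ▹ A) := by
  have tB := tr_lift_type hA hB hr
  have hr₂ := hr.comp (Sub.S₂ tB)
  have hi := (hA.map hr).term.sub_term (.S tB)
  have h₁ := (hA.map hr₂.symm).app (a := (PreExp.cast b A σ σ').subst S) (by simpa using hi)
  have e := (hA.inv hr).sub_termEq (.S tB)
  have := (CastRelEq.refl hr₂.symm).scons hA (.termEq_refl (by simpa using hi)) h₁.termEq_refl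
    (c' := .var 1) (by
      rw [subst_subst, scons_comp, cast_subst] at e
      simpa using e)
  simpa using this.flip

theorem sigma (hA : TypeCoherent T Γ A A') (hB : TypeCoherent T (Γ ▹ A) B B') :
    TypeCoherent T Γ (sigma A B) (.sigma A' B') := by
  refine ⟨Derivable.sigma_form_eq hA.eq hB.eq, fun hr => ?_, fun {b m Δ σ σ'} hr => ?_,
    fun {b m Δ σ σ' τ τ'} hr => ?_⟩
  · simpa [PreExp.cast] using (fibreMap hA hB hr).sigmaMap
  · have h := fibreMap hA hB hr
    have h' := fibreMap hA hB hr.symm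
    simp only [Bool.not_not] at h'
    have := h.sigmaMap_inv h' (hA.iso hr) ?_
    · simpa [PreExp.cast] using this
    · have e₁ := hB.left.congr_apply (relEq_roundtrip hA hB hr).flip
        (by simpa using h.term.termEq_refl)
      have e₂ := hB.inv (hr.lift hA)
      rw [cast_subst] at e₂ ⊢
      have e₃ := cast_subst (!b) A σ' σ ((PreExp.cast b A σ σ').subst S) (S ⊚ S)
      have e₄ := hB.left.typeEq_subst (relEq_roundtrip hA hB hr)
      have e₅ := e₁.convEq (by simpa using e₄)
      simp at e₂ e₃ e₅
      simpa [e₃] using e₅.termEq_trans (by simpa using e₂)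
  · have := (fibreMap hA hB hr.left).sigmaMap_congr (hA.typeEq_subst hr)
      (by simpa using hB.typeEq_subst (hr.lift hA)) (hA.typeEq_subst hr.flip)
      (by simpa using hB.typeEq_subst (hr.flip.lift hA)) (by simpa using hA.congr hr)
      (by simpa using hB.congr (hr.lift hA))
    simpa [PreExp.cast] using this

theorem pi (hA : TypeCoherent T Γ A A') (hB : TypeCoherent T (Γ ▹ A) B B') :
    TypeCoherent T Γ (pi A B) (.pi A' B') := by
  refine ⟨(Derivable.pi_form_eq (hA.eq.eq_collection _) (hB.eq.eq_collection _)).eq_col,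
    fun hr => ?_, fun {b m Δ σ σ'} hr => ?_, fun {b m Δ σ σ' τ τ'} hr => ?_⟩
  · simpa [PreExp.cast] using (cofibreMap hA hB hr).piMap
  · have h := cofibreMap hA hB hr
    have h' := cofibreMap hA hB hr.symm
    simp only [Bool.not_not] at h'
    have := h.piMap_inv h' (hA.iso hr) ?_
    · simpa [PreExp.cast] using this
    · have tB := tr_lift_type hA hB hr
      -- As for Σ, the fibre over the round trip of x has to be replaced by the fibre over x.
      have e₀ := hB.left.typeEq_subst (relEq_roundtrip hA hB hr)
      have hv := tB.var_zero.conv (by simpa using e₀.typeEq_symm)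
      have e₁ := hB.left.congr_apply (relEq_roundtrip hA hB hr) hv.termEq_refl
      have e₂ := (hB.map (hr.lift hA).symm).apply_congr (.S tB) (by simpa using e₁)
      have e₃ := hB.inv (hr.lift hA)
      have e₄ := cast_subst (!b) A σ' σ ((PreExp.cast b A σ σ').subst S) (S ⊚ S)
      have e₅ := cast_subst b B (scons (.var 0) (σ ⊚ S))
        (scons (PreExp.cast b A σ σ') (σ' ⊚ S)) (.var 0) S
      simp at e₂ e₃ e₄ e₅
      simp only [← e₅] at e₂
      rw [cast_subst b B]
      simpa [e₄] using e₂.termEq_trans (by simpa using e₃)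
  · have := (cofibreMap hA hB hr.left).piMap_congr (hA.typeEq_subst hr)
      (by simpa using hB.typeEq_subst (hr.lift hA)) (hA.typeEq_subst hr.flip)
      (by simpa using hB.typeEq_subst (hr.flip.lift hA)) (by simpa using hA.congr hr.flip)
      (by simpa using hB.congr (hr.colift hA))
    simpa [PreExp.cast] using this

end TypeCoherent

end

section

variable {T : Theory} [hT : T.Impredicative]

variable {n m l : ℕ} {b : Bool} {Γ : Ctx n} {Δ : Ctx m} {Ξ : Ctx l} {σ σ' τ τ' : Fin n → PreExp m}
  {A A' B B' C D D' a c : PreExp n} {R R' : PreExp (n + 2)} {k : Kind} {s : Size}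

namespace TypeCoherent

theorem sum (hA : TypeCoherent T Γ A A') (hB : TypeCoherent T Γ B B') :
    TypeCoherent T Γ (sum A B) (.sum A' B') := by
  refine ⟨(Derivable.sum_form_eq (hA.eq.eq_collection _) (hB.eq.eq_collection _)).eq_col,
    fun hr => ?_, fun {b m Δ σ σ'} hr => ?_, fun {b m Δ σ σ' τ τ'} hr => ?_⟩
  · simpa [PreExp.cast] using (hA.map hr).sumMap (hB.map hr)
  · simpa [PreExp.cast] using (hA.iso hr).sumMap_inv (hB.iso hr)
  · have := IsMap.sumMap_congr (hA.typeEq_subst hr) (hA.typeEq_subst hr.flip)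
      (hB.typeEq_subst hr) (hB.typeEq_subst hr.flip) (by simpa using hA.congr hr)
      (by simpa using hB.congr hr)
    simpa [PreExp.cast] using this

theorem list (hA : TypeCoherent T Γ A A') : TypeCoherent T Γ (list A) (.list A') := by
  refine ⟨(Derivable.list_form_eq (hA.eq.eq_collection _)).eq_col,
    fun hr => ?_, fun {b m Δ σ σ'} hr => ?_, fun {b m Δ σ σ' τ τ'} hr => ?_⟩
  · simpa [PreExp.cast] using (hA.map hr).listMap
  · simpa [PreExp.cast] using (hA.iso hr).listMap_inv
  · have := (hA.map hr.left).listMap_congr (hA.typeEq_subst hr) (hA.typeEq_subst hr.flip)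
      (by simpa using hA.congr hr)
    simpa [PreExp.cast] using this

theorem relEq_pair {x y x' y' : PreExp m} (hA : TypeCoherent T Γ A A')
    (hr : CastRelEq T b Δ σ σ' τ τ' Γ)
    (hx : Derivable T (termEq Δ x x' ((A.tr b).subst σ)))
    (hy : Derivable T (termEq Δ y y' ((A.tr b).subst σ))) :
    CastRelEq T b Δ (scons y (scons x σ))
      (scons ((PreExp.cast b A σ σ').inst y) (scons ((PreExp.cast b A σ σ').inst x) σ'))
      (scons y' (scons x' τ))
      (scons ((PreExp.cast b A τ τ').inst y') (scons ((PreExp.cast b A τ τ').inst x') τ'))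
      (Γ ▹ A ▹ A.wk) := by
  have tA := hA.eq.type_left
  have hl := tA.typeLike
  have e₁ := hA.left.congr_apply hr hx
  have e₂ := hA.left.congr_apply hr hy
  have h₁ := hr.scons hA hx e₁.left.termEq_refl e₁
  have hA' := hA.left.sub (SubCoherent.S tA)
  have := h₁.scons hA' (by simpa using hy)
    (by
      rw [cast_tr hl]
      simpa using e₂.left.termEq_refl) (by simpa using e₂)
  simpa using this

/-- That the coercion of `A` respects the relations is the entailment contained in coherence of `R`,
read at two generic representatives and their coercions. -/
theorem isQuotMap (hA : TypeCoherent T Γ A A') (hR : TypeCoherent T (Γ ▹ A ▹ A.wk) R R')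
    (tQ : Derivable T (type .set Γ (quot A R))) (hr : CastRel T b Δ σ σ' Γ) :
    IsQuotMap T Δ ((A.tr b).subst σ) ((R.tr b).subst (lift (lift σ))) ((A.tr (!b)).subst σ')
      ((R.tr (!b)).subst (lift (lift σ'))) (PreExp.cast b A σ σ') := by
  have t₁ := (tQ.tr_type b).sub_type hr.src
  have t₂ := (tQ.tr_type (!b)).sub_type hr.tgt
  rw [tr_quot] at t₁ t₂
  refine ⟨hA.map hr, t₁, t₂, ?_⟩
  have tR := t₁.quot_right
  have hr₃ := hr.comp (Sub.S₃ tR)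
  have h := (relEq_pair hA (.refl hr₃) (x := .var 2) (y := .var 1)
    (.termEq_refl (by simpa using tR.var_two)) (.termEq_refl (by simpa using tR.var_one))).left
  have := hR.entails tQ.quot_right h (by simpa using tR.prop.hyp)
  rw [cast_subst, cast_subst]
  simpa using this

theorem quot (hA : TypeCoherent T Γ A A') (hR : TypeCoherent T (Γ ▹ A ▹ A.wk) R R')
    (tQ : Derivable T (type .set Γ (quot A R))) (tQ' : Derivable T (type .set Γ (.quot A' R')))
    (eR : Derivable T (typeEq .props (Γ ▹ A ▹ A.wk) R R')) :
    TypeCoherent T Γ (.quot A R) (.quot A' R') := by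
  refine ⟨(Derivable.quot_form_eq tQ tQ' (hA.eq.eq_collection _) eR).eq_col,
    fun hr => ?_, fun {b m Δ σ σ'} hr => ?_, fun {b m Δ σ σ' τ τ'} hr => ?_⟩
  · simpa [PreExp.cast] using (isQuotMap hA hR tQ hr).quotMap
  · have h := isQuotMap hA hR tQ hr
    have h' := isQuotMap hA hR tQ hr.symm
    simp only [Bool.not_not] at h'
    simpa [PreExp.cast] using h.quotMap_inv h' (hA.iso hr)
  · have hE : ∀ {b m} {Δ : Ctx m} {σ σ' τ τ'}, CastRelEq T b Δ σ σ' τ τ' Γ → Derivable T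
        (typeEq .props (Δ ▹ (A.tr b).subst σ ▹ ((A.tr b).subst σ).wk)
          ((R.tr b).subst (lift (lift σ))) ((R'.tr b).subst (lift (lift τ)))) := by
      intro b m Δ σ σ' τ τ' hr
      have tA := (hA.eq.type_left.tr_type b).sub_type hr.left.src
      have tA₂ := tA.wk_type tA
      have h := (relEq_pair hA (hr.comp (Sub.S₂ tA₂)) (x := .var 1) (y := .var 0)
        (.termEq_refl (by simpa using tA₂.var_one))
        (.termEq_refl (by simpa using tA₂.var_zero))).src
      simpa using (eR.tr_typeEq b).subEq_typeEq (eR.type_right.tr_type b) h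
    have u := (tQ'.tr_type b).sub_type hr.right.src
    have u' := (tQ'.tr_type (!b)).sub_type hr.right.tgt
    rw [tr_quot] at u u'
    have := (isQuotMap hA hR tQ hr.left).quotMap_congr u u' (hA.typeEq_subst hr)
      (hA.typeEq_subst hr.flip) (hE hr) (hE hr.flip) (by simpa using hA.congr hr)
    simpa [PreExp.cast] using this

theorem empty (hΓ : Derivable T (.ctx Γ)) : TypeCoherent T Γ empty .empty := by
  have t := fun {m} {Δ : Ctx m} (h : Derivable T (.ctx Δ)) => (Derivable.empty_form h).col
  refine ⟨.typeEq_refl (t hΓ), fun hr => ⟨by simpa using t hr.ctx, by simpa using t hr.ctx, ?_⟩, fun hr => ?_, fun hr => ?_⟩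
  · simpa [PreExp.cast] using (t hr.ctx).var_zero
  · simpa [PreExp.cast] using (t hr.ctx).var_zero.termEq_refl
  · simpa [PreExp.cast] using (t hr.left.ctx).var_zero.termEq_refl

theorem unit (hΓ : Derivable T (.ctx Γ)) : TypeCoherent T Γ unit .unit := by
  have t := fun {m} {Δ : Ctx m} (h : Derivable T (.ctx Δ)) => (Derivable.unit_form h).col
  refine ⟨.typeEq_refl (t hΓ), fun hr => ⟨by simpa using t hr.ctx, by simpa using t hr.ctx, ?_⟩, fun hr => ?_, fun hr => ?_⟩
  · simpa [PreExp.cast] using (t hr.ctx).var_zero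
  · simpa [PreExp.cast] using (t hr.ctx).var_zero.termEq_refl
  · simpa [PreExp.cast] using (t hr.left.ctx).var_zero.termEq_refl

theorem pow (hΓ : Derivable T (.ctx Γ)) : TypeCoherent T Γ pow .pow := by
  have t := fun {m} {Δ : Ctx m} (h : Derivable T (.ctx Δ)) => Derivable.pow_form h
  refine ⟨.typeEq_refl (t hΓ), fun hr => ⟨by simpa using t hr.ctx, by simpa using t hr.ctx, ?_⟩, fun hr => ?_, fun hr => ?_⟩
  · simpa [PreExp.cast] using (t hr.ctx).var_zero
  · simpa [PreExp.cast] using (t hr.ctx).var_zero.termEq_refl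
  · simpa [PreExp.cast] using (t hr.left.ctx).var_zero.termEq_refl

end TypeCoherent

end

namespace PreExp

variable {n m k : ℕ} (b : Bool) (A : PreExp n) (σ σ' : Fin n → PreExp m)

-- A directed form of `cast_subst`. It fires only when the tail of the substitution is itself an
-- extension, and so does not apply to its own result.
@[simp] theorem cast_subst_scons {m : ℕ} (σ σ' : Fin n → PreExp (m + 1)) (a : PreExp k)
    (y : PreExp k) (θ : Fin m → PreExp k) :
    (cast b A σ σ').subst (scons a (scons y θ)) =
      (cast b A (σ ⊚ scons y θ) (σ' ⊚ scons y θ)).subst (scons a var) := cast_subst ..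

theorem cast_inst {A : PreExp (n + 1)} (hA : A.TypeLike) (a : PreExp n) :
    cast b (A.inst a) σ σ' =
      cast b A (scons ((a.tr b).subst σ) σ) (scons ((a.tr (!b)).subst σ') σ') := by
  simpa [inst] using cast_tr hA b (scons a var) σ σ'

end PreExp

section

variable {T : Theory} [hT : T.Impredicative]

variable {n m l : ℕ} {b : Bool} {Γ : Ctx n} {Δ : Ctx m} {Ξ : Ctx l} {σ σ' τ τ' : Fin n → PreExp m}
  {A A' C D D' a c d f φ : PreExp n} {B B' M e i j : PreExp (n + 1)} {R R' k' : PreExp (n + 2)}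
  {k : Kind} {s : Size} {θ : Fin n → PreExp m}

open Derivable in
theorem IsFibreMap.sigmaMap_pair (h : IsFibreMap T Γ A B A' B' i k') (hθ : Sub T Δ θ Γ)
    {a c : PreExp m} (ha : Derivable T (.term Δ a (A.subst θ)))
    (hc : Derivable T (.term Δ c (B.subst (scons a θ)))) :
    Derivable T (termEq Δ
      ((PreExp.sigmaMap A B A' B' i k').subst
        (scons (pair (A.subst θ) (B.subst (PreExp.lift θ)) a c) θ))
      (pair (A'.subst θ) (B'.subst (PreExp.lift θ)) (i.subst (scons a θ))
        (k'.subst (scons c (scons a θ)))) ((sigma A' B').subst θ)) := by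
  have tB := h.dom.sub_type (hθ.lift h.dom.head_type)
  have tB' := h.cod.sub_type (hθ.lift h.cod.head_type)
  have hc' := hc.term_cast rfl (A' := (B.subst (PreExp.lift θ)).inst a) (by simp)
  have e₁ := fst_beta ha tB hc'
  have e₂ := snd_beta ha tB hc'
  have eB := (h.dom.sub_type (hθ.lift h.dom.head_type)).inst_congr e₁
  have e₂' := e₂.convEq eB.typeEq_symm
  have es := ((SubEq.refl hθ).scons h.dom.head_type e₁.left e₁.right e₁).scons h.dom
    (by simpa using e₂'.left) (by simpa using e₂'.right) (by simpa using e₂')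
  have f₁ := h.base.apply_congr hθ e₁
  have f₂ := h.term.subEq_term es
  have := sigma_intro_eq (.typeEq_refl tB'.head_type) (.typeEq_refl tB') f₁
    (by simpa using f₂)
  simpa [PreExp.sigmaMap] using this

/-! ### Coherence of term constructors -/

namespace TermCoherent

theorem star (hΓ : Derivable T (.ctx Γ)) : TermCoherent T Γ star unit :=
  ⟨.unit hΓ, .unit_intro hΓ, fun hr => by
    simpa [PreExp.cast] using (Derivable.unit_intro hr.ctx).termEq_refl⟩

theorem code (hφ : Derivable T (.type (.proposition s) Γ φ)) (h : TypeCoherent T Γ φ φ) :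
    TermCoherent T Γ (code φ) pow :=
  ⟨.pow hφ.ctx, hφ.code_term, fun {b _ _ _ _} hr => by
    have := Derivable.code_congr ((hφ.prop.tr_type b).sub_type hr.src)
      ((hφ.prop.tr_type (!b)).sub_type hr.tgt) (h.tr_iff hφ hr)
    simpa [PreExp.cast] using this⟩

theorem pair (hA : TypeCoherent T Γ A A) (hB : TypeCoherent T (Γ ▹ A) B B)
    (ha : TermCoherent T Γ a A) (hc : TermCoherent T Γ c (B.inst a)) :
    TermCoherent T Γ (pair A B a c) (sigma A B) := by
  refine ⟨.sigma hA hB, .sigma_intro hA.eq.type_left hB.eq.type_left ha.term hc.term,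
    fun {b m Δ σ σ'} hr => ?_⟩
  have pa := (ha.term.tr_term b).sub_term hr.src
  have pc := (hc.term.tr_term b).sub_term hr.src
  have e₁ := (hA.fibreMap hB hr).sigmaMap_pair (.id hr.ctx) (by simpa using pa)
    (by simpa using pc)
  have ea := ha.cast hr
  have q := (CastRelEq.refl hr).scons hA pa.termEq_refl ea.left.termEq_refl ea
  have e₂ := hB.congr_apply q (by simpa using pc.termEq_refl)
  have e₃ := hc.cast hr
  rw [cast_inst _ _ _ hB.eq.type_left.typeLike] at e₃
  have tB := hA.tr_lift_type hB hr.symm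
  have eB := tB.inst_congr ea
  simp at e₂ e₃ eB
  have e₄ := e₂.termEq_trans (e₃.convEq eB.typeEq_symm)
  have e₅ := Derivable.sigma_intro_eq (.typeEq_refl tB.head_type) (.typeEq_refl tB) ea
    (by simpa using e₄)
  simp at e₁ e₅
  simpa [PreExp.cast] using e₁.termEq_trans e₅

/-- Both functions are evaluated at the variable of the target. The coerced one β-reduces to the
coercion of the body at the backward-coerced variable, and there coherence of the body applies. -/
theorem lam (hA : TypeCoherent T Γ A A) (hf : TermCoherent T (Γ ▹ A) e B) :
    TermCoherent T Γ (lam A B e) (pi A B) := by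
  have hB := hf.type
  have tP := hA.pi hB
  have hl := Derivable.pi_intro tP.eq.type_left hf.term
  refine ⟨tP, hl, fun {b m Δ σ σ'} hr => ?_⟩
  have h := hA.cofibreMap hB hr
  have pl := (hl.tr_term b).sub_term hr.src
  have ql := (hl.tr_term (!b)).sub_term hr.tgt
  have tA' := h.base.dom
  have tA := h.base.cod
  have tB := h.dom
  have hS := Sub.S tA'
  have hF := h.piMap.app (a := PreExp.lam ((A.tr b).subst σ) ((B.tr b).subst (PreExp.lift σ))
    ((e.tr b).subst (PreExp.lift σ))) (by simpa using pl)
  have := Derivable.pi_ext (f := (PreExp.cast b (.pi A B) σ σ').inst (((PreExp.lam A B e).tr b).subst σ))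
    (g := ((PreExp.lam A B e).tr (!b)).subst σ') (A := (A.tr (!b)).subst σ')
    (B := (B.tr (!b)).subst (PreExp.lift σ')) (by simpa [PreExp.cast] using hF) (by simpa using ql) ?_
  · simpa using this
  · have pe := (hf.term.tr_term b).sub_term (by simpa using hr.src.lift (hA.eq.type_left.tr_type b))
    have qe := (hf.term.tr_term (!b)).sub_term
      (by simpa using hr.tgt.lift (hA.eq.type_left.tr_type (!b)))
    have hj := h.base.term
    have e₁ := h.app_piMap hS (by simpa using pl.sub_term hS) (a := .var 0) tA'.var_zero
    have e₂ := Derivable.pi_beta (tB.sub_type (hS.lift tA)).pi_type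
      (by simpa using pe.sub_term (hS.lift tA)) hj
    have hrl := hr.colift hA
    have e₃ := hB.congr_apply (.refl hrl) (by simpa using e₂)
    have e₄ := hf.cast hrl
    have e₅ := Derivable.pi_beta (h.cod.sub_type (hS.lift tA')).pi_type
      (by simpa using qe.sub_term (hS.lift tA')) tA'.var_zero
    simp at e₁ e₃ e₄ e₅
    simpa [PreExp.cast] using e₁.termEq_trans (e₃.termEq_trans (e₄.termEq_trans e₅.termEq_symm))

/-- The coerced function at the target version of `a` is, by definition of the coercion on Π, the
coerced value of the source function at the backward coercion of that argument, which is the source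
version of `a`. -/
theorem app (hA : TypeCoherent T Γ A A) (hB : TypeCoherent T (Γ ▹ A) B B)
    (hf : TermCoherent T Γ f (pi A B)) (ha : TermCoherent T Γ a A) :
    TermCoherent T Γ (app A B f a) (B.inst a) := by
  refine ⟨hB.sub ha.inst, .pi_elim hB.eq.type_left hf.term ha.term, fun {b m Δ σ σ'} hr => ?_⟩
  rw [cast_inst _ _ _ hB.eq.type_left.typeLike]
  have h := hA.cofibreMap hB hr
  have pf := (hf.term.tr_term b).sub_term hr.src
  have pa := (ha.term.tr_term b).sub_term hr.src
  have qa := (ha.term.tr_term (!b)).sub_term hr.tgt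
  have e₁ := h.app_piMap (.id hr.ctx) (by simpa using pf) (by simpa using qa)
  have e₂ := Derivable.app_congr (.typeEq_refl h.base.dom) (.typeEq_refl h.cod)
    (by simpa using hf.cast hr) qa.termEq_refl
  have ea := ha.cast hr.symm
  simp only [Bool.not_not] at ea
  have q := ((CastRelEq.refl hr.symm).scons hA qa.termEq_refl
    (by simpa using ea.left.termEq_refl) (by simpa using ea)).flip
  have e₃ := Derivable.app_congr (.typeEq_refl h.base.cod) (.typeEq_refl h.dom)
    (by simpa using pf.termEq_refl) ea
  have e₄ := hB.congr_apply q (by simpa using e₃)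
  simp [PreExp.cast] at e₁ e₂ e₄
  simpa using e₄.termEq_symm.termEq_trans (e₁.termEq_symm.termEq_trans e₂)

theorem inl (hA : TypeCoherent T Γ A A) (hC : TypeCoherent T Γ C C) (ha : TermCoherent T Γ a A) :
    TermCoherent T Γ (inl A C a) (sum A C) := by
  refine ⟨.sum hA hC, .sum_inl (hA.eq.type_left.collection _) (hC.eq.type_left.collection _) ha.term,
    fun {b m Δ σ σ'} hr => ?_⟩
  have pa := (ha.term.tr_term b).sub_term hr.src
  have e₁ := (hA.map hr).sumMap_inl (hC.map hr) (.id hr.ctx) (by simpa using pa)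
  have e₂ := Derivable.sum_inl_eq (.typeEq_refl ((hA.map hr).cod.collection _))
    (.typeEq_refl ((hC.map hr).cod.collection _)) (ha.cast hr)
  simp at e₁ e₂
  simpa [PreExp.cast] using e₁.termEq_trans e₂

theorem inr (hA : TypeCoherent T Γ A A) (hC : TypeCoherent T Γ C C) (ha : TermCoherent T Γ a C) :
    TermCoherent T Γ (inr A C a) (sum A C) := by
  refine ⟨.sum hA hC, .sum_inr (hA.eq.type_left.collection _) (hC.eq.type_left.collection _) ha.term,
    fun {b m Δ σ σ'} hr => ?_⟩
  have pa := (ha.term.tr_term b).sub_term hr.src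
  have e₁ := (hA.map hr).sumMap_inr (hC.map hr) (.id hr.ctx) (by simpa using pa)
  have e₂ := Derivable.sum_inr_eq (.typeEq_refl ((hA.map hr).cod.collection _))
    (.typeEq_refl ((hC.map hr).cod.collection _)) (ha.cast hr)
  simp at e₁ e₂
  simpa [PreExp.cast] using e₁.termEq_trans e₂

theorem nil (hA : TypeCoherent T Γ A A) : TermCoherent T Γ (nil A) (list A) := by
  refine ⟨.list hA, .list_nil (hA.eq.type_left.collection _), fun {b m Δ σ σ'} hr => ?_⟩
  have e₁ := (hA.map hr).listMap_nil (.id hr.ctx)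
  simpa [PreExp.cast] using e₁

theorem cons (hA : TypeCoherent T Γ A A) (hc : TermCoherent T Γ c (list A))
    (ha : TermCoherent T Γ a A) : TermCoherent T Γ (cons A c a) (list A) := by
  refine ⟨.list hA, .list_cons (hA.eq.type_left.collection _) hc.term ha.term,
    fun {b m Δ σ σ'} hr => ?_⟩
  have pa := (ha.term.tr_term b).sub_term hr.src
  have pc := (hc.term.tr_term b).sub_term hr.src
  have e₁ := (hA.map hr).listMap_cons (.id hr.ctx) (by simpa using pc) (by simpa using pa)
  have e₂ := Derivable.list_cons_eq (.typeEq_refl ((hA.map hr).cod.collection _))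
    (by simpa using hc.cast hr) (ha.cast hr)
  simp [PreExp.cast] at e₁ e₂
  simpa [PreExp.cast] using e₁.termEq_trans e₂

theorem cls (hA : TypeCoherent T Γ A A) (hR : TypeCoherent T (Γ ▹ A ▹ A.wk) R R)
    (tQ : Derivable T (.type .set Γ (quot A R))) (ha : TermCoherent T Γ a A) :
    TermCoherent T Γ (cls A R a) (quot A R) := by
  refine ⟨.quot hA hR tQ tQ (.typeEq_refl tQ.quot_right), .quot_intro tQ ha.term,
    fun {b m Δ σ σ'} hr => ?_⟩
  have h := hA.isQuotMap hR tQ hr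
  have pa := (ha.term.tr_term b).sub_term hr.src
  have e₁ := h.quotMap_cls (.id hr.ctx) (by simpa using pa)
  have e₂ := Derivable.quot_intro_eq h.cod h.cod (.typeEq_refl h.cod.quot_left)
    (.typeEq_refl h.cod.quot_right) (ha.cast hr)
  simp at e₁ e₂
  simpa [PreExp.cast] using e₁.termEq_trans e₂

end TermCoherent

end

/-! ### Comparison of eliminators and coercions at a generic element -/

namespace PreExp

variable {n m k : ℕ}

/-- The value of `e` at `a`, coerced along `M`. -/
def castVal (b : Bool) (X : PreExp n) (M e : PreExp (n + 1)) (σ σ' : Fin n → PreExp m)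
    (a : PreExp m) : PreExp m :=
  (cast b M (scons a σ) (scons ((cast b X σ σ').inst a) σ')).inst ((e.tr b).subst (scons a σ))

/-- The value of `e` at the coercion of `a`. -/
def valCast (b : Bool) (X : PreExp n) (e : PreExp (n + 1)) (σ σ' : Fin n → PreExp m)
    (a : PreExp m) : PreExp m :=
  (e.tr (!b)).subst (scons ((cast b X σ σ').inst a) σ')

variable (b : Bool) (X : PreExp n) (M e : PreExp (n + 1)) (σ σ' : Fin n → PreExp m)
  (a : PreExp m) (θ : Fin m → PreExp k)

@[simp] theorem castVal_subst : (castVal b X M e σ σ' a).subst θ =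
    castVal b X M e (σ ⊚ θ) (σ' ⊚ θ) (a.subst θ) := by
  simp only [castVal, cast_inst_subst, scons_comp, subst_subst]

@[simp] theorem valCast_subst : (valCast b X e σ σ' a).subst θ =
    valCast b X e (σ ⊚ θ) (σ' ⊚ θ) (a.subst θ) := by
  simp only [valCast, cast_inst_subst, scons_comp, subst_subst]

end PreExp

section

variable {T : Theory} [hT : T.Impredicative]

variable {n m l : ℕ} {b : Bool} {Γ : Ctx n} {Δ : Ctx m} {Ξ : Ctx l} {σ σ' : Fin n → PreExp m}
  {X A C d : PreExp n} {M e B : PreExp (n + 1)} {R : PreExp (n + 2)}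

/-- Evaluating `e` at `a` commutes with the coercions. -/
abbrev Commutes (T : Theory) (b : Bool) {n m : ℕ} (Δ : Ctx m) (X : PreExp n) (M e : PreExp (n + 1))
    (σ σ' : Fin n → PreExp m) (a : PreExp m) : Prop :=
  Derivable T (termEq Δ (castVal b X M e σ σ' a) (valCast b X e σ σ' a) (valCast b X M σ σ' a))

theorem CastRel.val {a : PreExp m} (hr : CastRel T b Δ σ σ' Γ) (hX : TypeCoherent T Γ X X)
    (ha : Derivable T (.term Δ a ((X.tr b).subst σ))) :
    CastRel T b Δ (PreExp.scons a σ) (PreExp.scons ((PreExp.cast b X σ σ').inst a) σ') (Γ ▹ X) :=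
  hr.scons hX ha ((hX.map hr).app ha).termEq_refl

theorem CastRel.castVal {a : PreExp m} (hr : CastRel T b Δ σ σ' Γ) (hX : TypeCoherent T Γ X X)
    (hM : TypeCoherent T (Γ ▹ X) M M) (he : Derivable T (.term (Γ ▹ X) e M))
    (ha : Derivable T (.term Δ a ((X.tr b).subst σ))) :
    Derivable T (.term Δ (castVal b X M e σ σ' a) (valCast b X M σ σ' a)) :=
  (hM.map (hr.val hX ha)).app ((he.tr_term b).sub_term (hr.val hX ha).src)

theorem CastRel.valCast {a : PreExp m} (hr : CastRel T b Δ σ σ' Γ) (hX : TypeCoherent T Γ X X)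
    (he : Derivable T (.term (Γ ▹ X) e M))
    (ha : Derivable T (.term Δ a ((X.tr b).subst σ))) :
    Derivable T (.term Δ (valCast b X e σ σ' a) (valCast b X M σ σ' a)) :=
  (he.tr_term (!b)).sub_term (hr.val hX ha).tgt

theorem CastRel.relEq_val {a a' : PreExp m} (hr : CastRel T b Δ σ σ' Γ) (hX : TypeCoherent T Γ X X)
    (e : Derivable T (termEq Δ ((PreExp.cast b X σ σ').inst a) a' ((X.tr (!b)).subst σ')))
    (ha : Derivable T (.term Δ a ((X.tr b).subst σ))) :
    CastRelEq T b Δ (PreExp.scons a σ) (PreExp.scons ((PreExp.cast b X σ σ').inst a) σ')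
      (PreExp.scons a σ) (PreExp.scons a' σ') (Γ ▹ X) :=
  (CastRelEq.refl hr).scons hX ha.termEq_refl e.left.termEq_refl e

/-- The coerced argument may be replaced by any term equal to it. In applications this is the
constructor form, at which the eliminator computes. -/
theorem Commutes.of_cast {a a' : PreExp m} (hr : CastRel T b Δ σ σ' Γ) (hX : TypeCoherent T Γ X X)
    (hM : TypeCoherent T (Γ ▹ X) M M) (he : Derivable T (.term (Γ ▹ X) e M))
    (ha : Derivable T (.term Δ a ((X.tr b).subst σ)))
    (ea : Derivable T (termEq Δ ((PreExp.cast b X σ σ').inst a) a' ((X.tr (!b)).subst σ')))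
    (h : Derivable T (termEq Δ
      ((PreExp.cast b M (scons a σ) (scons a' σ')).inst ((e.tr b).subst (scons a σ)))
      ((e.tr (!b)).subst (scons a' σ')) ((M.tr (!b)).subst (scons a' σ')))) :
    Commutes T b Δ X M e σ σ' a := by
  have q := hr.relEq_val hX ea ha
  have e₁ := hM.congr_apply q ((he.tr_term b).sub_term (hr.val hX ha).src).termEq_refl
  have e₂ := (he.tr_term (!b)).subEq_term q.tgt
  have t := (hM.eq.type_left.tr_type (!b)).subEq_type q.tgt
  exact e₁.termEq_trans ((h.convEq t.typeEq_symm).termEq_trans e₂.termEq_symm)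

theorem Commutes.cast {a a' : PreExp m} (hr : CastRel T b Δ σ σ' Γ) (hX : TypeCoherent T Γ X X)
    (hM : TypeCoherent T (Γ ▹ X) M M) (he : Derivable T (.term (Γ ▹ X) e M))
    (ha : Derivable T (.term Δ a ((X.tr b).subst σ)))
    (ea : Derivable T (termEq Δ ((PreExp.cast b X σ σ').inst a) a' ((X.tr (!b)).subst σ')))
    (h : Commutes T b Δ X M e σ σ' a) :
    Derivable T (termEq Δ
      ((PreExp.cast b M (scons a σ) (scons a' σ')).inst ((e.tr b).subst (scons a σ)))
      ((e.tr (!b)).subst (scons a' σ')) ((M.tr (!b)).subst (scons a' σ'))) := by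
  have q := hr.relEq_val hX ea ha
  have e₁ := hM.congr_apply q ((he.tr_term b).sub_term (hr.val hX ha).src).termEq_refl
  have e₂ := (he.tr_term (!b)).subEq_term q.tgt
  have t := (hM.eq.type_left.tr_type (!b)).subEq_type q.tgt
  exact (e₁.termEq_symm.termEq_trans (h.termEq_trans e₂)).convEq t

/-- To evaluate a generic element, it suffices to do so in a context over which it is coherent. -/
theorem TermCoherent.commutes {Θ : Ctx m} {κ : Fin n → PreExp m} {ρ ρ' : Fin m → PreExp l}
    {c c' : PreExp m} (hX : TypeCoherent T Γ X X) (hM : TypeCoherent T (Γ ▹ X) M M)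
    (he : Derivable T (.term (Γ ▹ X) e M)) (hκ : SubCoherent T Θ κ Γ)
    (hc : TermCoherent T Θ c (X.subst κ))
    (hc' : TermCoherent T Θ c' (M.subst (PreExp.scons c κ)))
    (ec : Derivable T (termEq Θ (e.subst (PreExp.scons c κ)) c' (M.subst (PreExp.scons c κ))))
    (hr : CastRel T b Ξ ρ ρ' Θ) :
    Commutes T b Ξ X M e (trS b κ ⊚ ρ) (trS (!b) κ ⊚ ρ') ((c.tr b).subst ρ) := by
  have h := (hc'.of_eq ec.termEq_symm).cast hr
  have ea := hc.cast hr
  rw [cast_tr hM.eq.type_left.typeLike] at h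
  rw [cast_tr hX.eq.type_left.typeLike] at ea
  exact .of_cast (a' := (c.tr (!b)).subst ρ') (hκ.rel hr) hX hM he
    (by simpa using (hc.term.tr_term b).sub_term hr.src) (by simpa using ea) (by simpa using h)

/-- Coherence at a particular `d` is deduced from an equation between two families over X at
arbitrary elements. In this generality the equation can be proved by extensionality over X. -/
theorem TermCoherent.of_commutes (hX : TypeCoherent T Γ X X) (hM : TypeCoherent T (Γ ▹ X) M M)
    (he : Derivable T (.term (Γ ▹ X) e M)) (hd : TermCoherent T Γ d X)
    (h : ∀ {b m} {Δ : Ctx m} {σ σ' : Fin n → PreExp m} {a : PreExp m}, CastRel T b Δ σ σ' Γ →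
      Derivable T (.term Δ a ((X.tr b).subst σ)) → Commutes T b Δ X M e σ σ' a) :
    TermCoherent T Γ (e.inst d) (M.inst d) := by
  refine ⟨hM.sub hd.inst, he.inst_term hd.term, fun {b m Δ σ σ'} hr => ?_⟩
  have ha := (hd.term.tr_term b).sub_term hr.src
  rw [cast_inst _ _ _ hM.eq.type_left.typeLike]
  simpa [PreExp.inst] using (h hr ha).cast hr hX hM he ha (hd.cast hr)

theorem TermCoherent.var (i : Fin n) (hi : TypeCoherent T Γ (Γ.get i) (Γ.get i)) :
    TermCoherent T Γ (.var i) (Γ.get i) :=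
  ⟨hi, .var i hi.eq.type_left.ctx, fun hr => by simpa using hr.hom i⟩

theorem TermCoherent.var_zero (hA : TypeCoherent T Γ A A) :
    TermCoherent T (Γ ▹ A) (.var 0) (A.subst PreExp.S) := by
  simpa [Ctx.get_zero] using TermCoherent.var (Γ := Γ ▹ A) 0
    (by simpa [Ctx.get_zero] using hA.sub (.S hA.eq.type_left))

/-! ### Coherence of eliminators -/

namespace TermCoherent

open Derivable

/-- The pattern common to all eliminators: `e` is the eliminator applied to the generic element, and
the extensionality principle of its domain reduces the required equation to constructors. There the
computation rule, coherence of the constructor and coherence of the branch suffice. For N₀ no case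
remains. -/
theorem elEmpty (hM : TypeCoherent T (Γ ▹ .empty) M M) (hd : TermCoherent T Γ d .empty) :
    TermCoherent T Γ (elEmpty M d) (M.inst d) := by
  have tX := hM.eq.type_left.head_type
  have hX := TypeCoherent.empty tX.ctx
  have he := Derivable.empty_elim (hM.eq.type_left.sub_type ((Sub.S tX).lift tX)) tX.var_zero
  replace he : Derivable T (.term (Γ ▹ .empty) (PreExp.elEmpty (M.subst (lift PreExp.S)) (.var 0)) M) := by
    simpa using he
  have := of_commutes hX hM he hd fun {b m Δ σ σ' a} hr ha => ?_
  · simpa using this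
  · have t := (hX.map hr).dom
    have hr' := hr.comp (.S t)
    have h0 := t.var_zero.term_cast rfl (A' := ((PreExp.empty.tr b).subst (σ ⊚ PreExp.S)))
      (by simp)
    simp only [tr_empty, PreExp.subst] at t ha
    have := empty_ext (Γ := Δ) (d := a) (by simpa using hr'.castVal hX hM he h0)
      (by simpa using hr'.valCast hX he h0) ha
    simpa using this

theorem elUnit {c : PreExp n} (hM : TypeCoherent T (Γ ▹ .unit) M M) (hd : TermCoherent T Γ d .unit)
    (hc : TermCoherent T Γ c (M.inst .star)) :
    TermCoherent T Γ (elUnit M d c) (M.inst d) := by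
  have tX := hM.eq.type_left.head_type
  have hX := TypeCoherent.unit tX.ctx
  have he := Derivable.unit_elim (hM.eq.type_left.sub_type ((Sub.S tX).lift tX)) tX.var_zero
    (c := c.subst PreExp.S) (by simpa using hc.term.sub_term (.S tX))
  replace he : Derivable T (.term (Γ ▹ .unit)
      (PreExp.elUnit (M.subst (lift PreExp.S)) (.var 0) (c.subst PreExp.S)) M) := by
    simpa using he
  have := of_commutes hX hM he hd fun {b m Δ σ σ' a} hr ha => ?_
  · simpa using this
  · have t := (hX.map hr).dom
    have hr' := hr.comp (.S t)
    have h0 := t.var_zero.term_cast rfl (A' := ((PreExp.unit.tr b).subst (σ ⊚ PreExp.S)))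
      (by simp)
    simp only [tr_unit, PreExp.subst] at t ha
    have h₁ := commutes hX hM he (.id tX.ctx) (c := .star) (c' := c)
      (by simpa using TermCoherent.star tX.ctx) (by simpa [PreExp.inst] using hc)
      (by simpa [PreExp.inst] using Derivable.unit_beta hM.eq.type_left hc.term) hr
    have := unit_ext (Γ := Δ) (d := a) (by simpa using hr'.castVal hX hM he h0)
      (by simpa using hr'.valCast hX he h0) (by simpa using h₁) ha
    simpa using this

theorem elSum {f g : PreExp (n + 1)} (hA : TypeCoherent T Γ A A) (hC : TypeCoherent T Γ C C)
    (hM : TypeCoherent T (Γ ▹ .sum A C) M M) (hd : TermCoherent T Γ d (.sum A C))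
    (hf : TermCoherent T (Γ ▹ A) f (M.instAt 1 (.inl A.wk C.wk (.var 0))))
    (hg : TermCoherent T (Γ ▹ C) g (M.instAt 1 (.inr A.wk C.wk (.var 0)))) :
    TermCoherent T Γ (elSum A C M d f g) (M.inst d) := by
  have tX := hM.eq.type_left.head_type
  have tA := hA.eq.type_left
  have tC := hC.eq.type_left
  have hX := hA.sum hC
  have hS := Sub.S tX
  have tM := fun {m : ℕ} {Δ : Ctx m} {θ : Fin n → PreExp m} (hθ : Sub T Δ θ Γ) =>
    hM.eq.type_left.sub_type (hθ.lift tX)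
  have tf := fun {m : ℕ} {Δ : Ctx m} {θ : Fin n → PreExp m} (hθ : Sub T Δ θ Γ) =>
    hf.term.sub_term (hθ.lift tA)
  have tg := fun {m : ℕ} {Δ : Ctx m} {θ : Fin n → PreExp m} (hθ : Sub T Δ θ Γ) =>
    hg.term.sub_term (hθ.lift tC)
  have he := Derivable.sum_elim (tM hS) tX.var_zero (l := f.subst (lift PreExp.S))
    (r := g.subst (lift PreExp.S)) (by simpa using tf hS) (by simpa using tg hS)
  replace he : Derivable T (.term (Γ ▹ .sum A C) (PreExp.elSum (A.subst PreExp.S) (C.subst PreExp.S)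
      (M.subst (lift PreExp.S)) (.var 0) (f.subst (lift PreExp.S)) (g.subst (lift PreExp.S))) M) := by
    simpa using he
  have := of_commutes hX hM he hd fun {b m Δ σ σ' a} hr ha => ?_
  · simpa using this
  · have t := (hX.map hr).dom
    have hr' := hr.comp (.S t)
    have h0 := t.var_zero.term_cast rfl
      (A' := (((PreExp.sum A C).tr b).subst (σ ⊚ PreExp.S))) (by simp)
    simp only [tr_sum, PreExp.subst] at t ha
    have h₁ := commutes hX hM he (.S tA) (c := .inl A.wk C.wk (.var 0)) (c' := f)
      (by simpa using TermCoherent.inl (hA.sub (.S tA)) (hC.sub (.S tA)) (.var_zero hA))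
      (by simpa [PreExp.instAt] using hf)
      (by
        have hS := Sub.S tA
        simpa using Derivable.sum_beta_inl (tM hS) tA.var_zero (l := f.subst (lift PreExp.S))
          (r := g.subst (lift PreExp.S)) (by simpa using tf hS) (by simpa using tg hS))
      (hr.lift hA)
    have h₂ := commutes hX hM he (.S tC) (c := .inr A.wk C.wk (.var 0)) (c' := g)
      (by simpa using TermCoherent.inr (hA.sub (.S tC)) (hC.sub (.S tC)) (.var_zero hC))
      (by simpa [PreExp.instAt] using hg)
      (by
        have hS := Sub.S tC
        simpa using Derivable.sum_beta_inr (tM hS) tC.var_zero (l := f.subst (lift PreExp.S))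
          (r := g.subst (lift PreExp.S)) (by simpa using tf hS) (by simpa using tg hS))
      (hr.lift hC)
    have := sum_ext (Γ := Δ) (d := a) (by simpa using hr'.castVal hX hM he h0)
      (by simpa using hr'.valCast hX he h0) (by simpa using h₁) (by simpa using h₂) ha
    simpa using this

end TermCoherent
end

section

variable {T : Theory} [hT : T.Impredicative]

variable {n m l : ℕ} {b : Bool} {Γ : Ctx n} {Δ : Ctx m} {σ σ' θ : Fin n → PreExp m}
  {A a d : PreExp n} {M B f : PreExp (n + 1)} {R g : PreExp (n + 2)} {h : PreExp (n + 3)}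

theorem SubCoherent.lift (h : SubCoherent T Δ θ Γ) (hA : TypeCoherent T Γ A A) :
    SubCoherent T (Δ ▹ A.subst θ) (PreExp.lift θ) (Γ ▹ A) := by
  have hA' := hA.sub h
  simpa using (h.comp (.S hA'.eq.type_left)).scons hA (by simpa using TermCoherent.var_zero hA')

namespace TermCoherent

open Derivable

theorem elSigma (hA : TypeCoherent T Γ A A) (hB : TypeCoherent T (Γ ▹ A) B B)
    (hM : TypeCoherent T (Γ ▹ .sigma A B) M M) (hd : TermCoherent T Γ d (.sigma A B))
    (hg : TermCoherent T (Γ ▹ A ▹ B) g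
      (M.instAt 2 (.pair A.wk.wk (B.subst (PreExp.lift (shift 2))) (.var 1) (.var 0)))) :
    TermCoherent T Γ (elSigma A B M d g) (M.inst d) := by
  have tX := hM.eq.type_left.head_type
  have tA := hA.eq.type_left
  have tB := hB.eq.type_left
  have hX := hA.sigma hB
  have hS := Sub.S tX
  have tM := fun {m : ℕ} {Δ : Ctx m} {θ : Fin n → PreExp m} (hθ : Sub T Δ θ Γ) =>
    hM.eq.type_left.sub_type (hθ.lift tX)
  have tg := fun {m : ℕ} {Δ : Ctx m} {θ : Fin n → PreExp m} (hθ : Sub T Δ θ Γ) =>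
    hg.term.sub_term ((hθ.lift tA).lift tB)
  have he := Derivable.sigma_elim (tM hS) tX.var_zero (A := A.subst PreExp.S)
    (B := B.subst (PreExp.lift PreExp.S))
    (m := g.subst (PreExp.lift (PreExp.lift PreExp.S))) (by simpa using tg hS)
  replace he : Derivable T (.term (Γ ▹ .sigma A B) (PreExp.elSigma (A.subst PreExp.S)
      (B.subst (PreExp.lift PreExp.S)) (M.subst (PreExp.lift PreExp.S)) (.var 0)
      (g.subst (PreExp.lift (PreExp.lift PreExp.S)))) M) := by
    simpa using he
  have := of_commutes hX hM he hd fun {b m Δ σ σ' a} hr ha => ?_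
  · simpa using this
  · have t := (hX.map hr).dom
    have hr' := hr.comp (.S t)
    have h0 := t.var_zero.term_cast rfl
      (A' := (((PreExp.sigma A B).tr b).subst (σ ⊚ PreExp.S))) (by simp)
    simp only [tr_sigma, PreExp.subst] at t ha
    have cκ := (SubCoherent.S tA).comp (.S tB)
    have hc := TermCoherent.pair (hA.sub cκ) (hB.sub (cκ.lift hA)) (a := .var 1) (c := .var 0)
      (by simpa using (TermCoherent.var_zero hA).sub (.S tB))
      (by simpa using TermCoherent.var_zero hB)
    have hS := cκ.sub
    have h₁ := commutes hX hM he cκ (c' := g) (by simpa using hc)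
      (by simpa using hg)
      (by
        simpa using Derivable.sigma_beta (tM hS) (A := A.subst (PreExp.S ⊚ PreExp.S))
          (B := B.subst (PreExp.lift (PreExp.S ⊚ PreExp.S)))
          (m := g.subst (PreExp.lift (PreExp.lift (PreExp.S ⊚ PreExp.S)))) (a := .var 1)
          (b := .var 0) (by simpa using tB.var_one) (by simpa using tB.var_zero)
          (by simpa using tg hS))
      ((hr.lift hA).lift hB)
    have := sigma_ext (Γ := Δ) (d := a) (by simpa using hr'.castVal hX hM he h0)
      (by simpa using hr'.valCast hX he h0) (by simpa using h₁) ha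
    simpa using this

/-- Agreement of two families over a quotient has to be checked on classes only. The compatibility
of `f` serves to type the eliminator and its computation rule. -/
theorem elQuot (hA : TypeCoherent T Γ A A) (hR : TypeCoherent T (Γ ▹ A ▹ A.wk) R R)
    (tQ : Derivable T (.type .set Γ (quot A R)))
    (hM : TypeCoherent T (Γ ▹ .quot A R) M M) (hd : TermCoherent T Γ d (.quot A R))
    (hf : TermCoherent T (Γ ▹ A) f
      (M.instAt 1 (.cls A.wk (R.subst (PreExp.lift (PreExp.lift (shift 1)))) (.var 0))))
    (ef : Derivable T (termEq (Γ ▹ A ▹ A.wk ▹ R) (f.instAt 3 (.var 2)) (f.instAt 3 (.var 1))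
      (M.instAt 3 (.cls A.wk.wk.wk (R.subst (PreExp.lift (PreExp.lift (shift 3)))) (.var 2))))) :
    TermCoherent T Γ (elQuot A R M d f) (M.inst d) := by
  have tX := hM.eq.type_left.head_type
  have tA := hA.eq.type_left
  have tR := hR.eq.type_left
  have hX := hA.quot hR tQ tQ (.typeEq_refl tQ.quot_right)
  have hS := Sub.S tX
  have tM := fun {m : ℕ} {Δ : Ctx m} {θ : Fin n → PreExp m} (hθ : Sub T Δ θ Γ) =>
    hM.eq.type_left.sub_type (hθ.lift tX)
  have tf := fun {m : ℕ} {Δ : Ctx m} {θ : Fin n → PreExp m} (hθ : Sub T Δ θ Γ) =>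
    hf.term.sub_term (hθ.lift tA)
  have te := fun {m : ℕ} {Δ : Ctx m} {θ : Fin n → PreExp m} (hθ : Sub T Δ θ Γ) =>
    ef.sub_termEq (((hθ.lift tA).lift (tA.wk_type tA)).lift tR)
  have he := Derivable.quot_elim (tM hS) tX.var_zero (A := A.subst PreExp.S)
    (R := R.subst (PreExp.lift (PreExp.lift PreExp.S)))
    (l := f.subst (PreExp.lift PreExp.S)) (by simpa using tf hS) (by simpa using te hS)
  replace he : Derivable T (.term (Γ ▹ .quot A R) (PreExp.elQuot (A.subst PreExp.S)
      (R.subst (PreExp.lift (PreExp.lift PreExp.S))) (M.subst (PreExp.lift PreExp.S)) (.var 0)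
      (f.subst (PreExp.lift PreExp.S))) M) := by
    simpa using he
  have := of_commutes hX hM he hd fun {b m Δ σ σ' a} hr ha => ?_
  · simpa using this
  · have t := (hX.map hr).dom
    have hr' := hr.comp (.S t)
    have h0 := t.var_zero.term_cast rfl
      (A' := (((PreExp.quot A R).tr b).subst (σ ⊚ PreExp.S))) (by simp)
    simp only [tr_quot, PreExp.subst] at t ha
    have cκ := SubCoherent.S tA
    have hS := cκ.sub
    have hc := TermCoherent.cls (hA.sub cκ)
      (by
        have := hR.sub ((cκ.lift hA).lift (by simpa using hA.sub (.S tA)))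
        simpa using this)
      (tQ.sub_type hS) (TermCoherent.var_zero hA)
    have h₁ := commutes hX hM he cκ (c' := f) (by simpa using hc)
      (by simpa using hf)
      (by
        simpa using Derivable.quot_beta (tM hS) (A := A.subst PreExp.S)
          (R := R.subst (PreExp.lift (PreExp.lift PreExp.S)))
          (l := f.subst (PreExp.lift PreExp.S)) (a := .var 0)
          (by simpa using tA.var_zero) (by simpa using tf hS) (by simpa using te hS))
      (hr.lift hA)
    have := quot_ext (Γ := Δ) (d := a) (by simpa using hr'.castVal hX hM he h0)
      (by simpa using hr'.valCast hX he h0) (by simpa using h₁) ha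
    simpa using this

end TermCoherent
end

section

variable {T : Theory} [hT : T.Impredicative]

variable {n m l : ℕ} {b : Bool} {Γ : Ctx n} {Δ : Ctx m} {σ σ' θ : Fin n → PreExp m}
  {A a d : PreExp n} {M e : PreExp (n + 1)} {h : PreExp (n + 3)}

/-- The inductive step for the coherence of a function on lists. -/
theorem Commutes.cons {x y : PreExp m} (hA : TypeCoherent T Γ A A)
    (hM : TypeCoherent T (Γ ▹ .list A) M M) (he : Derivable T (.term (Γ ▹ .list A) e M))
    (hh : TermCoherent T (Γ ▹ .list A ▹ A.wk ▹ M.instAt 2 (.var 1)) h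
      (M.instAt 3 (.cons A.wk.wk.wk (.var 2) (.var 1))))
    (eh : Derivable T (termEq (Γ ▹ .list A ▹ A.wk)
      (e.subst (scons (.cons (A.subst (S ⊚ S)) (.var 1) (.var 0)) (S ⊚ S)))
      (h.subst (scons (e.subst (scons (.var 1) (S ⊚ S)))
        (scons (.var 0) (scons (.var 1) (S ⊚ S)))))
      (M.subst (scons (.cons (A.subst (S ⊚ S)) (.var 1) (.var 0)) (S ⊚ S)))))
    (hr : CastRel T b Δ σ σ' Γ)
    (hx : Derivable T (.term Δ x (((PreExp.list A).tr b).subst σ)))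
    (hy : Derivable T (.term Δ y ((A.tr b).subst σ)))
    (ih : Commutes T b Δ (.list A) M e σ σ' x) :
    Commutes T b Δ (.list A) M e σ σ' (.cons ((A.tr b).subst σ) x y) := by
  have hX := hA.list
  have tX := hX.eq.type_left
  have hA₁ : TypeCoherent T (Γ ▹ .list A) A.wk A.wk := by simpa using hA.sub (.S tX)
  have tA₁ := hA₁.eq.type_left
  have cκ := (SubCoherent.S tX).comp (.S tA₁)
  have c₁ := (TermCoherent.var_zero hX).sub (.S tA₁)
  have c₀ := TermCoherent.var_zero hA₁
  have hM₁ := hM.eq.type_left.typeLike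
  have hN : TypeCoherent T (Γ ▹ .list A ▹ A.wk) (M.instAt 2 (.var 1)) (M.instAt 2 (.var 1)) := by
    simpa [PreExp.instAt] using hM.sub (.S tA₁)
  have hc := TermCoherent.cons (hA.sub cκ) (c := .var 1) (a := .var 0) (by simpa using c₁)
    (by simpa using c₀)
  have r₁ := hr.val hX hx
  -- Only the correspondence between y and its coercion matters, so the exact expression for the
  -- latter is hidden.
  obtain ⟨y', r₂⟩ : ∃ y', CastRel T b Δ (scons y (scons x σ))
      (scons y' (scons ((PreExp.cast b (.list A) σ σ').inst x) σ')) (Γ ▹ .list A ▹ A.wk) :=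
    ⟨_, r₁.val hA₁ (by simpa using hy)⟩
  -- The third variable of the branch stands for the recursive value. The induction hypothesis says
  -- precisely that the recursive values on the two sides correspond.
  have r₃ := r₂.scons hN (a := (e.tr b).subst (scons x σ)) (a' := valCast b (.list A) e σ σ' x)
    (by simpa using (he.tr_term b).sub_term r₁.src)
    (by
      have : M.instAt 2 (.var 1) = M.subst S := by simp
      rw [this, cast_tr hM₁]
      unfold Commutes castVal at ih
      simpa [valCast] using ih)
  have hv := hh.cast r₃
  have ea := hc.cast r₂
  have eb := (eh.tr_termEq b).sub_termEq r₂.src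
  have eb' := (eh.tr_termEq (!b)).sub_termEq r₂.tgt
  rw [instAt, cast_tr hM₁] at hv
  rw [← PreExp.subst, cast_tr hX.eq.type_left.typeLike] at ea
  have ha : Derivable T (.term Δ (.cons ((A.tr b).subst σ) x y) (((PreExp.list A).tr b).subst σ)) := by
    simpa using (hc.term.tr_term b).sub_term r₂.src
  have ea' : Derivable T (termEq Δ
      ((PreExp.cast b (.list A) σ σ').inst (.cons ((A.tr b).subst σ) x y))
      (.cons ((A.tr (!b)).subst σ') ((PreExp.cast b (.list A) σ σ').inst x) y')
      (((PreExp.list A).tr (!b)).subst σ')) := by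
    simpa using ea
  have r := hr.scons hX ha ea'
  have ec := hM.congr_apply (.refl r) (by simpa using eb)
  refine .of_cast hr hX hM he ha ea' (ec.termEq_trans ?_)
  simp [valCast] at hv eb' ⊢
  exact hv.termEq_trans eb'.termEq_symm

namespace TermCoherent

open Derivable

theorem elList (hA : TypeCoherent T Γ A A) (hM : TypeCoherent T (Γ ▹ .list A) M M)
    (hd : TermCoherent T Γ d (.list A)) (ha : TermCoherent T Γ a (M.inst (.nil A)))
    (hh : TermCoherent T (Γ ▹ .list A ▹ A.wk ▹ M.instAt 2 (.var 1)) h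
      (M.instAt 3 (.cons A.wk.wk.wk (.var 2) (.var 1)))) :
    TermCoherent T Γ (elList A M d a h) (M.inst d) := by
  have tX := hM.eq.type_left.head_type
  have tA := hA.eq.type_left
  have tA₁ := tA.wk_type tX
  have tN := hh.term.head_type
  have hX := hA.list
  have hS := Sub.S tX
  have tM := fun {m : ℕ} {Δ : Ctx m} {θ : Fin n → PreExp m} (hθ : Sub T Δ θ Γ) =>
    hM.eq.type_left.sub_type (hθ.lift tX)
  have ta := fun {m : ℕ} {Δ : Ctx m} {θ : Fin n → PreExp m} (hθ : Sub T Δ θ Γ) =>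
    ha.term.sub_term hθ
  have th := fun {m : ℕ} {Δ : Ctx m} {θ : Fin n → PreExp m} (hθ : Sub T Δ θ Γ) =>
    hh.term.sub_term (((hθ.lift tX).lift tA₁).lift tN)
  have he := Derivable.list_elim (tM hS) tX.var_zero (A := A.subst S) (a := a.subst S)
    (l := h.subst (PreExp.lift (PreExp.lift (PreExp.lift S)))) (by simpa using ta hS)
    (by simpa using th hS)
  replace he : Derivable T (.term (Γ ▹ .list A) (PreExp.elList (A.subst S)
      (M.subst (PreExp.lift S)) (.var 0) (a.subst S)
      (h.subst (PreExp.lift (PreExp.lift (PreExp.lift S))))) M) := by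
    simpa using he
  have := of_commutes hX hM he hd fun {b m Δ σ σ' d'} hr hd' => ?_
  · simpa using this
  · have t := (hX.map hr).dom
    have hr' := hr.comp (.S t)
    have h0 := t.var_zero.term_cast rfl
      (A' := (((PreExp.list A).tr b).subst (σ ⊚ S))) (by simp)
    simp only [tr_list, PreExp.subst] at t hd'
    have h₁ := commutes hX hM he (.id tX.ctx) (c := .nil A) (c' := a)
      (by simpa using TermCoherent.nil hA) (by simpa [PreExp.inst] using ha)
      (by simpa [PreExp.inst] using Derivable.list_beta_nil hM.eq.type_left ha.term hh.term) hr
    have f₁ := hr'.castVal hX hM he h0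
    have f₂ := hr'.valCast hX he h0
    have tE := Derivable.eq_form (s := .large) f₁.presup f₁ f₂
    have tA₁' := (tA.tr_type b).sub_type hr.src |>.wk_type t
    have tE₂ := tE.sub_type ((Sub.S₂ tA₁').scons (a := .var 1) (by simpa using tA₁'.var_one))
    have hr₃ := hr.comp (.S₃ tE₂)
    have hx := tE₂.var_two
    have hy := tE₂.var_one
    have tN' := tE₂.wk_type tE₂
    -- The last declared variable proves that the families agree at the tail; by reflection this
    -- becomes the judgemental hypothesis of the inductive step.
    have ih := Derivable.eq_reflection (hr₃.castVal hX hM he (by simpa using hx)).presup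
      (hr₃.castVal hX hM he (by simpa using hx)) (hr₃.valCast hX he (by simpa using hx))
      (.prop_true (by simpa using tN') (by simpa using tE₂.var_zero))
    have hθ := Sub.S₂ tA₁
    have eh := Derivable.list_beta_cons (tM hθ) (A := A.subst (S ⊚ S)) (a := a.subst (S ⊚ S))
      (s := .var 1) (b := .var 0) (l := h.subst (PreExp.lift (PreExp.lift (PreExp.lift (S ⊚ S)))))
      (by simpa using tA₁.var_one) (by simpa using tA₁.var_zero) (by simpa using ta hθ)
      (by simpa using th hθ)
    have h₂ := Commutes.cons hA hM he hh (by simpa using eh) hr₃ (by simpa using hx)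
      (by simpa using hy) ih
    have := list_ext (Γ := Δ) (d := d') (by simpa using f₁) (by simpa using f₂)
      (by simpa using h₁) (by simpa using h₂) hd'
    simpa using this

end TermCoherent

end

/-! ### The coherence theorem -/

section

variable {T : Theory}

/-- Coherence of the components of list types and quotients. -/
def ComponentsCoherent (T : Theory) {n : ℕ} (Γ : Ctx n) : PreExp n → Prop
  | .list A => TypeCoherent T Γ A A
  | .quot A R => TypeCoherent T Γ A A ∧ TypeCoherent T (Γ ▹ A ▹ A.wk) R R
  | _ => True

/-- Coherence of all declarations of a context. -/
def CtxCoherent (T : Theory) : {n : ℕ} → Ctx n → Prop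
  | _, .nil => True
  | _, Γ ▹ A => CtxCoherent T Γ ∧ TypeCoherent T Γ A A ∧ ComponentsCoherent T Γ A

/-- Coherence of a judgement. -/
def Judgement.Coherent (T : Theory) {n : ℕ} : Judgement n → Prop
  | .ctx Γ => CtxCoherent T Γ
  | .type _ Γ A => CtxCoherent T Γ ∧ TypeCoherent T Γ A A ∧ ComponentsCoherent T Γ A
  | .typeEq _ Γ A B => CtxCoherent T Γ ∧ TypeCoherent T Γ A B
  | .term Γ a A => CtxCoherent T Γ ∧ TermCoherent T Γ a A
  | .termEq Γ a _ A => CtxCoherent T Γ ∧ TermCoherent T Γ a A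

variable [hT : T.Impredicative]

variable {n m : ℕ} {Γ : Ctx n} {Δ : Ctx m} {θ : Fin n → PreExp m} {A φ : PreExp n} {s : Size}

theorem CtxCoherent.get (h : CtxCoherent T Γ) (i : Fin n) :
    TypeCoherent T Γ (Γ.get i) (Γ.get i) := by
  induction Γ with
  | nil => exact i.elim0
  | snoc Γ A ih =>
    have hS := SubCoherent.S h.2.1.eq.type_left
    cases i using Fin.cases with
    | zero => simpa [Ctx.get_zero] using h.2.1.sub hS
    | succ i => simpa [Ctx.get_succ] using (ih h.1 i).sub hS

theorem ComponentsCoherent.sub (h : ComponentsCoherent T Γ A) (hA : A.TypeLike) (hθ : SubCoherent T Δ θ Γ) :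
    ComponentsCoherent T Δ (A.subst θ) := by
  cases A <;> try first | exact hA.elim | trivial
  case list A => exact TypeCoherent.sub h hθ
  case quot A R =>
    refine ⟨h.1.sub hθ, ?_⟩
    have := h.2.sub ((hθ.lift h.1).lift (by simpa using h.1.sub (.S h.1.eq.type_left)))
    simpa using this

/-- By proof-irrelevance, coherence of a proof follows from coherence of the proposition alone, so
in logical rules the derivations of truth need no analysis. -/
theorem Judgement.Coherent.of_holds (hΓ : CtxCoherent T Γ)
    (hφ : Derivable T (.type (.proposition s) Γ φ)) (h : TypeCoherent T Γ φ φ)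
    (d : Derivable T (.holds Γ φ)) : (Judgement.holds Γ φ).Coherent T :=
  ⟨hΓ, .of_prop hφ h d⟩

theorem Sub.coherent {σ : Fin n → PreExp m} (hσ : Sub T Δ σ Γ) (hΓ : Derivable T (.ctx Γ))
    (h : ∀ i, (Judgement.term Δ (σ i) ((Γ.get i).subst σ)).Coherent T) : SubCoherent T Δ σ Γ :=
  .of_terms hσ hΓ fun i => (h i).2

/-- All derivable judgements are coherent. -/
theorem Derivable.coherent (hp : .propext ∉ T) {J : Judgement n} (h : Derivable T J) :
    J.Coherent T := by
  induction h with
  | ctx_nil => trivial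
  | ctx_snoc _ ih => exact ih
  | var i _ ih => exact ⟨ih, .var i (CtxCoherent.get ih i)⟩
  | type_into _ _ ih => exact ih
  | typeEq_into _ _ ih => exact ih
  | typeEq_refl _ ih => exact ⟨ih.1, ih.2.1⟩
  | typeEq_symm _ ih => exact ⟨ih.1, ih.2.symm⟩
  | typeEq_trans _ _ ih₁ ih₂ => exact ⟨ih₁.1, ih₁.2.trans ih₂.2⟩
  | termEq_refl _ ih => exact ih
  | termEq_symm h ih => exact ⟨ih.1, ih.2.of_eq h⟩
  | termEq_trans _ _ ih₁ _ => exact ih₁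
  | conv _ _ ih₁ ih₂ => exact ⟨ih₁.1, ih₁.2.conv ih₂.2⟩
  | convEq _ _ ih₁ ih₂ => exact ⟨ih₁.1, ih₁.2.conv ih₂.2⟩
  | type_subst hΔ hσ h ihΔ ihσ ih =>
    have c := Sub.coherent ⟨hΔ, hσ⟩ h.ctx ihσ
    exact ⟨ihΔ, ih.2.1.sub c, ih.2.2.sub h.typeLike c⟩
  | typeEq_subst hΔ hσ h ihΔ ihσ ih => exact ⟨ihΔ, ih.2.sub (Sub.coherent ⟨hΔ, hσ⟩ h.ctx ihσ)⟩
  | term_subst hΔ hσ h ihΔ ihσ ih => exact ⟨ihΔ, ih.2.sub (Sub.coherent ⟨hΔ, hσ⟩ h.ctx ihσ)⟩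
  | termEq_subst hΔ hσ h ihΔ ihσ ih => exact ⟨ihΔ, ih.2.sub (Sub.coherent ⟨hΔ, hσ⟩ h.ctx ihσ)⟩
  | type_subst_eq hΔ hσ hτ e h ihΔ ihσ ihτ _ ih =>
    exact ⟨ihΔ, ih.2.1.sub_eq (Sub.coherent ⟨hΔ, hσ⟩ h.ctx ihσ)
      (Sub.coherent ⟨hΔ, hτ⟩ h.ctx ihτ) ⟨⟨hΔ, hσ⟩, ⟨hΔ, hτ⟩, e⟩⟩
  | term_subst_eq hΔ hσ _ _ h ihΔ ihσ _ _ ih =>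
    exact ⟨ihΔ, ih.2.sub (Sub.coherent ⟨hΔ, hσ⟩ h.ctx ihσ)⟩
  | prop_mono _ _ _ _ ih _ => exact ih
  | prop_true hφ h ihφ ih => exact .of_holds ih.1 hφ ihφ.2.1 (.prop_true hφ h)
  | empty_form h ih => exact ⟨ih, .empty h, trivial⟩
  | empty_elim _ _ ihM ih => exact ⟨ih.1, .elEmpty ihM.2.1 ih.2⟩
  | empty_elim_eq _ _ ihM ih => exact ⟨ih.1, .elEmpty ihM.2.left ih.2⟩
  | unit_form h ih => exact ⟨ih, .unit h, trivial⟩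
  | unit_intro h ih => exact ⟨ih, .star h⟩
  | unit_elim _ _ _ ihM ih ihc => exact ⟨ih.1, .elUnit ihM.2.1 ih.2 ihc.2⟩
  | unit_elim_eq _ _ _ ihM ih ihc => exact ⟨ih.1, .elUnit ihM.2.left ih.2 ihc.2⟩
  | unit_beta _ hc ihM ihc => exact ⟨ihc.1, .elUnit ihM.2.1 (.star hc.ctx) ihc.2⟩
  | sigma_form _ _ ihA ihB => exact ⟨ihA.1, ihA.2.1.sigma ihB.2.1, trivial⟩
  | sigma_form_eq _ _ ihA ihB => exact ⟨ihA.1, ihA.2.sigma ihB.2⟩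
  | sigma_intro _ _ _ _ ihA ihB iha ihb => exact ⟨ihA.1, .pair ihA.2.1 ihB.2.1 iha.2 ihb.2⟩
  | sigma_intro_eq _ _ _ _ ihA ihB iha ihb =>
    exact ⟨ihA.1, .pair ihA.2.left ihB.2.left iha.2 ihb.2⟩
  | sigma_elim _ _ _ ihM ih ihm =>
    exact ⟨ih.1, .elSigma ihm.1.1.2.1 ihm.1.2.1 ihM.2.1 ih.2 ihm.2⟩
  | sigma_elim_eq _ _ _ _ _ _ _ ihM ih ihm =>
    exact ⟨ih.1, .elSigma ihm.1.1.2.1 ihm.1.2.1 ihM.2.left ih.2 ihm.2⟩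
  | sigma_beta _ _ _ _ ihM iha ihb ihm =>
    have hA := ihm.1.1.2.1
    have hB := ihm.1.2.1
    exact ⟨iha.1, .elSigma hA hB ihM.2.1 (.pair hA hB iha.2 ihb.2) ihm.2⟩
  | pi_form _ _ ihA ihB => exact ⟨ihA.1, ihA.2.1.pi ihB.2.1, trivial⟩
  | pi_form_eq _ _ ihA ihB => exact ⟨ihA.1, ihA.2.pi ihB.2⟩
  | pi_pow_form h ih => exact ⟨ih.1, ih.2.1.pi (.pow (ctx_snoc h.col)), trivial⟩
  | pi_pow_form_eq h ih => exact ⟨ih.1, ih.2.pi (.pow (ctx_snoc h.type_left.col))⟩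
  | pi_intro _ _ ih ihb => exact ⟨ih.1, .lam ihb.1.2.1 ihb.2⟩
  | pi_intro_eq _ _ _ _ ih _ _ ihb => exact ⟨ih.1, .lam ihb.1.2.1 ihb.2⟩
  | pi_elim _ _ _ ihB ihf iha => exact ⟨ihf.1, .app ihB.1.2.1 ihB.2.1 ihf.2 iha.2⟩
  | pi_elim_eq _ _ _ _ _ ihA ihB _ ihf iha =>
    exact ⟨ihf.1, .app ihA.2.left ihB.2.left ihf.2 iha.2⟩
  | pi_beta _ _ _ ih ihb iha =>
    have hA := ihb.1.2.1
    exact ⟨ih.1, .app hA ihb.2.type (.lam hA ihb.2) iha.2⟩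
  | pi_eta h ih => exact ⟨ih.1, ih.2.of_eq (pi_eta h).termEq_symm⟩
  | sum_form _ _ ihA ihB => exact ⟨ihA.1, ihA.2.1.sum ihB.2.1, trivial⟩
  | sum_form_eq _ _ ihA ihB => exact ⟨ihA.1, ihA.2.sum ihB.2⟩
  | sum_inl _ _ _ ihA ihB ih => exact ⟨ih.1, .inl ihA.2.1 ihB.2.1 ih.2⟩
  | sum_inl_eq _ _ _ ihA ihB ih => exact ⟨ih.1, .inl ihA.2.left ihB.2.left ih.2⟩
  | sum_inr _ _ _ ihA ihB ih => exact ⟨ih.1, .inr ihA.2.1 ihB.2.1 ih.2⟩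
  | sum_inr_eq _ _ _ ihA ihB ih => exact ⟨ih.1, .inr ihA.2.left ihB.2.left ih.2⟩
  | sum_elim _ _ _ _ ihM ih ihl ihr =>
    exact ⟨ih.1, .elSum ihl.1.2.1 ihr.1.2.1 ihM.2.1 ih.2 ihl.2 ihr.2⟩
  | sum_elim_eq _ _ _ _ _ _ _ _ ihM ih ihl ihr =>
    exact ⟨ih.1, .elSum ihl.1.2.1 ihr.1.2.1 ihM.2.left ih.2 ihl.2 ihr.2⟩
  | sum_beta_inl _ _ _ _ ihM ih ihl ihr =>
    have hA := ihl.1.2.1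
    have hB := ihr.1.2.1
    exact ⟨ih.1, .elSum hA hB ihM.2.1 (.inl hA hB ih.2) ihl.2 ihr.2⟩
  | sum_beta_inr _ _ _ _ ihM ih ihl ihr =>
    have hA := ihl.1.2.1
    have hB := ihr.1.2.1
    exact ⟨ih.1, .elSum hA hB ihM.2.1 (.inr hA hB ih.2) ihl.2 ihr.2⟩
  | list_form _ ih => exact ⟨ih.1, ih.2.1.list, ih.2.1⟩
  | list_form_eq _ ih => exact ⟨ih.1, ih.2.list⟩
  | list_nil _ ih => exact ⟨ih.1, .nil ih.2.1⟩
  | list_nil_eq _ ih => exact ⟨ih.1, .nil ih.2.left⟩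
  | list_cons _ _ _ ihA ihs iha => exact ⟨ihA.1, .cons ihA.2.1 ihs.2 iha.2⟩
  | list_cons_eq _ _ _ ihA ihs iha => exact ⟨ihA.1, .cons ihA.2.left ihs.2 iha.2⟩
  -- Coherence of `A` itself, rather than of its weakening, is read off the declaration of List(A)
  -- in the context of the motive; this is why components are recorded.
  | list_elim _ _ _ _ ihM ihs iha ihl =>
    exact ⟨ihs.1, .elList ihM.1.2.2 ihM.2.1 ihs.2 iha.2 ihl.2⟩
  | list_elim_eq _ _ _ _ _ ihA ihM ihs iha ihl =>
    exact ⟨ihs.1, .elList ihA.2.left ihM.2.left ihs.2 iha.2 ihl.2⟩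
  | list_beta_nil _ _ _ ihM iha ihl =>
    exact ⟨iha.1, .elList ihM.1.2.2 ihM.2.1 (.nil ihM.1.2.2) iha.2 ihl.2⟩
  | list_beta_cons _ _ _ _ _ ihM ihs ihb iha ihl =>
    exact ⟨ihs.1, .elList ihM.1.2.2 ihM.2.1 (.cons ihM.1.2.2 ihs.2 ihb.2) iha.2 ihl.2⟩
  | quot_form hA hR h₁ h₂ h₃ ihA ihR =>
    have tQ := quot_form hA hR h₁ h₂ h₃
    exact ⟨ihA.1, ihA.2.1.quot ihR.2.1 tQ tQ (.typeEq_refl hR), ihA.2.1, ihR.2.1⟩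
  | quot_form_eq tQ tQ' _ hR ih _ ihA ihR => exact ⟨ih.1, ihA.2.quot ihR.2 tQ tQ' hR⟩
  | quot_intro tQ _ ih iha => exact ⟨ih.1, .cls ih.2.2.1 ih.2.2.2 tQ iha.2⟩
  | quot_intro_eq tQ _ _ _ _ ih _ _ _ iha => exact ⟨ih.1, .cls ih.2.2.1 ih.2.2.2 tQ iha.2⟩
  | quot_eq tQ _ _ _ ih iha _ _ => exact ⟨ih.1, .cls ih.2.2.1 ih.2.2.2 tQ iha.2⟩
  | quot_eff tQ ha hb h ih iha ihb _ =>
    have c := iha.2.inst.scons (by simpa using ih.2.2.1.sub (.S ih.2.2.1.eq.type_left))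
      (by simpa using ihb.2)
    rw [← wk_eq] at c
    exact .of_holds ih.1 (tQ.quot_right.sub_type c.sub) (ih.2.2.2.sub c) (quot_eff tQ ha hb h)
  | quot_elim _ hp _ ef ihM ih ihl _ =>
    have c := ihM.1.2.2
    exact ⟨ih.1, .elQuot c.1 c.2 (hp.presup.collection _) ihM.2.1 ih.2 ihl.2 ef⟩
  | quot_elim_eq tQ _ _ _ _ _ _ ef ihQ _ _ _ ihM ih ihl _ =>
    have c := ihQ.2.2
    exact ⟨ih.1, .elQuot c.1 c.2 tQ ihM.2.left ih.2 ihl.2 ef⟩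
  | quot_beta hM _ _ ef ihM iha ihl _ =>
    have c := ihM.1.2.2
    have tQ := hM.head_type.collection .small
    exact ⟨iha.1, .elQuot c.1 c.2 tQ ihM.2.1 (.cls c.1 c.2 tQ iha.2) ihl.2 ef⟩
  | pow_form h ih => exact ⟨ih, .pow h, trivial⟩
  | pow_intro h ih => exact ⟨ih.1, .code h ih.2.1⟩
  | pow_intro_eq h ih => exact ⟨ih.1, .code h.type_left ih.2.left⟩
  | pow_eq h _ _ ih => exact ⟨ih.1, .code h ih.2.1⟩
  | pow_eff hφ hψ h ihφ ihψ =>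
    have e₁ := (typeEq_refl hφ)
    have e₂ := (typeEq_refl hψ)
    exact .of_holds ihφ.1 (.and_form (.imp_form hφ hψ) (.imp_form hψ hφ))
      ((ihφ.2.1.imp ihψ.2.1 e₁ e₂).and (ihψ.2.1.imp ihφ.2.1 e₂ e₁)
        (imp_form_eq e₁ e₂) (imp_form_eq e₂ e₁)) (pow_eff hφ hψ h)
  | pow_eta _ ih => exact ih
  | pow_eq_small h h' ih ih' =>
    exact ⟨ih.1, .eq_prop (.pow h.ctx) ih.2 ih'.2 h.termEq_refl h'.termEq_refl, trivial⟩
  | pow_eq_small_eq h h' ih ih' => exact ⟨ih.1, .eq_prop (.pow h.ctx) ih.2 ih'.2 h h'⟩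
  | bot_form h ih => exact ⟨ih, .bot h, trivial⟩
  | bot_elim hφ h ihφ _ => exact .of_holds ihφ.1 hφ ihφ.2.1 (bot_elim hφ h)
  | and_form hφ hψ ihφ ihψ =>
    exact ⟨ihφ.1, ihφ.2.1.and ihψ.2.1 (typeEq_refl hφ) (typeEq_refl hψ), trivial⟩
  | and_form_eq hφ hψ ihφ ihψ => exact ⟨ihφ.1, ihφ.2.and ihψ.2 hφ hψ⟩
  | and_intro hφ hψ h h' ihφ ihψ _ _ =>
    exact .of_holds ihφ.1 (and_form hφ hψ)
      (ihφ.2.1.and ihψ.2.1 (typeEq_refl hφ) (typeEq_refl hψ)) (and_intro hφ hψ h h')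
  | and_left hφ hψ h ihφ _ _ => exact .of_holds ihφ.1 hφ ihφ.2.1 (and_left hφ hψ h)
  | and_right hφ hψ h _ ihψ _ => exact .of_holds ihψ.1 hψ ihψ.2.1 (and_right hφ hψ h)
  | or_form hφ hψ ihφ ihψ =>
    exact ⟨ihφ.1, ihφ.2.1.or ihψ.2.1 (typeEq_refl hφ) (typeEq_refl hψ), trivial⟩
  | or_form_eq hφ hψ ihφ ihψ => exact ⟨ihφ.1, ihφ.2.or ihψ.2 hφ hψ⟩
  | or_inl hφ hψ h ihφ ihψ _ =>
    exact .of_holds ihφ.1 (or_form hφ hψ)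
      (ihφ.2.1.or ihψ.2.1 (typeEq_refl hφ) (typeEq_refl hψ)) (or_inl hφ hψ h)
  | or_inr hφ hψ h ihφ ihψ _ =>
    exact .of_holds ihφ.1 (or_form hφ hψ)
      (ihφ.2.1.or ihψ.2.1 (typeEq_refl hφ) (typeEq_refl hψ)) (or_inr hφ hψ h)
  | or_elim hφ hψ hχ h h₁ h₂ _ _ ihχ =>
    exact .of_holds ihχ.1 hχ ihχ.2.1 (or_elim hφ hψ hχ h h₁ h₂)
  | imp_form hφ hψ ihφ ihψ =>
    exact ⟨ihφ.1, ihφ.2.1.imp ihψ.2.1 (typeEq_refl hφ) (typeEq_refl hψ), trivial⟩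
  | imp_form_eq hφ hψ ihφ ihψ => exact ⟨ihφ.1, ihφ.2.imp ihψ.2 hφ hψ⟩
  | imp_intro hφ hψ h ihφ ihψ _ =>
    exact .of_holds ihφ.1 (imp_form hφ hψ)
      (ihφ.2.1.imp ihψ.2.1 (typeEq_refl hφ) (typeEq_refl hψ)) (imp_intro hφ hψ h)
  | imp_elim hφ hψ h h' _ ihψ _ _ => exact .of_holds ihψ.1 hψ ihψ.2.1 (imp_elim hφ hψ h h')
  | ex_form hA hφ ihA ihφ =>
    exact ⟨ihA.1, ihA.2.1.ex ihφ.2.1 (typeEq_refl hφ), trivial⟩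
  | ex_form_eq hA hφ ihA ihφ => exact ⟨ihA.1, ihA.2.ex ihφ.2 hφ⟩
  | ex_intro hφ ha h ihφ iha _ =>
    have hA := ihφ.1.2.1
    exact .of_holds iha.1 (ex_form (s := .large) hA.eq.type_left hφ)
      (hA.ex ihφ.2.1 (typeEq_refl hφ)) (ex_intro hφ ha h)
  | ex_elim hφ hχ h h' _ ihχ => exact .of_holds ihχ.1 hχ ihχ.2.1 (ex_elim hφ hχ h h')
  | all_form hA hφ ihA ihφ =>
    exact ⟨ihA.1, ihA.2.1.all ihφ.2.1 (typeEq_refl hφ), trivial⟩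
  | all_form_eq hA hφ ihA ihφ => exact ⟨ihA.1, ihA.2.all ihφ.2 hφ⟩
  | all_intro hφ h ihφ _ =>
    have hA := ihφ.1.2.1
    exact .of_holds ihφ.1.1 (all_form (s := .large) hA.eq.type_left hφ)
      (hA.all ihφ.2.1 (typeEq_refl hφ)) (all_intro hφ h)
  | all_elim hφ h ha ihφ _ iha =>
    have c := iha.2.inst
    exact .of_holds iha.1 (hφ.sub_type c.sub) (ihφ.2.1.sub c) (all_elim hφ h ha)
  | eq_form hA ha hb ihA iha ihb =>
    exact ⟨ihA.1, .eq_prop ihA.2.1 iha.2 ihb.2 ha.termEq_refl hb.termEq_refl, trivial⟩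
  | eq_form_eq hA ha hb ihA iha ihb => exact ⟨ihA.1, .eq_prop ihA.2 iha.2 ihb.2 ha hb⟩
  | eq_intro hA ha ihA iha =>
    exact .of_holds ihA.1 (eq_form (s := .large) hA ha ha)
      (.eq_prop ihA.2.1 iha.2 iha.2 ha.termEq_refl ha.termEq_refl) (eq_intro hA ha)
  | eq_reflection _ _ _ _ _ iha _ _ => exact iha
  | lem hl hφ ih =>
    have e := typeEq_refl hφ
    have tb' := (bot_type (s := .large) hφ.ctx).typeEq_refl
    exact .of_holds ih.1 (or_form hφ (imp_form hφ (bot_type hφ.ctx)))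
      (ih.2.1.or (ih.2.1.imp (.bot hφ.ctx) e tb') e (imp_form_eq e tb')) (lem hl hφ)
  | propext h => exact absurd h hp

end

/-! ### Conservativity -/

section

variable {T : Theory} [hT : T.Impredicative] {n : ℕ} {Γ : Ctx n}

/-- The variables of a context are carried by the coercions to its canonical form. -/
theorem CtxCoherent.exists_castRel (h : CtxCoherent T Γ) : ∃ τ, CastRel T false Γ var τ Γ := by
  induction Γ with
  | nil => exact ⟨var, .id .ctx_nil, .id .ctx_nil, fun i => i.elim0, fun i => i.elim0⟩
  | snoc Γ A ih =>
    obtain ⟨τ, hr⟩ := ih h.1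
    exact ⟨_, by simpa [PreExp.tr] using hr.lift h.2.1⟩

theorem Theory.conservativeOver (hp : .propext ∉ T) : T.addPropext.ConservativeOver T := by
  intro n Γ φ hφ d
  have c := hφ.coherent hp
  obtain ⟨τ, hr⟩ := c.1.exists_castRel
  -- The translated derivation lives over the canonical context; substituting the coerced variables
  -- brings it back to Γ. The reversed correspondence then leads from the canonical form of φ to φ
  -- itself.
  have h := (Derivable.canon (T := T) (fun _ h => h) d).sub_term hr.tgt
  simpa [PreExp.tr] using c.2.1.entails hφ hr.symm h

end

instance : emTTimp.Impredicative := ⟨rfl⟩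

instance : emTTcimp.Impredicative := ⟨.inl rfl⟩

end EmTT

theorem propositiona5 :
    EmTT.emTTimp.addPropext.ConservativeOver EmTT.emTTimp ∧
      EmTT.emTTcimp.addPropext.ConservativeOver EmTT.emTTcimp :=
  ⟨EmTT.Theory.conservativeOver (by simp [EmTT.emTTimp]),
    EmTT.Theory.conservativeOver (by simp [EmTT.emTTcimp])⟩
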